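/- Let $\lambda,\mu,r,\zeta^+,\zeta^-$ be real with $0<\lambda<\mu$ and $r>0$, and put $\nu=\lambda/\mu<1$ and $\omega_n=n(n+r-1)$. On $\mathsf h=\ell^2(\mathbb N)$ with canonical orthonormal basis $(e_n)_{n\ge0}$ let $Be_n=\omega_n^{1/2}e_{n-1}$ (with $Be_0=0$) and $B^+e_n=\omega_{n+1}^{1/2}e_{n+1}$, and put $$G=-\tfrac{\lambda^2}{2}BB^+-\tfrac{\mu^2}{2}B^+B-\mathrm i(\zeta^+BB^++\zeta^-B^+B),\qquad L_1=\mu B,\qquad L_2=\lambda B^+ .$$ Let $P_t$ be the contraction semigroup generated by $G$ (it is diagonal in the basis $(e_n)$), and let $\mathcal T=(\mathcal T_t)_{t\ge0}$ be the minimal quantum dynamical semigroup on $\mathcal B(\mathsf h)$ associated with $G,L_1,L_2$, i.e. the limit of the Picard iterates of the Lindblad equation $$\langle v,\mathcal T_t(x)u\rangle=\langle P_tv,xP_tu\rangle+\sum_{\ell=1}^2\int_0^t\langle L_\ell P_{t-s}v,\mathcal T_s(x)L_\ell P_{t-s}u\rangle\,ds ,$$ where $u,v$ range over the linear span of the $e_n$.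 Let $\rho=(1-\nu^2)\sum_{n\ge0}\nu^{2n}|e_n\rangle\langle e_n|$, let $L_2(\mathsf h)$ be the space of Hilbert–Schmidt operators with inner product $\langle x,y\rangle=\mathrm{tr}(x^*y)$, and let $\iota(x)=\rho^{1/4}x\rho^{1/4}$ for $x\in\mathcal B(\mathsf h)$. Let $T=(T_t)_{t\ge0}$ be the semigroup of bounded operators on $L_2(\mathsf h)$ determined by $T_t(\iota(x))=\iota(\mathcal T_t(x))$ for all $x\in\mathcal B(\mathsf h)$, let $L$ be its generator, with domain $D(L)$, and let $$\mathrm{gap}\,L=\inf\{-\mathrm{Re}\langle\xi,L\xi\rangle:\ \xi\in D(L),\ \|\xi\|=1,\ \xi\in(\mathrm{Ker}\,L)^\perp\}.$$ Let $\Phi(z,n,r)=\sum_{k\ge0}z^k/(k+r)^n$ be the Lerch function. If $\left(2\nu^2+r(1-\nu^2)\right)\Phi(\nu^2,1,r)\le2$, then $$\mathrm{gap}\,L=\frac{\mu^2}{2}\left(2\nu^2+r(1-\nu^2)\right).$$ In particular, this identity holds whenever $r\ge 2\nu^2/(1-\nu^2)$. -/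

import Mathlib

open Filter Topology InnerProductSpace

noncomputable section

/-! ## Hilbert-Schmidt operators on `ℓ²(ℕ)` -/

/-- The Hilbert space `ℓ²(ℕ)`. -/
abbrev FockSpace : Type := lp (fun _ : ℕ => ℂ) 2

/-- The canonical orthonormal basis vector `eₙ` (written `ket n`) of `ℓ²(ℕ)`. -/
def ket (n : ℕ) : FockSpace := lp.single 2 n (1 : ℂ)

/-- Bounded operators `x` on `ℓ²(ℕ)` with `∑ₙ ‖x eₙ‖² < ∞`. -/
def hsSubmodule : Submodule ℂ (FockSpace →L[ℂ] FockSpace) where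
  carrier := {x | Memℓp (fun n => x (ket n)) 2}
  zero_mem' := zero_memℓp
  add_mem' := fun hx hy => hx.add hy
  smul_mem' := fun c _ hx => hx.const_smul c

/-- The space of Hilbert-Schmidt operators on `ℓ²(ℕ)`. It is a type of its own, so that it does not
inherit the operator norm. -/
def HilbertSchmidt : Type := hsSubmodule

namespace HilbertSchmidt

instance : AddCommGroup HilbertSchmidt := inferInstanceAs (AddCommGroup hsSubmodule)
instance : Module ℂ HilbertSchmidt := inferInstanceAs (Module ℂ hsSubmodule)

/-- The underlying bounded operator of a Hilbert-Schmidt operator. -/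
def toOp : HilbertSchmidt →ₗ[ℂ] (FockSpace →L[ℂ] FockSpace) := hsSubmodule.subtype

/-- The sequence `(x eₙ)ₙ` of columns of a Hilbert-Schmidt operator, an element of `ℓ²(ℕ; ℓ²(ℕ))`. -/
def columns (x : HilbertSchmidt) : lp (fun _ : ℕ => FockSpace) 2 :=
  ⟨fun n => toOp x (ket n), x.2⟩

theorem summable_inner (x y : HilbertSchmidt) :
    Summable fun n => inner ℂ (toOp x (ket n)) (toOp y (ket n)) :=
  lp.summable_inner (columns x) (columns y)

theorem ext_columns {x : HilbertSchmidt} (hx : ∀ n, toOp x (ket n) = 0) : x = 0 := by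
  apply Subtype.ext
  show toOp x = 0
  ext1 v
  have h := lp.hasSum_single (p := 2) (by norm_num) v
  have h2 := h.mapL (toOp x)
  have h3 : ∀ n, toOp x (lp.single 2 n (v n)) = 0 := by
    intro n
    have : lp.single 2 n (v n) = (v n) • ket n := by
      rw [ket, ← lp.single_smul]; simp
    rw [this, map_smul, hx, smul_zero]
  simp only [h3] at h2
  exact h2.unique hasSum_zero

/-- The inner product `⟨x, y⟩ = tr (x* y) = ∑ₙ ⟨x eₙ, y eₙ⟩`. -/
@[reducible] def core : InnerProductSpace.Core ℂ HilbertSchmidt where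
  inner x y := ∑' n, inner ℂ (toOp x (ket n)) (toOp y (ket n))
  conj_inner_symm x y := by
    rw [Complex.conj_tsum]
    simp
  re_inner_nonneg x := by
    have h := Complex.reCLM.map_tsum (summable_inner x x)
    simp only [Complex.reCLM_apply] at h
    simp only [RCLike.re_to_complex]
    rw [h]
    exact tsum_nonneg fun n => inner_self_nonneg (𝕜 := ℂ)
  add_left x y z := by
    rw [← (summable_inner x z).tsum_add (summable_inner y z)]
    simp
  smul_left x y r := by
    rw [← tsum_mul_left]
    simp [mul_comm]
  definite x hx := by
    have h : inner ℂ (columns x) (columns x) = 0 := by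
      rw [lp.inner_eq_tsum]; exact hx
    rw [inner_self_eq_zero] at h
    exact ext_columns fun n => congrFun (congrArg Subtype.val h) n

instance : NormedAddCommGroup HilbertSchmidt := core.toNormedAddCommGroup
instance : InnerProductSpace ℂ HilbertSchmidt := InnerProductSpace.ofCore core.toCore

theorem inner_eq (x y : HilbertSchmidt) :
    inner ℂ x y = ∑' n, inner ℂ (toOp x (ket n)) (toOp y (ket n)) := rfl

end HilbertSchmidt

/-! ## Generators, Dirichlet forms and spectral gaps of operator semigroups -/

section Generator

variable {E : Type*} [NormedAddCommGroup E] [InnerProductSpace ℂ E]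

/-- The infinitesimal generator of a one-parameter family `(T t)` of bounded operators: its domain
consists of the `ξ` for which `lim_{t → 0+} (T t ξ - ξ) / t` exists, and its value at `ξ` is this
limit. -/
def generator (T : ℝ → E →L[ℂ] E) : E →ₗ.[ℂ] E where
  domain :=
    { carrier := {ξ | ∃ η, Tendsto (fun t : ℝ => (t : ℂ)⁻¹ • (T t ξ - ξ)) (𝓝[>] 0) (𝓝 η)}
      zero_mem' := ⟨0, by simp⟩
      add_mem' := by
        rintro a b ⟨η, hη⟩ ⟨θ, hθ⟩
        refine ⟨η + θ, (hη.add hθ).congr fun t => ?_⟩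
        rw [← smul_add, map_add]
        congr 1
        abel
      smul_mem' := by
        rintro c a ⟨η, hη⟩
        refine ⟨c • η, (hη.const_smul c).congr fun t => ?_⟩
        rw [map_smul, ← smul_sub, smul_comm] }
  toFun :=
    { toFun := fun ξ => ξ.2.choose
      map_add' := by
        intro a b
        refine tendsto_nhds_unique (a + b).2.choose_spec
          ((a.2.choose_spec.add b.2.choose_spec).congr fun t => ?_)
        rw [← smul_add, Submodule.coe_add, map_add]
        congr 1
        abel
      map_smul' := by
        intro c a
        refine tendsto_nhds_unique (c • a).2.choose_spec
          ((a.2.choose_spec.const_smul c).congr fun t => ?_)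
        rw [Submodule.coe_smul, map_smul, ← smul_sub, smul_comm] }

theorem generator_spec (T : ℝ → E →L[ℂ] E) (ξ : (generator T).domain) :
    Tendsto (fun t : ℝ => (t : ℂ)⁻¹ • (T t ξ - ξ)) (𝓝[>] 0) (𝓝 (generator T ξ)) :=
  ξ.2.choose_spec

/-- The kernel `{ξ ∈ D(L) | L ξ = 0}` of an unbounded operator `L`. -/
def kernel (L : E →ₗ.[ℂ] E) : Submodule ℂ E :=
  (LinearMap.ker L.toFun).map L.domain.subtype

/-- The Dirichlet form `-Re ⟨ξ, L ξ⟩`, for `ξ ∈ D(L)`. -/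
def dirichletForm (L : E →ₗ.[ℂ] E) (ξ : L.domain) : ℝ :=
  -(inner ℂ (ξ : E) (L ξ)).re

/-- The spectral gap of `L`: the infimum of the Dirichlet form over the unit vectors of `D(L)` that
are orthogonal to the kernel of `L`. -/
def spectralGap (L : E →ₗ.[ℂ] E) : ℝ :=
  sInf {a | ∃ ξ : L.domain, ‖(ξ : E)‖ = 1 ∧ (ξ : E) ∈ (kernel L)ᗮ ∧ dirichletForm L ξ = a}

end Generator

/-! ## The quadratic open quantum harmonic oscillator -/

/-- The real parameters of the quadratic open quantum harmonic oscillator, in the regime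
`0 < λ < μ` (that is, `ν = λ / μ < 1`) in which there is an invariant state: `r > 0` determines the Fock representation,
`zp` and `zm` are the coefficients `ζ⁺` and `ζ⁻` of the Hamiltonian. -/
structure QuadraticOscillator where
  lam : ℝ
  mu : ℝ
  r : ℝ
  zp : ℝ
  zm : ℝ
  lam_pos : 0 < lam
  lam_lt_mu : lam < mu
  r_pos : 0 < r

namespace QuadraticOscillator

variable (Q : QuadraticOscillator)

/-- `ν = λ / μ`. -/
def nu : ℝ := Q.lam / Q.mu

theorem mu_pos : 0 < Q.mu := Q.lam_pos.trans Q.lam_lt_mu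
theorem nu_pos : 0 < Q.nu := div_pos Q.lam_pos Q.mu_pos
theorem nu_lt_one : Q.nu < 1 := (div_lt_one Q.mu_pos).2 Q.lam_lt_mu

/-- `ωₙ = n (n + r - 1)`. -/
def omega (n : ℕ) : ℝ := n * (n + Q.r - 1)

theorem omega_nonneg (n : ℕ) : 0 ≤ Q.omega n := by
  rcases n with _ | n
  · simp [omega]
  · have := Q.r_pos
    unfold omega
    push_cast
    have : (0 : ℝ) ≤ n := n.cast_nonneg
    apply mul_nonneg <;> linarith

/-- The linear span of the vectors `ket n`, as a space of finitely supported sequences: a common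
invariant core of all the unbounded operators below. -/
abbrev Core : Type := ℕ →₀ ℂ

/-- The inclusion of the span of the `ket n` into `ℓ²(ℕ)`. -/
def incl : Core →ₗ[ℂ] FockSpace := Finsupp.linearCombination ℂ ket

/-- The annihilation operator: `B eₙ = √ωₙ eₙ₋₁` for `n > 0`, and `B e₀ = 0` (since `ω₀ = 0`). -/
def B : Core →ₗ[ℂ] Core :=
  Finsupp.linearCombination ℂ fun n => Finsupp.single (n - 1) (Real.sqrt (Q.omega n) : ℂ)

/-- The creation operator: `B⁺ eₙ = √ωₙ₊₁ eₙ₊₁`. -/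
def Bplus : Core →ₗ[ℂ] Core :=
  Finsupp.linearCombination ℂ fun n => Finsupp.single (n + 1) (Real.sqrt (Q.omega (n + 1)) : ℂ)

/-- `G = -(λ²/2) B B⁺ - (μ²/2) B⁺ B - i (ζ⁺ B B⁺ + ζ⁻ B⁺ B)`. -/
def G : Core →ₗ[ℂ] Core :=
  -((Q.lam ^ 2 / 2 : ℝ) : ℂ) • (Q.B ∘ₗ Q.Bplus) - ((Q.mu ^ 2 / 2 : ℝ) : ℂ) • (Q.Bplus ∘ₗ Q.B)
    - Complex.I • ((Q.zp : ℂ) • (Q.B ∘ₗ Q.Bplus) + (Q.zm : ℂ) • (Q.Bplus ∘ₗ Q.B))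

/-- The Lindblad operator `L₁ = μ B`. -/
def L1 : Core →ₗ[ℂ] Core := (Q.mu : ℂ) • Q.B

/-- The Lindblad operator `L₂ = λ B⁺`. -/
def L2 : Core →ₗ[ℂ] Core := (Q.lam : ℂ) • Q.Bplus

/-- The eigenvalue of `G` at `ket n`. -/
def gEig (n : ℕ) : ℂ :=
  -((Q.lam ^ 2 / 2 : ℝ) + Complex.I * Q.zp) * Q.omega (n + 1)
    - ((Q.mu ^ 2 / 2 : ℝ) + Complex.I * Q.zm) * Q.omega n

theorem G_single (n : ℕ) : Q.G (Finsupp.single n 1) = Q.gEig n • Finsupp.single n 1 := by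
  have hs : ∀ k, ((Real.sqrt (Q.omega k) : ℝ) : ℂ) * (Real.sqrt (Q.omega k) : ℝ) = Q.omega k := by
    intro k
    rw [← Complex.ofReal_mul, Real.mul_self_sqrt (Q.omega_nonneg k)]
  have h1 : Q.B (Q.Bplus (Finsupp.single n 1)) = Finsupp.single n (Q.omega (n + 1) : ℂ) := by
    simp [B, Bplus, hs]
  have h2 : Q.Bplus (Q.B (Finsupp.single n 1)) = Finsupp.single n (Q.omega n : ℂ) := by
    rcases n with _ | n
    · simp [B, Bplus, omega]
    · simp [B, Bplus, hs]
  simp only [G, LinearMap.sub_apply, LinearMap.smul_apply, LinearMap.add_apply,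
    LinearMap.comp_apply, h1, h2, gEig]
  ext m
  by_cases h : n = m
  · subst h; simp; ring
  · simp [h]

/-- The contraction semigroup `P t = exp (t G)`, which is diagonal in the basis `(ket n)`. -/
def P (t : ℝ) : Core →ₗ[ℂ] Core :=
  Finsupp.linearCombination ℂ fun n => Finsupp.single n (Complex.exp (t * Q.gEig n))

/-- The Picard iterates of the Lindblad equation
`⟨v, 𝒯ₜ(x) u⟩ = ⟨Pₜ v, x Pₜ u⟩ + ∑_{l = 1, 2} ∫₀ᵗ ⟨L_l Pₜ₋ₛ v, 𝒯ₛ(x) L_l Pₜ₋ₛ u⟩ ds`,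
as forms on the span of the `ket n`. -/
def picard : ℕ → ℝ → (FockSpace →L[ℂ] FockSpace) → Core → Core → ℂ
  | 0, t, x, v, u => inner ℂ (incl (Q.P t v)) (x (incl (Q.P t u)))
  | k + 1, t, x, v, u =>
      inner ℂ (incl (Q.P t v)) (x (incl (Q.P t u)))
        + ∫ s in (0 : ℝ)..t,
            (picard k s x (Q.L1 (Q.P (t - s) v)) (Q.L1 (Q.P (t - s) u))
              + picard k s x (Q.L2 (Q.P (t - s) v)) (Q.L2 (Q.P (t - s) u)))

/-- `y = 𝒯ₜ(x)`: the bounded operator `y` is the limit of the Picard iterates at time `t`. Since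
the span of the `ket n` is dense, there is at most one such `y`. -/
def IsPicardLimit (t : ℝ) (x y : FockSpace →L[ℂ] FockSpace) : Prop :=
  ∀ v u : Core, Tendsto (fun k => Q.picard k t x v u) atTop (𝓝 (inner ℂ (incl v) (y (incl u))))

/-- The minimal quantum dynamical semigroup `𝒯ₜ` on the bounded operators on `ℓ²(ℕ)` associated
with `G`, `L₁`, `L₂`: the limit of the Picard iterates of the Lindblad equation. -/
def qms (t : ℝ) (x : FockSpace →L[ℂ] FockSpace) : FockSpace →L[ℂ] FockSpace :=
  Classical.epsilon fun y => Q.IsPicardLimit t x y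

/-- The eigenvalues `(1 - ν²) ν²ⁿ` of the invariant state. -/
def rhoEig (n : ℕ) : ℝ := (1 - Q.nu ^ 2) * Q.nu ^ (2 * n)

/-- The power `ρ^a`, `a > 0`, of the invariant state `ρ = (1 - ν²) ∑ₙ ν²ⁿ |eₙ⟩⟨eₙ|`, that is,
`ρ^a = ∑ₙ ((1 - ν²) ν²ⁿ)^a |eₙ⟩⟨eₙ|` (a series that converges in operator norm). -/
def rhoPow (a : ℝ) : FockSpace →L[ℂ] FockSpace :=
  ∑' n, ((Q.rhoEig n ^ a : ℝ) : ℂ) • rankOne ℂ (ket n) (ket n)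

theorem rhoEig_pos (n : ℕ) : 0 < Q.rhoEig n :=
  mul_pos (by nlinarith [Q.nu_pos, Q.nu_lt_one]) (pow_pos Q.nu_pos _)

theorem summable_rhoEig_rpow {a : ℝ} (ha : 0 < a) : Summable fun n => Q.rhoEig n ^ a := by
  have h : ∀ n, Q.rhoEig n ^ a = (1 - Q.nu ^ 2) ^ a * ((Q.nu ^ 2) ^ a) ^ n := by
    intro n
    have h1 : 0 ≤ 1 - Q.nu ^ 2 := by nlinarith [Q.nu_pos, Q.nu_lt_one]
    rw [rhoEig, Real.mul_rpow h1 (by have := Q.nu_pos; positivity), pow_mul,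
      ← Real.rpow_natCast (Q.nu ^ 2) n, ← Real.rpow_natCast ((Q.nu ^ 2) ^ a) n,
      ← Real.rpow_mul (sq_nonneg _), ← Real.rpow_mul (sq_nonneg _), mul_comm a]
  simp only [h]
  refine (summable_geometric_of_lt_one (by positivity) ?_).mul_left _
  exact Real.rpow_lt_one (sq_nonneg _) (by nlinarith [Q.nu_pos, Q.nu_lt_one]) ha

theorem norm_ket (n : ℕ) : ‖ket n‖ = 1 := by
  simp [ket, lp.norm_single]

theorem inner_ket (m n : ℕ) : inner ℂ (ket m) (ket n) = if m = n then (1 : ℂ) else 0 := by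
  rw [ket, lp.inner_single_left, ket, lp.single_apply]
  by_cases h : m = n
  · subst h; simp
  · simp [h]

theorem summable_rhoPow {a : ℝ} (ha : 0 < a) :
    Summable fun n => ((Q.rhoEig n ^ a : ℝ) : ℂ) • rankOne ℂ (ket n) (ket n) := by
  refine Summable.of_norm ((Q.summable_rhoEig_rpow ha).congr fun n => ?_)
  rw [norm_smul, norm_rankOne, norm_ket, mul_one, mul_one, Complex.norm_real, Real.norm_of_nonneg]
  exact Real.rpow_nonneg (Q.rhoEig_pos n).le _

theorem rhoPow_ket {a : ℝ} (ha : 0 < a) (n : ℕ) :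
    Q.rhoPow a (ket n) = ((Q.rhoEig n ^ a : ℝ) : ℂ) • ket n := by
  have h := (Q.summable_rhoPow ha).hasSum.mapL (ContinuousLinearMap.apply ℂ FockSpace (ket n))
  refine h.unique ?_
  convert hasSum_single n ?_ using 1
  · rw [ContinuousLinearMap.apply_apply, _root_.smul_apply, rankOne_apply, inner_ket,
      if_pos rfl, one_smul]
  · intro m hm
    simp [inner_ket, hm]

theorem embedding_mem (x : FockSpace →L[ℂ] FockSpace) :
    Q.rhoPow (1 / 4) ∘L x ∘L Q.rhoPow (1 / 4) ∈ hsSubmodule := by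
  have h4 : (0 : ℝ) < 1 / 4 := by norm_num
  show Memℓp _ 2
  rw [memℓp_gen_iff (by norm_num)]
  refine Summable.of_nonneg_of_le (fun n => by positivity) (fun n => ?_)
    ((Q.summable_rhoEig_rpow (a := 1 / 2) (by norm_num)).mul_left
      (‖Q.rhoPow (1 / 4) ∘L x‖ ^ 2))
  have h1 : (Q.rhoPow (1 / 4) ∘L x ∘L Q.rhoPow (1 / 4)) (ket n)
      = ((Q.rhoEig n ^ (1 / 4 : ℝ) : ℝ) : ℂ) • (Q.rhoPow (1 / 4) ∘L x) (ket n) := by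
    simp only [ContinuousLinearMap.comp_apply, Q.rhoPow_ket h4, map_smul]
  have h0 := (Q.rhoEig_pos n).le
  have h2 : ‖(Q.rhoPow (1 / 4) ∘L x) (ket n)‖ ≤ ‖Q.rhoPow (1 / 4) ∘L x‖ := by
    simpa [norm_ket] using (Q.rhoPow (1 / 4) ∘L x).le_opNorm (ket n)
  have h3 : (Q.rhoEig n ^ (1 / 4 : ℝ)) ^ 2 = Q.rhoEig n ^ (1 / 2 : ℝ) := by
    rw [← Real.rpow_natCast, ← Real.rpow_mul h0]; norm_num
  rw [h1, norm_smul, Complex.norm_real, Real.norm_of_nonneg (Real.rpow_nonneg h0 _)]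
  have : (2 : ENNReal).toReal = ((2 : ℕ) : ℝ) := by norm_num
  rw [this, Real.rpow_natCast, mul_pow, h3, mul_comm]
  have := Real.rpow_nonneg h0 (1 / 2)
  gcongr

/-- The embedding `ι(x) = ρ^{1/4} x ρ^{1/4}` of the bounded operators into the Hilbert-Schmidt
operators. -/
def embedding (x : FockSpace →L[ℂ] FockSpace) : HilbertSchmidt :=
  ⟨Q.rhoPow (1 / 4) ∘L x ∘L Q.rhoPow (1 / 4), Q.embedding_mem x⟩

/-- The semigroup `T` on the Hilbert-Schmidt operators: `T t` is the bounded operator determined by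
`T t (ι x) = ι (𝒯ₜ x)` for all bounded `x` (the range of `ι` is dense). -/
def hsSemigroup (t : ℝ) : HilbertSchmidt →L[ℂ] HilbertSchmidt :=
  Classical.epsilon fun S => ∀ x, S (Q.embedding x) = Q.embedding (Q.qms t x)

/-- The generator `L` of the semigroup on the Hilbert-Schmidt operators. -/
def L : HilbertSchmidt →ₗ.[ℂ] HilbertSchmidt := generator Q.hsSemigroup

end QuadraticOscillator

/-- The Lerch function `Φ(z, n, r) = ∑_{k ≥ 0} zᵏ / (k + r)ⁿ`, for real `|z| < 1` and `r > 0`. -/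
def lerchPhi (z : ℝ) (n : ℕ) (r : ℝ) : ℝ := ∑' k : ℕ, z ^ k / ((k : ℝ) + r) ^ n

end

noncomputable section

namespace QuadraticOscillator

/-! ## Matrices of operators on `ℓ²(ℕ)` -/

/-! Everything is computed on the entries b(m,n) = ⟨eₘ, x eₙ⟩. There the Lindblad equation is a
linear system coupling (m,n) only to (m±1,n±1), so every diagonal n - m = const evolves by itself,
and ι becomes multiplication by the square root of w(m,n) = (1-ν²)ν^(m+n). Detailed balance, μ²
w(m+1,n+1) = λ² w(m,n), turns the energy Σ w Re(conj b · 𝓛b) into a sum of nearest-neighbour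
expressions along the diagonals.

Off the main diagonal (`density_le_of_ne`), the cross term of b(m,n) and b(m+1,n+1) is split by the
arithmetic-geometric inequality with the coefficients (min+r)(max+1) and (min+1)(max+r), whose
product is ω(m+1)ω(n+1). The second half is transported to the next site and cancels on summation.
At distance k = |m-n| there remains the rate (k/2)((k-1)(λ²+μ²) + 2λ² + r(μ²-λ²)), which is smallest
at k = 1, where it is `gapRate`. A weighted shift gives equality at k = 1, so this rate is attained.

On the main diagonal (`density_diag`) the energy is the Dirichlet form of a birth and death chain,
reversible for the geometric law of parameter ν². `poincare`, obtained by duality from the Hardy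
inequality `dual_hardy`, bounds its rate below by μ²/Φ(ν²,1,r). The hypothesis of the theorem says
precisely that this bound is at least `gapRate`.

The analysis is arranged around solutions rather than around the generator. The Picard iterates are
partial sums of a Dyson series (`picard_eq`), dominated by the jump-count probabilities of a chain,
so `qms` produces bounded solutions of the matrix equation. For these all energy sums converge,
since the weights decay geometrically and the coefficients grow polynomially. Grönwall's argument
(`IsSolution.decay`) then gives decay of centred solutions. With rate 0 this shows conservativity
and boundedness of T; with rate `gapRate` it extends by density to the complement of ι(1), and
differentiation at t = 0 yields the gap inequality on all of D(L), without any discussion of cores.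
-/

/-- The matrix of a bounded operator on `ℓ²(ℕ)` in the canonical basis. -/
def coeff (x : FockSpace →L[ℂ] FockSpace) (m n : ℕ) : ℂ := inner ℂ (ket m) (x (ket n))

/-- The sesquilinear form on finitely supported sequences that is given by an infinite matrix. -/
def sform (b : ℕ → ℕ → ℂ) (v u : Core) : ℂ :=
  v.sum fun m a => u.sum fun n c => starRingEnd ℂ a * c * b m n

theorem sform_zero_left (b : ℕ → ℕ → ℂ) (u : Core) : sform b 0 u = 0 := by simp [sform]

theorem sform_zero_right (b : ℕ → ℕ → ℂ) (v : Core) : sform b v 0 = 0 := by simp [sform]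

theorem sform_add_left (b : ℕ → ℕ → ℂ) (v w u : Core) :
    sform b (v + w) u = sform b v u + sform b w u := by
  unfold sform
  rw [Finsupp.sum_add_index']
  · simp
  · intro m a c
    rw [← Finsupp.sum_add]
    exact Finsupp.sum_congr fun n _ => by rw [map_add]; ring

theorem sform_add_right (b : ℕ → ℕ → ℂ) (v u w : Core) :
    sform b v (u + w) = sform b v u + sform b v w := by
  unfold sform
  rw [← Finsupp.sum_add]
  refine Finsupp.sum_congr fun m _ => ?_
  rw [Finsupp.sum_add_index']
  · simp
  · intro n c d
    ring

theorem sform_single (b : ℕ → ℕ → ℂ) (m n : ℕ) (a c : ℂ) :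
    sform b (Finsupp.single m a) (Finsupp.single n c) = starRingEnd ℂ a * c * b m n := by
  simp [sform]

/-- Induction on both arguments of a statement about pairs of finitely supported sequences. -/
theorem core_induction {p : Core → Core → Prop} (h0l : ∀ u, p 0 u) (h0r : ∀ v, p v 0)
    (hl : ∀ v w u, p v u → p w u → p (v + w) u) (hr : ∀ v u w, p v u → p v w → p v (u + w))
    (hs : ∀ m n a c, p (Finsupp.single m a) (Finsupp.single n c)) (v u : Core) : p v u := by
  induction v using Finsupp.induction_linear with
  | zero => exact h0l u
  | add v w hv hw => exact hl v w u hv hw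
  | single m a =>
    induction u using Finsupp.induction_linear with
    | zero => exact h0r _
    | add u w hu hw => exact hr _ u w hu hw
    | single n c => exact hs m n a c

theorem sform_add (b b' : ℕ → ℕ → ℂ) (v u : Core) :
    sform (fun m n => b m n + b' m n) v u = sform b v u + sform b' v u := by
  unfold sform
  rw [← Finsupp.sum_add]
  refine Finsupp.sum_congr fun m _ => ?_
  rw [← Finsupp.sum_add]
  exact Finsupp.sum_congr fun n _ => by ring

theorem sform_finset_sum {ι : Type*} (s : Finset ι) (b : ι → ℕ → ℕ → ℂ) (v u : Core) :
    sform (fun m n => ∑ i ∈ s, b i m n) v u = ∑ i ∈ s, sform (b i) v u := by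
  induction s using Finset.cons_induction with
  | empty => simp [sform]
  | cons i s hi ih => simp only [Finset.sum_cons, sform_add, ih]

theorem sform_comp {A : Core →ₗ[ℂ] Core} {σ : ℕ → ℕ} {c : ℕ → ℂ}
    (hA : ∀ n, A (Finsupp.single n 1) = c n • Finsupp.single (σ n) 1) (b : ℕ → ℕ → ℂ)
    (v u : Core) :
    sform b (A v) (A u)
      = sform (fun m n => starRingEnd ℂ (c m) * c n * b (σ m) (σ n)) v u := by
  have hA' : ∀ n a, A (Finsupp.single n a) = Finsupp.single (σ n) (a * c n) := by
    intro n a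
    have : (Finsupp.single n a : Core) = a • Finsupp.single n 1 := by simp
    rw [this, map_smul, hA]
    simp
  refine core_induction (p := fun v u => sform b (A v) (A u)
      = sform (fun m n => starRingEnd ℂ (c m) * c n * b (σ m) (σ n)) v u) ?_ ?_ ?_ ?_ ?_ v u
  · intro u; simp [sform_zero_left]
  · intro u; simp [sform_zero_right]
  · intro v w u h1 h2; simp only [map_add, sform_add_left, h1, h2]
  · intro v w u h1 h2; simp only [map_add, sform_add_right, h1, h2]
  · intro m n a d
    simp only [hA', sform_single, map_mul]
    ring

theorem tendsto_sform {X : Type*} {l : Filter X} {b : X → ℕ → ℕ → ℂ} {b' : ℕ → ℕ → ℂ}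
    (hb : ∀ m n, Tendsto (fun s => b s m n) l (𝓝 (b' m n))) (v u : Core) :
    Tendsto (fun s => sform (b s) v u) l (𝓝 (sform b' v u)) := by
  unfold sform Finsupp.sum
  exact tendsto_finsetSum _ fun m _ => tendsto_finsetSum _ fun n _ => (hb m n).const_mul _

theorem integral_sform {b : ℝ → ℕ → ℕ → ℂ} (hb : ∀ m n, Continuous fun s => b s m n)
    (t : ℝ) (v u : Core) :
    ∫ s in (0 : ℝ)..t, sform (b s) v u
      = sform (fun m n => ∫ s in (0 : ℝ)..t, b s m n) v u := by
  unfold sform Finsupp.sum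
  have hc : ∀ m n, Continuous fun s => starRingEnd ℂ (v m) * u n * b s m n := fun m n =>
    continuous_const.mul (hb m n)
  rw [intervalIntegral.integral_finsetSum fun m _ => (Continuous.intervalIntegrable
    (continuous_finsetSum _ fun n _ => hc m n) _ _)]
  refine Finset.sum_congr rfl fun m _ => ?_
  rw [intervalIntegral.integral_finsetSum fun n _ => (hc m n).intervalIntegrable _ _]
  exact Finset.sum_congr rfl fun n _ => intervalIntegral.integral_const_mul _ _

theorem incl_single (n : ℕ) (a : ℂ) : incl (Finsupp.single n a) = a • ket n := by
  simp [incl]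

theorem inner_incl (y : FockSpace →L[ℂ] FockSpace) (v u : Core) :
    inner ℂ (incl v) (y (incl u)) = sform (coeff y) v u := by
  refine core_induction (p := fun v u => inner ℂ (incl v) (y (incl u)) = sform (coeff y) v u)
    ?_ ?_ ?_ ?_ ?_ v u
  · intro u; simp [sform_zero_left]
  · intro u; simp [sform_zero_right]
  · intro v w u h1 h2; simp only [map_add, sform_add_left, inner_add_left, h1, h2]
  · intro v w u h1 h2; simp only [map_add, sform_add_right, inner_add_right, h1, h2]
  · intro m n a d
    simp only [incl_single, map_smul, inner_smul_left, inner_smul_right, sform_single, coeff]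
    ring

theorem coeff_one (m n : ℕ) : coeff 1 m n = if m = n then 1 else 0 := by
  simp [coeff, inner_ket]

/-- The quadratic form on finitely supported sequences that is given by a diagonal matrix. -/
def qform (N : ℕ → ℝ) (v : Core) : ℝ := v.sum fun n a => ‖a‖ ^ 2 * N n

theorem sform_diag (N : ℕ → ℝ) (v : Core) :
    sform (fun m n => if m = n then (N n : ℂ) else 0) v v = (qform N v : ℂ) := by
  unfold sform qform Finsupp.sum
  push_cast
  refine Finset.sum_congr rfl fun m hm => ?_
  rw [Finset.sum_eq_single m]
  · rw [if_pos rfl, Complex.conj_mul']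
  · intro n _ h; simp [h.symm]
  · intro h; exact absurd hm h

theorem norm_incl_sq (v : Core) : ‖incl v‖ ^ 2 = qform (fun _ => 1) v := by
  have h := inner_incl 1 v v
  have h1 : coeff 1 = fun m n => if m = n then ((1 : ℝ) : ℂ) else 0 := by
    ext m n; rw [coeff_one]; simp
  rw [h1, sform_diag (fun _ => 1), one_apply_eq_self, inner_self_eq_norm_sq_to_K] at h
  exact Complex.ofReal_injective (by rw [← h]; push_cast; rfl)

theorem qform_mono {N N' : ℕ → ℝ} (h : ∀ n, N n ≤ N' n) (v : Core) : qform N v ≤ qform N' v :=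
  Finset.sum_le_sum fun n _ => mul_le_mul_of_nonneg_left (h n) (by positivity)

theorem qform_add (N N' : ℕ → ℝ) (v : Core) :
    qform (fun n => N n + N' n) v = qform N v + qform N' v := by
  unfold qform
  rw [← Finsupp.sum_add]
  exact Finsupp.sum_congr fun n _ => by ring

theorem qform_finset_sum {ι : Type*} (s : Finset ι) (N : ι → ℕ → ℝ) (v : Core) :
    qform (fun n => ∑ i ∈ s, N i n) v = ∑ i ∈ s, qform (N i) v := by
  induction s using Finset.cons_induction with
  | empty => simp [qform]
  | cons i s hi ih => simp only [Finset.sum_cons, qform_add, ih]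

theorem qform_single (N : ℕ → ℝ) (n : ℕ) (a : ℂ) :
    qform N (Finsupp.single n a) = ‖a‖ ^ 2 * N n := by
  simp [qform]

theorem continuous_qform {X : Type*} [TopologicalSpace X] {N : X → ℕ → ℝ}
    (hN : ∀ n, Continuous fun s => N s n) (v : Core) : Continuous fun s => qform (N s) v := by
  unfold qform Finsupp.sum
  have := hN
  fun_prop

theorem integral_qform {N : ℝ → ℕ → ℝ} (hN : ∀ n, Continuous fun s => N s n)
    (t : ℝ) (v : Core) :
    ∫ s in (0 : ℝ)..t, qform (N s) v = qform (fun n => ∫ s in (0 : ℝ)..t, N s n) v := by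
  unfold qform Finsupp.sum
  rw [intervalIntegral.integral_finsetSum fun m _ =>
    (Continuous.intervalIntegrable (by have := hN m; fun_prop) _ _)]
  exact Finset.sum_congr rfl fun n _ => intervalIntegral.integral_const_mul _ _

/-- The side condition allows σ to merge two indices only if one of them carries a zero coefficient,
so no cross terms survive. It is needed for n ↦ n - 1, which merges 0 and 1 but comes with ω₀ = 0.
-/
theorem qform_comp {A : Core →ₗ[ℂ] Core} {σ : ℕ → ℕ} {c : ℕ → ℂ}
    (hA : ∀ n, A (Finsupp.single n 1) = c n • Finsupp.single (σ n) 1)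
    (hσ : ∀ m n, m ≠ n → σ m = σ n → c m = 0 ∨ c n = 0) (N : ℕ → ℝ) (v : Core) :
    qform N (A v) = qform (fun n => ‖c n‖ ^ 2 * N (σ n)) v := by
  have h := sform_comp hA (fun m n => if m = n then (N n : ℂ) else 0) v v
  have h1 : (fun m n => starRingEnd ℂ (c m) * c n * (if σ m = σ n then (N (σ n) : ℂ) else 0))
      = fun m n => if m = n then ((‖c n‖ ^ 2 * N (σ n) : ℝ) : ℂ) else 0 := by
    ext m n
    by_cases hmn : m = n
    · subst hmn
      simp only [if_true]
      rw [← Complex.normSq_eq_norm_sq]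
      push_cast
      rw [Complex.normSq_eq_conj_mul_self]
    · rw [if_neg hmn]
      split_ifs with hs
      · rcases hσ m n hmn hs with h | h <;> simp [h]
      · simp
  rw [h1, sform_diag, sform_diag (fun n => ‖c n‖ ^ 2 * N (σ n))] at h
  exact_mod_cast h

theorem denseRange_incl : DenseRange incl := by
  intro v
  have h := lp.hasSum_single (p := 2) (by norm_num) v
  refine mem_closure_of_tendsto h (Eventually.of_forall fun s => ?_)
  refine ⟨∑ n ∈ s, Finsupp.single n (v n), ?_⟩
  rw [map_sum]
  refine Finset.sum_congr rfl fun n _ => ?_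
  rw [incl_single, ket, ← lp.single_smul]
  simp

theorem ext_coeff {x y : FockSpace →L[ℂ] FockSpace} (h : ∀ m n, coeff x m n = coeff y m n) :
    x = y := by
  have h' : coeff x = coeff y := by ext m n; exact h m n
  have h1 : ∀ u, x (incl u) = y (incl u) := by
    intro u
    refine denseRange_incl.induction_on (p := fun w => inner ℂ w (x (incl u)) = inner ℂ w (y (incl u)))
      |> fun H => ext_inner_left ℂ fun w => H w ?_ ?_
    · exact isClosed_eq (by fun_prop) (by fun_prop)
    · intro v; rw [inner_incl, inner_incl, h']
  exact ContinuousLinearMap.ext fun w => denseRange_incl.induction_on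
    (p := fun w => x w = y w) w (isClosed_eq x.continuous y.continuous) h1

theorem norm_coeff_le (x : FockSpace →L[ℂ] FockSpace) (m n : ℕ) : ‖coeff x m n‖ ≤ ‖x‖ := by
  calc ‖coeff x m n‖ ≤ ‖ket m‖ * ‖x (ket n)‖ := norm_inner_le_norm _ _
    _ ≤ ‖ket m‖ * (‖x‖ * ‖ket n‖) := by gcongr; exact x.le_opNorm _
    _ = ‖x‖ := by simp [norm_ket]

/-- The column combination `∑ₙ uₙ bₘₙ` of a matrix. -/
def rowSum (b : ℕ → ℕ → ℂ) (u : Core) (m : ℕ) : ℂ := u.sum fun n c => c * b m n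

theorem sform_finset_single (b : ℕ → ℕ → ℂ) (s : Finset ℕ) (f : ℕ → ℂ) (u : Core) :
    sform b (∑ m ∈ s, Finsupp.single m (f m)) u
      = ∑ m ∈ s, starRingEnd ℂ (f m) * rowSum b u m := by
  induction s using Finset.cons_induction with
  | empty => simp [sform]
  | cons i s hi ih =>
    rw [Finset.sum_cons, sform_add_left, ih, Finset.sum_cons]
    congr 1
    unfold sform rowSum
    rw [Finsupp.sum_single_index (by simp), Finsupp.sum, Finsupp.sum, Finset.mul_sum]
    simp only [mul_assoc]

theorem qform_finset_single (s : Finset ℕ) (f : ℕ → ℂ) :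
    qform (fun _ => 1) (∑ m ∈ s, Finsupp.single m (f m)) = ∑ m ∈ s, ‖f m‖ ^ 2 := by
  have hg : ∀ n, (∑ m ∈ s, Finsupp.single m (f m) : Core) n = if n ∈ s then f n else 0 := by
    intro n
    simp [Finsupp.finsetSum_apply, Finsupp.single_apply]
  unfold qform
  rw [Finsupp.sum_of_support_subset (s := s) _ ?_ _ (by simp)]
  · exact Finset.sum_congr rfl fun n hn => by rw [hg, if_pos hn, mul_one]
  · intro n hn
    by_contra h
    rw [Finsupp.mem_support_iff, hg, if_neg h] at hn
    exact hn rfl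

/-- Duality: testing the form against the truncation a of the vector `rowSum b u` itself gives ‖a‖²
≤ C ‖a‖ ‖u‖, and a factor ‖a‖ cancels. The bound does not depend on the truncation. -/
theorem sum_norm_rowSum_sq_le {b : ℕ → ℕ → ℂ} {C : ℝ}
    (h : ∀ v u, ‖sform b v u‖ ≤ C * ‖incl v‖ * ‖incl u‖) (u : Core) (s : Finset ℕ) :
    ∑ m ∈ s, ‖rowSum b u m‖ ^ 2 ≤ (C * ‖incl u‖) ^ 2 := by
  set S := ∑ m ∈ s, ‖rowSum b u m‖ ^ 2 with hS
  have hS0 : 0 ≤ S := Finset.sum_nonneg fun _ _ => by positivity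
  have h1 := h (∑ m ∈ s, Finsupp.single m (rowSum b u m)) u
  have h2 : sform b (∑ m ∈ s, Finsupp.single m (rowSum b u m)) u = (S : ℂ) := by
    rw [sform_finset_single, hS]
    push_cast
    refine Finset.sum_congr rfl fun m _ => ?_
    rw [Complex.conj_mul']
  have h3 := norm_incl_sq (∑ m ∈ s, Finsupp.single m (rowSum b u m))
  rw [qform_finset_single, ← hS] at h3
  rw [h2, Complex.norm_real, Real.norm_of_nonneg hS0] at h1
  set a := ‖incl (∑ m ∈ s, Finsupp.single m (rowSum b u m))‖
  have ha : 0 ≤ a := norm_nonneg _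
  rw [← h3] at h1 ⊢
  rcases ha.eq_or_lt with h0 | h0
  · rw [← h0, zero_pow two_ne_zero]; positivity
  · have : a ≤ C * ‖incl u‖ := by
      refine le_of_mul_le_mul_right ?_ h0
      nlinarith
    gcongr

/-- A matrix whose sesquilinear form is bounded is the matrix of a bounded operator. -/
theorem exists_operator {b : ℕ → ℕ → ℂ} {C : ℝ} (hC : 0 ≤ C)
    (h : ∀ v u, ‖sform b v u‖ ≤ C * ‖incl v‖ * ‖incl u‖) :
    ∃ y : FockSpace →L[ℂ] FockSpace, ∀ m n, coeff y m n = b m n := by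
  have h2 : (2 : ENNReal).toReal = ((2 : ℕ) : ℝ) := by norm_num
  have hmem : ∀ u, Memℓp (rowSum b u) 2 := fun u => memℓp_gen' (C := (C * ‖incl u‖) ^ 2) fun s => by
    simpa [h2] using sum_norm_rowSum_sq_le h u s
  let f : Core →ₗ[ℂ] FockSpace :=
    { toFun := fun u => ⟨rowSum b u, hmem u⟩
      map_add' := fun u w => by
        apply Subtype.ext
        refine funext fun m => ?_
        show rowSum b (u + w) m = rowSum b u m + rowSum b w m
        exact Finsupp.sum_add_index' (fun _ => zero_mul _) (fun _ _ _ => add_mul _ _ _)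
      map_smul' := fun c u => by
        apply Subtype.ext
        refine funext fun m => ?_
        show rowSum b (c • u) m = c * rowSum b u m
        unfold rowSum
        rw [Finsupp.sum_smul_index (by simp), Finsupp.sum, Finsupp.sum, Finset.mul_sum]
        exact Finset.sum_congr rfl fun _ _ => by ring }
  have hf : ∀ u, ‖f u‖ ≤ C * ‖incl u‖ := fun u =>
    lp.norm_le_of_forall_sum_le (by norm_num) (by positivity) fun s => by
      simpa [h2, f] using sum_norm_rowSum_sq_le h u s
  refine ⟨f.extendOfNorm incl, fun m n => ?_⟩
  have h3 := f.extendOfNorm_eq denseRange_incl ⟨C, hf⟩ (Finsupp.single n 1)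
  rw [incl_single, one_smul] at h3
  rw [coeff, h3, ket, lp.inner_single_left]
  simp [f, rowSum]

end QuadraticOscillator

namespace QuadraticOscillator

variable (Q : QuadraticOscillator)

/-! ## The Dyson series of the Lindblad equation -/

/-- The decay rate `-Re gₙ` of `ket n` under the semigroup `P`. -/
def killRate (n : ℕ) : ℝ := (Q.lam ^ 2 * Q.omega (n + 1) + Q.mu ^ 2 * Q.omega n) / 2

theorem gEig_re (n : ℕ) : (Q.gEig n).re = -Q.killRate n := by
  simp [gEig, killRate, -Complex.ofReal_pow]
  ring

theorem omega_zero : Q.omega 0 = 0 := by simp [omega]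

/-- The eigenvalue of `x ↦ G* x + x G` at the matrix unit `(m, n)`. -/
def drift (m n : ℕ) : ℂ := starRingEnd ℂ (Q.gEig m) + Q.gEig n

/-- The map `x ↦ L₁* x L₁ + L₂* x L₂` on infinite matrices. -/
def jump (b : ℕ → ℕ → ℂ) (m n : ℕ) : ℂ :=
  ((Q.mu ^ 2 * (√(Q.omega m) * √(Q.omega n)) : ℝ) : ℂ) * b (m - 1) (n - 1)
    + ((Q.lam ^ 2 * (√(Q.omega (m + 1)) * √(Q.omega (n + 1))) : ℝ) : ℂ) * b (m + 1) (n + 1)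

/-- The Lindblad generator on infinite matrices. -/
def lindblad (b : ℕ → ℕ → ℂ) (m n : ℕ) : ℂ := Q.drift m n * b m n + Q.jump b m n

/-- The terms of the Dyson series, whose partial sums are the Picard iterates. -/
def dyson (b : ℕ → ℕ → ℂ) : ℕ → ℝ → ℕ → ℕ → ℂ
  | 0, t, m, n => Complex.exp (t * Q.drift m n) * b m n
  | k + 1, t, m, n =>
      ∫ s in (0 : ℝ)..t, Complex.exp ((t - s : ℝ) * Q.drift m n) * Q.jump (dyson b k s) m n

/-- The terms of the Dyson series of the identity, on the diagonal. -/
def dysonDiag : ℕ → ℝ → ℕ → ℝ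
  | 0, t, n => Real.exp (-(2 * Q.killRate n) * t)
  | k + 1, t, n =>
      ∫ s in (0 : ℝ)..t, Real.exp (-(2 * Q.killRate n) * (t - s))
        * (Q.mu ^ 2 * Q.omega n * dysonDiag k s (n - 1)
          + Q.lam ^ 2 * Q.omega (n + 1) * dysonDiag k s (n + 1))

theorem killRate_nonneg (n : ℕ) : 0 ≤ Q.killRate n := by
  have h1 := Q.omega_nonneg n
  have h2 := Q.omega_nonneg (n + 1)
  unfold killRate
  positivity

theorem continuous_jump {X : Type*} [TopologicalSpace X] {b : X → ℕ → ℕ → ℂ}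
    (hb : ∀ m n, Continuous fun s => b s m n) (m n : ℕ) :
    Continuous fun s => Q.jump (b s) m n := by
  unfold jump
  have := hb
  fun_prop

theorem continuous_dyson (b : ℕ → ℕ → ℂ) (k m n : ℕ) :
    Continuous fun t => Q.dyson b k t m n := by
  induction k generalizing m n with
  | zero => unfold dyson; fun_prop
  | succ k ih =>
    have h := Q.continuous_jump ih m n
    unfold dyson
    refine intervalIntegral.continuous_parametric_intervalIntegral_of_continuous
      (f := fun t s => Complex.exp ((t - s : ℝ) * Q.drift m n) * Q.jump (Q.dyson b k s) m n)
      ?_ continuous_id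
    simp only [Function.uncurry_def]
    have h' : Continuous fun p : ℝ × ℝ => Q.jump (Q.dyson b k p.2) m n := h.comp continuous_snd
    fun_prop

theorem continuous_dysonDiag (k n : ℕ) : Continuous fun t => Q.dysonDiag k t n := by
  induction k generalizing n with
  | zero => unfold dysonDiag; fun_prop
  | succ k ih =>
    have h1 := ih (n - 1)
    have h2 := ih (n + 1)
    unfold dysonDiag
    refine intervalIntegral.continuous_parametric_intervalIntegral_of_continuous
      (f := fun t s => Real.exp (-(2 * Q.killRate n) * (t - s))
        * (Q.mu ^ 2 * Q.omega n * Q.dysonDiag k s (n - 1)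
          + Q.lam ^ 2 * Q.omega (n + 1) * Q.dysonDiag k s (n + 1)))
      ?_ continuous_id
    simp only [Function.uncurry_def]
    have h1' : Continuous fun p : ℝ × ℝ => Q.dysonDiag k p.2 (n - 1) := h1.comp continuous_snd
    have h2' : Continuous fun p : ℝ × ℝ => Q.dysonDiag k p.2 (n + 1) := h2.comp continuous_snd
    fun_prop

theorem dysonDiag_nonneg (k : ℕ) {t : ℝ} (ht : 0 ≤ t) (n : ℕ) : 0 ≤ Q.dysonDiag k t n := by
  induction k generalizing t n with
  | zero => exact (Real.exp_pos _).le
  | succ k ih =>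
    refine intervalIntegral.integral_nonneg ht fun s hs => ?_
    have h1 := ih hs.1 (n - 1)
    have h2 := ih hs.1 (n + 1)
    have h3 := Q.omega_nonneg n
    have h4 := Q.omega_nonneg (n + 1)
    positivity

theorem integral_exp_decay (a t : ℝ) :
    ∫ s in (0 : ℝ)..t, Real.exp (-a * (t - s)) * a = 1 - Real.exp (-a * t) := by
  have h : ∀ s ∈ Set.uIcc 0 t, HasDerivAt (fun s => Real.exp (-a * (t - s)))
      (Real.exp (-a * (t - s)) * a) s := by
    intro s _
    have := (((hasDerivAt_id s).const_sub t).const_mul (-a)).exp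
    simpa using this
  rw [intervalIntegral.integral_eq_sub_of_hasDerivAt h
    (Continuous.intervalIntegrable (by fun_prop) _ _)]
  simp

/-- `dysonDiag k t n` is the probability that the chain started at n, with rates λ²ωₙ₊₁ upwards and
μ²ωₙ downwards, makes exactly k jumps before time t; the recursion conditions on the first jump. The
total jump rate is twice `killRate`, so the integral contributes at most 1 - exp(-2κt), which leaves
room for exactly the term k = 0. -/
theorem sum_dysonDiag_le_one (k : ℕ) {t : ℝ} (ht : 0 ≤ t) (n : ℕ) :
    ∑ i ∈ Finset.range k, Q.dysonDiag i t n ≤ 1 := by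
  induction k generalizing t n with
  | zero => simp
  | succ k ih =>
    have hc := Q.continuous_dysonDiag
    have hω := Q.omega_nonneg n
    have hω' := Q.omega_nonneg (n + 1)
    rw [Finset.sum_range_succ']
    simp only [dysonDiag]
    rw [← intervalIntegral.integral_finsetSum fun i _ => Continuous.intervalIntegrable
      (by have h1 := hc i (n - 1); have h2 := hc i (n + 1); fun_prop) _ _]
    have h : ∫ s in (0 : ℝ)..t, ∑ i ∈ Finset.range k,
        Real.exp (-(2 * Q.killRate n) * (t - s))
          * (Q.mu ^ 2 * Q.omega n * Q.dysonDiag i s (n - 1)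
            + Q.lam ^ 2 * Q.omega (n + 1) * Q.dysonDiag i s (n + 1))
        ≤ ∫ s in (0 : ℝ)..t, Real.exp (-(2 * Q.killRate n) * (t - s)) * (2 * Q.killRate n) := by
      refine intervalIntegral.integral_mono_on ht (Continuous.intervalIntegrable
        (continuous_finsetSum _ fun i _ => by
          have h1 := hc i (n - 1); have h2 := hc i (n + 1); fun_prop) _ _)
        (Continuous.intervalIntegrable (by fun_prop) _ _) fun s hs => ?_
      rw [← Finset.mul_sum, Finset.sum_add_distrib, ← Finset.mul_sum, ← Finset.mul_sum]
      refine mul_le_mul_of_nonneg_left ?_ (Real.exp_pos _).le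
      calc _ ≤ Q.mu ^ 2 * Q.omega n * 1 + Q.lam ^ 2 * Q.omega (n + 1) * 1 := by
            gcongr
            · exact ih hs.1 _
            · exact ih hs.1 _
        _ = 2 * Q.killRate n := by unfold killRate; ring
    rw [integral_exp_decay] at h
    linarith

theorem summable_dysonDiag {t : ℝ} (ht : 0 ≤ t) (n : ℕ) : Summable fun k => Q.dysonDiag k t n :=
  summable_of_sum_range_le (fun k => Q.dysonDiag_nonneg k ht n)
    fun k => Q.sum_dysonDiag_le_one k ht n

theorem P_single (t : ℝ) (n : ℕ) :
    Q.P t (Finsupp.single n 1) = Complex.exp (t * Q.gEig n) • Finsupp.single n 1 := by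
  simp [P]

theorem L1_P_single (t : ℝ) (n : ℕ) :
    (Q.L1 ∘ₗ Q.P t) (Finsupp.single n 1)
      = ((Q.mu * √(Q.omega n) : ℝ) * Complex.exp (t * Q.gEig n)) • Finsupp.single (n - 1) 1 := by
  rw [LinearMap.comp_apply, P_single, map_smul, L1, LinearMap.smul_apply, B,
    Finsupp.linearCombination_single]
  simp only [Finsupp.smul_single, smul_eq_mul]
  congr 1
  push_cast
  ring

theorem L2_P_single (t : ℝ) (n : ℕ) :
    (Q.L2 ∘ₗ Q.P t) (Finsupp.single n 1)
      = ((Q.lam * √(Q.omega (n + 1)) : ℝ) * Complex.exp (t * Q.gEig n))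
        • Finsupp.single (n + 1) 1 := by
  rw [LinearMap.comp_apply, P_single, map_smul, L2, LinearMap.smul_apply, Bplus,
    Finsupp.linearCombination_single]
  simp only [Finsupp.smul_single, smul_eq_mul]
  congr 1
  push_cast
  ring

theorem exp_drift (t : ℝ) (m n : ℕ) :
    starRingEnd ℂ (Complex.exp (t * Q.gEig m)) * Complex.exp (t * Q.gEig n)
      = Complex.exp (t * Q.drift m n) := by
  rw [← Complex.exp_conj, ← Complex.exp_add, drift, map_mul, Complex.conj_ofReal, mul_add]

theorem sform_P (t : ℝ) (b : ℕ → ℕ → ℂ) (v u : Core) :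
    sform b (Q.P t v) (Q.P t u)
      = sform (fun m n => Complex.exp (t * Q.drift m n) * b m n) v u := by
  rw [sform_comp (Q.P_single t)]
  simp only [exp_drift]

theorem sform_jump (t : ℝ) (b : ℕ → ℕ → ℂ) (v u : Core) :
    sform b (Q.L1 (Q.P t v)) (Q.L1 (Q.P t u)) + sform b (Q.L2 (Q.P t v)) (Q.L2 (Q.P t u))
      = sform (fun m n => Complex.exp (t * Q.drift m n) * Q.jump b m n) v u := by
  have h1 := sform_comp (Q.L1_P_single t) b v u
  have h2 := sform_comp (Q.L2_P_single t) b v u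
  simp only [LinearMap.comp_apply] at h1 h2
  rw [h1, h2, ← sform_add]
  congr 1
  ext m n
  rw [← exp_drift, jump]
  simp only [map_mul, Complex.conj_ofReal]
  push_cast
  ring

theorem norm_sq_exp_gEig (t : ℝ) (n : ℕ) :
    ‖Complex.exp (t * Q.gEig n)‖ ^ 2 = Real.exp (-(2 * Q.killRate n) * t) := by
  rw [Complex.norm_exp, ← Real.exp_nat_mul]
  congr 1
  simp [gEig_re]
  ring

theorem qform_P (t : ℝ) (N : ℕ → ℝ) (v : Core) :
    qform N (Q.P t v) = qform (fun n => Real.exp (-(2 * Q.killRate n) * t) * N n) v := by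
  rw [qform_comp (Q.P_single t) (fun m n h h' => absurd h' h)]
  simp only [norm_sq_exp_gEig]

theorem qform_jump (t : ℝ) (N : ℕ → ℝ) (v : Core) :
    qform N (Q.L1 (Q.P t v)) + qform N (Q.L2 (Q.P t v))
      = qform (fun n => Real.exp (-(2 * Q.killRate n) * t)
          * (Q.mu ^ 2 * Q.omega n * N (n - 1) + Q.lam ^ 2 * Q.omega (n + 1) * N (n + 1))) v := by
  have h1 := qform_comp (Q.L1_P_single t) (fun m n h h' => by
    have h3 : m = 0 ∨ n = 0 := by omega
    rcases h3 with h3 | h3 <;> simp [h3, omega_zero]) N v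
  have h2 := qform_comp (Q.L2_P_single t) (fun m n h h' => by omega) N v
  simp only [LinearMap.comp_apply] at h1 h2
  rw [h1, h2, ← qform_add]
  congr 1
  ext n
  simp only [norm_mul, mul_pow, norm_sq_exp_gEig, Complex.norm_real, Real.norm_eq_abs, sq_abs,
    Real.sq_sqrt (Q.omega_nonneg _)]
  ring

theorem jump_sum {ι : Type*} (s : Finset ι) (b : ι → ℕ → ℕ → ℂ) (m n : ℕ) :
    Q.jump (fun m n => ∑ i ∈ s, b i m n) m n = ∑ i ∈ s, Q.jump (b i) m n := by
  simp only [jump, Finset.sum_add_distrib, Finset.mul_sum]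

theorem sum_dyson_succ (b : ℕ → ℕ → ℂ) (k : ℕ) (t : ℝ) (m n : ℕ) :
    ∑ i ∈ Finset.range (k + 1), Q.dyson b i t m n
      = Complex.exp (t * Q.drift m n) * b m n
        + ∫ s in (0 : ℝ)..t, Complex.exp ((t - s : ℝ) * Q.drift m n)
            * Q.jump (fun m n => ∑ i ∈ Finset.range k, Q.dyson b i s m n) m n := by
  rw [Finset.sum_range_succ', add_comm]
  congr 1
  simp only [jump_sum, Finset.mul_sum]
  rw [intervalIntegral.integral_finsetSum fun i _ => Continuous.intervalIntegrable
    (by have := Q.continuous_jump (Q.continuous_dyson b i) m n; fun_prop) _ _]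
  rfl

/-- The Picard iterates are the partial sums of the Dyson series. -/
theorem picard_eq (k : ℕ) (t : ℝ) (x : FockSpace →L[ℂ] FockSpace) (v u : Core) :
    Q.picard k t x v u
      = sform (fun m n => ∑ i ∈ Finset.range (k + 1), Q.dyson (coeff x) i t m n) v u := by
  induction k generalizing t v u with
  | zero => simp [picard, inner_incl, sform_P, dyson]
  | succ k ih =>
    simp only [picard, ih, sform_jump, inner_incl, sform_P]
    rw [integral_sform (b := fun s m n => Complex.exp ((t - s : ℝ) * Q.drift m n)
      * Q.jump (fun m n => ∑ i ∈ Finset.range (k + 1), Q.dyson (coeff x) i s m n) m n),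
      ← sform_add]
    · simp only [Q.sum_dyson_succ _ (k + 1)]
    · intro m n
      have := Q.continuous_jump (b := fun s m n =>
        ∑ i ∈ Finset.range (k + 1), Q.dyson (coeff x) i s m n)
        (fun m n => continuous_finsetSum _ fun i _ => Q.continuous_dyson _ _ _ _) m n
      fun_prop

/-! ### Form bounds for the Dyson series -/

/-- The matrix `b` is bounded by `C` as a sesquilinear form. -/
def FormBounded (b : ℕ → ℕ → ℂ) (C : ℝ) : Prop :=
  ∀ v u : Core, ‖sform b v u‖ ≤ C / 2 * (qform (fun _ => 1) v + qform (fun _ => 1) u)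

theorem formBounded_coeff (x : FockSpace →L[ℂ] FockSpace) : FormBounded (coeff x) ‖x‖ := by
  intro v u
  rw [← inner_incl, ← norm_incl_sq, ← norm_incl_sq]
  have h1 : ‖inner ℂ (incl v) (x (incl u))‖ ≤ ‖incl v‖ * (‖x‖ * ‖incl u‖) :=
    (norm_inner_le_norm _ _).trans (mul_le_mul_of_nonneg_left (x.le_opNorm _) (norm_nonneg _))
  nlinarith [mul_nonneg (norm_nonneg x) (sq_nonneg (‖incl v‖ - ‖incl u‖))]

/-- The bound by half a sum of squares, instead of a product of norms, is additive. It therefore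
passes through the two jump terms and the time integral, and the quadratic forms on the right
reproduce the recursion of `dysonDiag`. -/
theorem norm_sform_dyson_le {b : ℕ → ℕ → ℂ} {C : ℝ} (hb : FormBounded b C) (k : ℕ) {t : ℝ}
    (ht : 0 ≤ t) (v u : Core) :
    ‖sform (Q.dyson b k t) v u‖
      ≤ C / 2 * (qform (Q.dysonDiag k t) v + qform (Q.dysonDiag k t) u) := by
  induction k generalizing t v u with
  | zero =>
    have h := hb (Q.P t v) (Q.P t u)
    rw [sform_P, qform_P, qform_P] at h
    simp only [mul_one] at h
    exact h
  | succ k ih =>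
    have hj := Q.continuous_jump (Q.continuous_dyson b k)
    have hd := Q.continuous_dysonDiag k
    have h1 : sform (Q.dyson b (k + 1) t) v u = ∫ s in (0 : ℝ)..t,
        sform (fun m n => Complex.exp ((t - s : ℝ) * Q.drift m n) * Q.jump (Q.dyson b k s) m n)
          v u := by
      rw [integral_sform (b := fun s m n => Complex.exp ((t - s : ℝ) * Q.drift m n)
        * Q.jump (Q.dyson b k s) m n) (fun m n => by have := hj m n; fun_prop)]
      rfl
    have hN : ∀ n, Continuous fun s => Real.exp (-(2 * Q.killRate n) * (t - s))
        * (Q.mu ^ 2 * Q.omega n * Q.dysonDiag k s (n - 1)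
          + Q.lam ^ 2 * Q.omega (n + 1) * Q.dysonDiag k s (n + 1)) := fun n => by
      have h1 := hd (n - 1); have h2 := hd (n + 1); fun_prop
    have h2 : ∀ w, qform (Q.dysonDiag (k + 1) t) w = ∫ s in (0 : ℝ)..t,
        qform (fun n => Real.exp (-(2 * Q.killRate n) * (t - s))
        * (Q.mu ^ 2 * Q.omega n * Q.dysonDiag k s (n - 1)
          + Q.lam ^ 2 * Q.omega (n + 1) * Q.dysonDiag k s (n + 1))) w := by
      intro w
      rw [integral_qform hN]
      rfl
    have hq := fun w => (continuous_qform hN w).intervalIntegrable (μ := MeasureTheory.volume) 0 t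
    rw [h1, h2, h2, ← intervalIntegral.integral_add (hq v) (hq u),
      ← intervalIntegral.integral_const_mul]
    refine intervalIntegral.norm_integral_le_of_norm_le ht (Eventually.of_forall fun s hs => ?_)
      (((hq v).add (hq u)).const_mul _)
    rw [← sform_jump, ← qform_jump, ← qform_jump]
    refine (norm_add_le _ _).trans ?_
    have e1 := ih hs.1.le (Q.L1 (Q.P (t - s) v)) (Q.L1 (Q.P (t - s) u))
    have e2 := ih hs.1.le (Q.L2 (Q.P (t - s) v)) (Q.L2 (Q.P (t - s) u))
    linarith

theorem norm_dyson_le {b : ℕ → ℕ → ℂ} {C : ℝ} (hb : FormBounded b C) (k : ℕ) {t : ℝ}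
    (ht : 0 ≤ t) (m n : ℕ) :
    ‖Q.dyson b k t m n‖ ≤ C / 2 * (Q.dysonDiag k t m + Q.dysonDiag k t n) := by
  simpa [sform_single, qform_single] using
    Q.norm_sform_dyson_le hb k ht (Finsupp.single m 1) (Finsupp.single n 1)

theorem FormBounded.nonneg {b : ℕ → ℕ → ℂ} {C : ℝ} (hb : FormBounded b C) : 0 ≤ C := by
  have h := hb (Finsupp.single 0 1) (Finsupp.single 0 1)
  simp only [qform_single] at h
  have := (norm_nonneg _).trans h
  norm_num at this
  exact this

theorem summable_dyson {b : ℕ → ℕ → ℂ} {C : ℝ} (hb : FormBounded b C) {t : ℝ}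
    (ht : 0 ≤ t) (m n : ℕ) : Summable fun k => Q.dyson b k t m n :=
  Summable.of_norm_bounded (((Q.summable_dysonDiag ht m).add
    (Q.summable_dysonDiag ht n)).mul_left _) fun k => Q.norm_dyson_le hb k ht m n

theorem formBounded_sum_dyson {b : ℕ → ℕ → ℂ} {C : ℝ} (hb : FormBounded b C) (k : ℕ) {t : ℝ}
    (ht : 0 ≤ t) :
    FormBounded (fun m n => ∑ i ∈ Finset.range k, Q.dyson b i t m n) C := by
  intro v u
  rw [sform_finset_sum]
  have hC := hb.nonneg
  calc _ ≤ ∑ i ∈ Finset.range k,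
        C / 2 * (qform (Q.dysonDiag i t) v + qform (Q.dysonDiag i t) u) :=
        norm_sum_le_of_le _ fun i _ => Q.norm_sform_dyson_le hb i ht v u
    _ = C / 2 * (qform (fun n => ∑ i ∈ Finset.range k, Q.dysonDiag i t n) v
          + qform (fun n => ∑ i ∈ Finset.range k, Q.dysonDiag i t n) u) := by
        rw [← Finset.mul_sum, Finset.sum_add_distrib, qform_finset_sum, qform_finset_sum]
    _ ≤ _ := by
        gcongr
        · exact qform_mono (fun n => Q.sum_dysonDiag_le_one k ht n) v
        · exact qform_mono (fun n => Q.sum_dysonDiag_le_one k ht n) u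

/-- The sum of the Dyson series. -/
def evol (b : ℕ → ℕ → ℂ) (t : ℝ) (m n : ℕ) : ℂ := ∑' k, Q.dyson b k t m n

theorem tendsto_sum_dyson {b : ℕ → ℕ → ℂ} {C : ℝ} (hb : FormBounded b C) {t : ℝ}
    (ht : 0 ≤ t) (m n : ℕ) :
    Tendsto (fun k => ∑ i ∈ Finset.range k, Q.dyson b i t m n) atTop (𝓝 (Q.evol b t m n)) :=
  (Q.summable_dyson hb ht m n).hasSum.tendsto_sum_nat

theorem formBounded_evol {b : ℕ → ℕ → ℂ} {C : ℝ} (hb : FormBounded b C) {t : ℝ} (ht : 0 ≤ t) :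
    FormBounded (Q.evol b t) C := fun v u =>
  le_of_tendsto (tendsto_sform (fun m n => Q.tendsto_sum_dyson hb ht m n) v u).norm
    (Eventually.of_forall fun k => Q.formBounded_sum_dyson hb k ht v u)

theorem FormBounded.norm_le {b : ℕ → ℕ → ℂ} {C : ℝ} (hb : FormBounded b C) (m n : ℕ) :
    ‖b m n‖ ≤ C := by
  have h := hb (Finsupp.single m 1) (Finsupp.single n 1)
  simp only [sform_single, qform_single] at h
  norm_num at h
  linarith

theorem FormBounded.exists_operator {b : ℕ → ℕ → ℂ} {C : ℝ} (hb : FormBounded b C) :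
    ∃ y : FockSpace →L[ℂ] FockSpace, ∀ m n, coeff y m n = b m n := by
  refine QuadraticOscillator.exists_operator hb.nonneg fun v u => ?_
  have hsl : ∀ (r : ℝ) (v : Core), sform b ((r : ℂ) • v) u = r * sform b v u := by
    intro r v
    induction v using Finsupp.induction_linear with
    | zero => simp [sform_zero_left]
    | add v w hv hw => rw [smul_add, sform_add_left, hv, hw, sform_add_left]; ring
    | single m a =>
      induction u using Finsupp.induction_linear with
      | zero => simp [sform_zero_right]
      | add u w hu hw => rw [sform_add_right, hu, hw, sform_add_right]; ring
      | single n c =>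
        rw [Finsupp.smul_single, sform_single, sform_single]
        simp
        ring
  -- Scaling v alone by r produces a quadratic polynomial in r that is nowhere negative. Its
  -- discriminant turns the bound by a sum of squares into the bound by a product of norms.
  have key : ∀ r : ℝ, r * ‖sform b v u‖ ≤ C / 2 * (r ^ 2 * ‖incl v‖ ^ 2 + ‖incl u‖ ^ 2) := by
    intro r
    have h := hb ((r : ℂ) • v) u
    rw [← norm_incl_sq, ← norm_incl_sq, hsl, map_smul, norm_smul, norm_mul, mul_pow,
      Complex.norm_real, Real.norm_eq_abs, sq_abs] at h
    exact (mul_le_mul_of_nonneg_right (le_abs_self r) (norm_nonneg _)).trans h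
  have hC := hb.nonneg
  have hd := discrim_le_zero (a := C / 2 * ‖incl v‖ ^ 2) (b := -‖sform b v u‖)
    (c := C / 2 * ‖incl u‖ ^ 2) fun r => by linarith [key r]
  refine abs_le_of_sq_le_sq' ?_ (by positivity) |>.2
  unfold discrim at hd
  linarith

end QuadraticOscillator

namespace QuadraticOscillator

variable (Q : QuadraticOscillator)

/-! ## The minimal semigroup -/

theorem norm_jump_le {b : ℕ → ℕ → ℂ} {C : ℝ} (hb : ∀ m n, ‖b m n‖ ≤ C) (m n : ℕ) :
    ‖Q.jump b m n‖ ≤ (Q.mu ^ 2 * (√(Q.omega m) * √(Q.omega n))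
      + Q.lam ^ 2 * (√(Q.omega (m + 1)) * √(Q.omega (n + 1)))) * C := by
  refine (norm_add_le _ _).trans ?_
  rw [norm_mul, norm_mul, Complex.norm_real, Complex.norm_real, Real.norm_of_nonneg (by positivity),
    Real.norm_of_nonneg (by positivity), add_mul]
  gcongr
  · exact hb _ _
  · exact hb _ _

theorem tendsto_jump {X : Type*} {l : Filter X} {b : X → ℕ → ℕ → ℂ} {b' : ℕ → ℕ → ℂ}
    (hb : ∀ m n, Tendsto (fun s => b s m n) l (𝓝 (b' m n))) (m n : ℕ) :
    Tendsto (fun s => Q.jump (b s) m n) l (𝓝 (Q.jump b' m n)) :=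
  ((hb _ _).const_mul _).add ((hb _ _).const_mul _)

theorem norm_exp_drift_le {t : ℝ} (ht : 0 ≤ t) (m n : ℕ) :
    ‖Complex.exp (t * Q.drift m n)‖ ≤ 1 := by
  rw [Complex.norm_exp, Real.exp_le_one_iff]
  have h1 := Q.killRate_nonneg m
  have h2 := Q.killRate_nonneg n
  simp only [drift, Complex.re_ofReal_mul, Complex.add_re, Complex.conj_re, gEig_re]
  nlinarith

/-- The mild form of the Lindblad equation. -/
theorem evol_eq {b : ℕ → ℕ → ℂ} {C : ℝ} (hb : FormBounded b C) {t : ℝ} (ht : 0 ≤ t) (m n : ℕ) :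
    Q.evol b t m n = Complex.exp (t * Q.drift m n) * b m n
      + ∫ s in (0 : ℝ)..t, Complex.exp ((t - s : ℝ) * Q.drift m n) * Q.jump (Q.evol b s) m n := by
  have h1 := (tendsto_add_atTop_iff_nat 1).2 (Q.tendsto_sum_dyson hb ht m n)
  simp only [sum_dyson_succ] at h1
  refine tendsto_nhds_unique h1 (tendsto_const_nhds.add ?_)
  -- Dominated convergence: the entries of all partial sums are bounded by the same C.
  refine intervalIntegral.tendsto_integral_filter_of_dominated_convergence
    (fun _ => (Q.mu ^ 2 * (√(Q.omega m) * √(Q.omega n))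
      + Q.lam ^ 2 * (√(Q.omega (m + 1)) * √(Q.omega (n + 1)))) * C) ?_ ?_ (by simp) ?_
  · refine Eventually.of_forall fun k => Continuous.aestronglyMeasurable ?_
    have := Q.continuous_jump (b := fun s m n => ∑ i ∈ Finset.range k, Q.dyson b i s m n)
      (fun m n => continuous_finsetSum _ fun i _ => Q.continuous_dyson _ _ _ _) m n
    fun_prop
  · refine Eventually.of_forall fun k => Eventually.of_forall fun s hs => ?_
    rw [Set.uIoc_of_le ht] at hs
    rw [norm_mul]
    refine (mul_le_of_le_one_left (norm_nonneg _)
      (Q.norm_exp_drift_le (sub_nonneg.2 hs.2) m n)).trans ?_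
    exact Q.norm_jump_le (Q.formBounded_sum_dyson hb k hs.1.le).norm_le m n
  · refine Eventually.of_forall fun s hs => ?_
    rw [Set.uIoc_of_le ht] at hs
    exact (Q.tendsto_jump (Q.tendsto_sum_dyson hb hs.1.le) m n).const_mul _

/-- A bounded solution of the Lindblad equation on infinite matrices. -/
structure IsSolution (F : ℝ → ℕ → ℕ → ℂ) (C : ℝ) : Prop where
  norm_le : ∀ t, 0 ≤ t → ∀ m n, ‖F t m n‖ ≤ C
  continuousOn : ∀ m n, ContinuousOn (fun t => F t m n) (Set.Ici 0)
  hasDerivAt : ∀ t, 0 < t → ∀ m n, HasDerivAt (fun t => F t m n) (Q.lindblad (F t) m n) t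

/-- With the factor exp(t · drift) pulled out, t enters the integral only as an endpoint, so
regularity in t reduces to that of a primitive. `max s 0` keeps the integrand under control at
negative times, where the Dyson series need not converge. -/
theorem evol_eq' {b : ℕ → ℕ → ℂ} {C : ℝ} (hb : FormBounded b C) {t : ℝ} (ht : 0 ≤ t) (m n : ℕ) :
    Q.evol b t m n = Complex.exp (t * Q.drift m n) * (b m n
      + ∫ s in (0 : ℝ)..t, Complex.exp (-(s * Q.drift m n)) * Q.jump (Q.evol b (max s 0)) m n) := by
  rw [Q.evol_eq hb ht, mul_add, ← intervalIntegral.integral_const_mul]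
  congr 1
  refine intervalIntegral.integral_congr fun s hs => ?_
  rw [Set.uIcc_of_le ht] at hs
  rw [max_eq_left hs.1, ← mul_assoc, ← Complex.exp_add]
  congr 2
  push_cast
  ring

theorem evol_zero {b : ℕ → ℕ → ℂ} {C : ℝ} (hb : FormBounded b C) : Q.evol b 0 = b := by
  ext m n
  rw [Q.evol_eq' hb le_rfl]
  simp

theorem isSolution_evol {b : ℕ → ℕ → ℂ} {C : ℝ} (hb : FormBounded b C) :
    Q.IsSolution (Q.evol b) C := by
  -- Bootstrap: pointwise limits of continuous functions are measurable, hence the bounded integrand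
  -- is integrable, hence its primitive and `evol` are continuous, hence the primitive is
  -- differentiable.
  have hmeas : ∀ m n, Measurable fun s => Q.evol b (max s 0) m n := fun m n =>
    measurable_of_tendsto_metrizable (f := fun k s => ∑ i ∈ Finset.range k,
      Q.dyson b i (max s 0) m n) (fun k => Continuous.measurable (continuous_finsetSum _ fun i _ =>
        (Q.continuous_dyson b i m n).comp (by fun_prop)))
      (tendsto_pi_nhds.2 fun s => Q.tendsto_sum_dyson hb (le_max_right s 0) m n)
  have hbd : ∀ s m n, ‖Q.evol b (max s 0) m n‖ ≤ C := fun s =>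
    (Q.formBounded_evol hb (le_max_right s 0)).norm_le
  have hint : ∀ m n (t : ℝ), IntervalIntegrable
      (fun s : ℝ => Complex.exp (-(s * Q.drift m n)) * Q.jump (Q.evol b (max s 0)) m n)
      MeasureTheory.volume 0 t := by
    intro m n t
    refine IntervalIntegrable.continuousOn_mul ?_ (Continuous.continuousOn (by fun_prop))
    refine intervalIntegrable_const (c := (Q.mu ^ 2 * (√(Q.omega m) * √(Q.omega n))
      + Q.lam ^ 2 * (√(Q.omega (m + 1)) * √(Q.omega (n + 1)))) * C) |>.mono_fun ?_ ?_
    · have h := hmeas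
      refine Measurable.aestronglyMeasurable ?_
      exact (((h _ _).const_mul _).add ((h _ _).const_mul _))
    · exact Eventually.of_forall fun s =>
        (Q.norm_jump_le (hbd s) m n).trans (le_abs_self _)
  have hcont : ∀ m n, ContinuousOn (fun t => Q.evol b t m n) (Set.Ici 0) := by
    intro m n
    refine ContinuousOn.congr (f := fun t : ℝ => Complex.exp (t * Q.drift m n) * (b m n
      + ∫ s in (0 : ℝ)..t, Complex.exp (-(s * Q.drift m n)) * Q.jump (Q.evol b (max s 0)) m n))
      (Continuous.continuousOn ?_) fun t ht => Q.evol_eq' hb ht m n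
    have := intervalIntegral.continuous_primitive (fun a c =>
      (hint m n a).symm.trans (hint m n c)) 0
    fun_prop
  refine ⟨fun t ht => (Q.formBounded_evol hb ht).norm_le, hcont, fun t ht m n => ?_⟩
  have hcont' : ∀ m n, Continuous fun s => Q.evol b (max s 0) m n := fun m n =>
    (hcont m n).comp_continuous (by fun_prop) fun s => le_max_right s 0
  have hc : Continuous fun s : ℝ =>
      Complex.exp (-(s * Q.drift m n)) * Q.jump (Q.evol b (max s 0)) m n := by
    have := Q.continuous_jump hcont' m n
    fun_prop
  have h1 := ((hc.integral_hasStrictDerivAt 0 t).hasDerivAt.const_add (b m n))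
  have h2 : HasDerivAt (fun t : ℝ => Complex.exp (t * Q.drift m n))
      (Complex.exp (t * Q.drift m n) * Q.drift m n) t := by
    have := ((Complex.ofRealCLM.hasDerivAt (x := t)).mul_const (Q.drift m n)).cexp
    simpa using this
  have h3 := h2.mul h1
  have h4 : Q.lindblad (Q.evol b t) m n = Complex.exp (t * Q.drift m n) * Q.drift m n *
      (b m n + ∫ s in (0 : ℝ)..t,
        Complex.exp (-(s * Q.drift m n)) * Q.jump (Q.evol b (max s 0)) m n) +
      Complex.exp (t * Q.drift m n) *
        (Complex.exp (-(t * Q.drift m n)) * Q.jump (Q.evol b (max t 0)) m n) := by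
    rw [← mul_assoc (Complex.exp _) (Complex.exp _), ← Complex.exp_add, max_eq_left ht.le, lindblad,
      Q.evol_eq' hb ht.le]
    simp
    ring
  rw [h4]
  refine h3.congr_of_eventuallyEq ?_
  filter_upwards [Ioi_mem_nhds ht] with s hs
  exact Q.evol_eq' hb (le_of_lt hs) m n

theorem isPicardLimit_unique {t : ℝ} {x y z : FockSpace →L[ℂ] FockSpace}
    (hy : Q.IsPicardLimit t x y) (hz : Q.IsPicardLimit t x z) : y = z := by
  refine ext_coeff fun m n => ?_
  have h := tendsto_nhds_unique (hy (Finsupp.single m 1) (Finsupp.single n 1))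
    (hz (Finsupp.single m 1) (Finsupp.single n 1))
  simpa [inner_incl, sform_single] using h

theorem isPicardLimit_of_coeff_eq {t : ℝ} (ht : 0 ≤ t) {x y : FockSpace →L[ℂ] FockSpace}
    (h : ∀ m n, coeff y m n = Q.evol (coeff x) t m n) : Q.IsPicardLimit t x y := by
  intro v u
  rw [inner_incl]
  simp only [picard_eq]
  refine tendsto_sform (fun m n => ?_) v u
  rw [h]
  exact (tendsto_add_atTop_iff_nat 1).2 (Q.tendsto_sum_dyson (formBounded_coeff x) ht m n)

/-- The minimal quantum dynamical semigroup is given by the Dyson series. -/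
theorem coeff_qms {t : ℝ} (ht : 0 ≤ t) (x : FockSpace →L[ℂ] FockSpace) :
    coeff (Q.qms t x) = Q.evol (coeff x) t := by
  obtain ⟨y, hy⟩ := (Q.formBounded_evol (formBounded_coeff x) ht).exists_operator
  have h1 := Q.isPicardLimit_of_coeff_eq ht hy
  have h2 : Q.IsPicardLimit t x (Q.qms t x) := Classical.epsilon_spec ⟨y, h1⟩
  rw [Q.isPicardLimit_unique h2 h1]
  ext m n
  exact hy m n

theorem isSolution_coeff_qms (x : FockSpace →L[ℂ] FockSpace) :
    Q.IsSolution (fun t => coeff (Q.qms t x)) ‖x‖ := by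
  have h := Q.isSolution_evol (formBounded_coeff x)
  refine ⟨fun t ht m n => ?_, fun m n => ?_, fun t ht m n => ?_⟩
  · simp only [Q.coeff_qms ht]
    exact h.norm_le t ht m n
  · exact (h.continuousOn m n).congr fun t ht => by simp only [Q.coeff_qms ht]
  · simp only [Q.coeff_qms ht.le]
    refine (h.hasDerivAt t ht m n).congr_of_eventuallyEq ?_
    filter_upwards [Ioi_mem_nhds ht] with s hs
    rw [Q.coeff_qms (le_of_lt hs)]

theorem coeff_qms_zero (x : FockSpace →L[ℂ] FockSpace) : coeff (Q.qms 0 x) = coeff x := by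
  rw [Q.coeff_qms le_rfl, Q.evol_zero (formBounded_coeff x)]

/-! ### Linearity of the minimal semigroup -/

theorem coeff_add (x y : FockSpace →L[ℂ] FockSpace) (m n : ℕ) :
    coeff (x + y) m n = coeff x m n + coeff y m n := by
  simp [coeff]

theorem coeff_smul (c : ℂ) (x : FockSpace →L[ℂ] FockSpace) (m n : ℕ) :
    coeff (c • x) m n = c * coeff x m n := by
  simp [coeff]

theorem dyson_add (b b' : ℕ → ℕ → ℂ) (k : ℕ) (t : ℝ) (m n : ℕ) :
    Q.dyson (fun m n => b m n + b' m n) k t m n = Q.dyson b k t m n + Q.dyson b' k t m n := by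
  induction k generalizing t m n with
  | zero => simp only [dyson]; ring
  | succ k ih =>
    have h1 := Q.continuous_jump (Q.continuous_dyson b k) m n
    have h2 := Q.continuous_jump (Q.continuous_dyson b' k) m n
    simp only [dyson]
    rw [← intervalIntegral.integral_add (Continuous.intervalIntegrable (by fun_prop) _ _)
      (Continuous.intervalIntegrable (by fun_prop) _ _)]
    congr 1
    ext s
    simp only [jump, ih]
    ring

theorem dyson_smul (c : ℂ) (b : ℕ → ℕ → ℂ) (k : ℕ) (t : ℝ) (m n : ℕ) :
    Q.dyson (fun m n => c * b m n) k t m n = c * Q.dyson b k t m n := by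
  induction k generalizing t m n with
  | zero => simp only [dyson]; ring
  | succ k ih =>
    simp only [dyson]
    rw [← intervalIntegral.integral_const_mul]
    congr 1
    ext s
    simp only [jump, ih]
    ring

theorem qms_add {t : ℝ} (ht : 0 ≤ t) (x y : FockSpace →L[ℂ] FockSpace) :
    Q.qms t (x + y) = Q.qms t x + Q.qms t y := by
  refine ext_coeff fun m n => ?_
  have h : coeff (x + y) = fun m n => coeff x m n + coeff y m n := by
    ext m n; exact coeff_add x y m n
  rw [coeff_add, coeff_qms _ ht, coeff_qms _ ht, coeff_qms _ ht, h]
  simp only [evol, dyson_add]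
  exact (Q.summable_dyson (formBounded_coeff x) ht m n).tsum_add
    (Q.summable_dyson (formBounded_coeff y) ht m n)

theorem qms_smul {t : ℝ} (ht : 0 ≤ t) (c : ℂ) (x : FockSpace →L[ℂ] FockSpace) :
    Q.qms t (c • x) = c • Q.qms t x := by
  refine ext_coeff fun m n => ?_
  have h : coeff (c • x) = fun m n => c * coeff x m n := by
    ext m n; exact coeff_smul c x m n
  rw [coeff_smul, coeff_qms _ ht, coeff_qms _ ht, h]
  simp only [evol, dyson_smul]
  exact tsum_mul_left

end QuadraticOscillator

/-! ## A Poincaré inequality for a birth and death chain with geometric invariant law -/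

/-- The shifted Lerch function `∑ₖ pᵏ / (k + m + r)`. -/
def lerchShift (p r : ℝ) (m : ℕ) : ℝ := ∑' k : ℕ, p ^ k / ((k : ℝ) + m + r)

section Poincare

variable {p r : ℝ}

theorem summable_lerchShift (hp : 0 < p) (hp1 : p < 1) (hr : 0 < r) (m : ℕ) :
    Summable fun k : ℕ => p ^ k / ((k : ℝ) + m + r) := by
  refine Summable.of_nonneg_of_le (fun k => by positivity) (fun k => ?_)
    ((summable_geometric_of_lt_one hp.le hp1).div_const r)
  have : r ≤ (k : ℝ) + m + r := by linarith [k.cast_nonneg (α := ℝ), m.cast_nonneg (α := ℝ)]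
  gcongr

theorem lerchShift_zero : lerchShift p r 0 = lerchPhi p 1 r := by
  simp [lerchShift, lerchPhi]

theorem lerchShift_pos (hp : 0 < p) (hp1 : p < 1) (hr : 0 < r) (m : ℕ) : 0 < lerchShift p r m :=
  (summable_lerchShift hp hp1 hr m).tsum_pos (fun k => by positivity) 0 (by positivity)

theorem lerchShift_le (hp : 0 < p) (hp1 : p < 1) (hr : 0 < r) (m : ℕ) :
    lerchShift p r m ≤ lerchShift p r 0 := by
  refine (summable_lerchShift hp hp1 hr m).tsum_le_tsum (fun k => ?_)
    (summable_lerchShift hp hp1 hr 0)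
  have : (0 : ℝ) ≤ m := m.cast_nonneg
  rw [Nat.cast_zero, add_zero]
  gcongr
  linarith

/-- Splitting off the term k = 0 of the series. This recursion makes pⁿ · `lerchSum p r n` a
solution of the difference equation behind `dual_hardy`, and it explains why the Lerch function is
the constant. -/
theorem lerchShift_sub (hp : 0 < p) (hp1 : p < 1) (hr : 0 < r) (m : ℕ) :
    lerchShift p r m - p * lerchShift p r (m + 1) = 1 / (m + r) := by
  unfold lerchShift
  rw [(summable_lerchShift hp hp1 hr m).tsum_eq_zero_add, ← tsum_mul_left]
  have : ∀ k : ℕ, p ^ (k + 1) / (((k + 1 : ℕ) : ℝ) + m + r)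
      = p * (p ^ k / ((k : ℝ) + (m + 1 : ℕ) + r)) := by
    intro k
    push_cast
    rw [pow_succ', mul_div_assoc]
    congr 3
    ring
  simp only [this]
  simp

theorem lerchPhi_le (hp : 0 < p) (hp1 : p < 1) (hr : 0 < r) :
    lerchPhi p 1 r ≤ 1 / (r * (1 - p)) := by
  rw [← lerchShift_zero]
  have h : lerchShift p r 0 ≤ ∑' k : ℕ, p ^ k / r := by
    refine (summable_lerchShift hp hp1 hr 0).tsum_le_tsum (fun k => ?_)
      ((summable_geometric_of_lt_one hp.le hp1).div_const r)
    have : r ≤ (k : ℝ) + (0 : ℕ) + r := by simp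
    gcongr
  rw [tsum_div_const, tsum_geometric_of_lt_one hp.le hp1] at h
  refine h.trans (le_of_eq ?_)
  have : 1 - p ≠ 0 := by linarith
  field_simp

/-- The increasing test function of the chain, summed. -/
def lerchSum (p r : ℝ) (n : ℕ) : ℝ := ∑ m ∈ Finset.range (n + 1), lerchShift p r m

theorem lerchSum_pos (hp : 0 < p) (hp1 : p < 1) (hr : 0 < r) (n : ℕ) : 0 < lerchSum p r n :=
  Finset.sum_pos (fun m _ => lerchShift_pos hp hp1 hr m) ⟨0, by simp⟩

theorem lerchSum_le (hp : 0 < p) (hp1 : p < 1) (hr : 0 < r) (n : ℕ) :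
    lerchSum p r n ≤ (n + 1) * lerchShift p r 0 := by
  have h := Finset.sum_le_card_nsmul (Finset.range (n + 1)) (lerchShift p r) _
    fun m _ => lerchShift_le hp hp1 hr m
  simpa [lerchSum] using h

/-- The Hardy inequality for the dual chain, on an initial segment. -/
theorem dual_hardy (hp : 0 < p) (hp1 : p < 1) (hr : 0 < r) (f : ℕ → ℂ) (N : ℕ) :
    ∑ n ∈ Finset.range (N + 1),
        ‖∑ j ∈ Finset.range (n + 1), (p : ℂ) ^ j * f j‖ ^ 2 / (p ^ (n + 1) * ((n + 1) * (n + r)))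
      ≤ lerchPhi p 1 r * (∑ n ∈ Finset.range (N + 1), p ^ n * ‖f n‖ ^ 2
        + ‖∑ j ∈ Finset.range (N + 1), (p : ℂ) ^ j * f j‖ ^ 2 / p ^ (N + 1)) := by
  set S : ℕ → ℂ := fun n => ∑ j ∈ Finset.range (n + 1), (p : ℂ) ^ j * f j with hS
  -- Ground state: u(n) = pⁿ q(n), with u(-1) = 0, satisfies (u(n) - u(n-1))/pⁿ - (u(n+1) -
  -- u(n))/pⁿ⁺¹ = 1/(p(n+r)). Since pⁿ f(n) = S(n) - S(n-1), the quantity to be bounded below is Σ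
  -- |S(n) - S(n-1)|²/pⁿ, and Picone's argument with u applies.
  set q := lerchSum p r with hq
  set φ := lerchShift p r 0 with hφ
  have hφp : 0 < φ := lerchShift_pos hp hp1 hr 0
  have hqp : ∀ n, 0 < q n := lerchSum_pos hp hp1 hr
  have hq1 : ∀ n, q (n + 1) = q n + lerchShift p r (n + 1) := fun n => Finset.sum_range_succ _ _
  have hq0 : q 0 = φ := by simp [hq, lerchSum, hφ]
  set T : ℕ → ℝ := fun n => ‖S n‖ ^ 2 / p ^ n with hT
  have hT0 : ∀ n, 0 ≤ T n := fun n => by positivity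
  -- The boundary term that the ground state argument leaves at the end of the segment.
  set A : ℕ → ℝ := fun n => T n * (1 / p - q (n + 1) / q n) with hA
  have key : ∑ n ∈ Finset.range (N + 1), T n / (p * q n * (n + r)) - A N
      ≤ ∑ n ∈ Finset.range (N + 1), p ^ n * ‖f n‖ ^ 2 := by
    induction N with
    | zero =>
      have h1 := lerchShift_sub hp hp1 hr 0
      have h2 : T 0 = ‖f 0‖ ^ 2 := by simp [hT, hS]
      have h3 : lerchShift p r 1 = (φ - 1 / r) / p := by
        rw [eq_div_iff hp.ne']; simp only [Nat.cast_zero, zero_add] at h1; linarith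
      simp only [zero_add, Finset.range_one, Finset.sum_singleton, Nat.cast_zero, pow_zero, one_mul,
        hA, h2, hq1 0, hq0, h3]
      apply le_of_eq
      field_simp
      ring
    | succ N ih =>
      rw [Finset.sum_range_succ, Finset.sum_range_succ (fun n => p ^ n * ‖f n‖ ^ 2)]
      have h1 := lerchShift_sub hp hp1 hr (N + 1)
      have hpos : (0 : ℝ) < (N + 1 : ℕ) + r := by positivity
      have h3 : lerchShift p r (N + 2)
          = (lerchShift p r (N + 1) - 1 / ((N + 1 : ℕ) + r)) / p := by
        rw [eq_div_iff hp.ne']; linarith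
      have hcoef : T (N + 1) / (p * q (N + 1) * ((N + 1 : ℕ) + r)) - A (N + 1)
          = T (N + 1) * (1 - q N / (p * q (N + 1))) := by
        have h4 : q N = q (N + 1) - lerchShift p r (N + 1) := by rw [hq1]; ring
        have := (hqp (N + 1)).ne'
        simp only [hA, hq1 (N + 1), h4]
        rw [h3]
        field_simp
        ring
      have hstep : A N + T (N + 1) * (1 - q N / (p * q (N + 1))) ≤ p ^ (N + 1) * ‖f (N + 1)‖ ^ 2 := by
        have h5 : S (N + 1) - S N = (p : ℂ) ^ (N + 1) * f (N + 1) := by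
          simp only [hS]; rw [Finset.sum_range_succ _ (N + 1)]; ring
        have h6 : p ^ (N + 1) * ‖f (N + 1)‖ ^ 2 = ‖S (N + 1) - S N‖ ^ 2 / p ^ (N + 1) := by
          rw [h5, norm_mul, norm_pow, Complex.norm_real, Real.norm_of_nonneg hp.le]
          field_simp
        have h7 : (‖S (N + 1)‖ - ‖S N‖) ^ 2 ≤ ‖S (N + 1) - S N‖ ^ 2 := by
          rw [sq_le_sq, abs_of_nonneg (norm_nonneg (S (N + 1) - S N))]
          exact abs_norm_sub_norm_le _ _
        have h8 := hqp N
        have h9 := hqp (N + 1)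
        -- The defect in one step is a perfect square, which vanishes when S(n) is proportional to
        -- pⁿ q(n).
        have h10 : (‖S (N + 1)‖ - ‖S N‖) ^ 2 / p ^ (N + 1)
            - (A N + T (N + 1) * (1 - q N / (p * q (N + 1))))
            = (p * q (N + 1) * ‖S N‖ - q N * ‖S (N + 1)‖) ^ 2
              / (p ^ (N + 1) * (p * q (N + 1) * q N)) := by
          simp only [hA, hT]
          field_simp
          ring
        have h11 : 0 ≤ (p * q (N + 1) * ‖S N‖ - q N * ‖S (N + 1)‖) ^ 2
              / (p ^ (N + 1) * (p * q (N + 1) * q N)) := by positivity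
        have h12 : (‖S (N + 1)‖ - ‖S N‖) ^ 2 / p ^ (N + 1) ≤ ‖S (N + 1) - S N‖ ^ 2 / p ^ (N + 1) := by
          gcongr
        linarith
      linarith
  -- The increments of q are at most the initial one, φ, so q(n) ≤ (n+1)φ. This trades the natural
  -- weight 1/q(n) for the weight 1/(n+1) of the chain, at the cost of the factor φ.
  have hterm : ∀ n, ‖S n‖ ^ 2 / (p ^ (n + 1) * ((n + 1) * (n + r)))
      ≤ φ * (T n / (p * q n * (n + r))) := by
    intro n
    have h1 := lerchSum_le hp hp1 hr n
    have h2 := hqp n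
    have h3 : φ * (T n / (p * q n * (n + r))) = ‖S n‖ ^ 2 / (p ^ (n + 1) * (q n / φ * (n + r))) := by
      simp only [hT]
      field_simp
      ring
    rw [h3]
    have h4 : q n / φ ≤ n + 1 := by rwa [div_le_iff₀ hφp]
    have h5 : 0 < q n / φ := by positivity
    gcongr
  have hAN : A N ≤ ‖S N‖ ^ 2 / p ^ (N + 1) := by
    have h1 : ‖S N‖ ^ 2 / p ^ (N + 1) = T N * (1 / p) := by
      simp only [hT]
      field_simp
      ring
    rw [h1]
    have := hqp N
    have := hqp (N + 1)
    refine mul_le_mul_of_nonneg_left ?_ (hT0 N)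
    have : 0 ≤ q (N + 1) / q N := by positivity
    linarith
  rw [← lerchShift_zero]
  calc _ ≤ ∑ n ∈ Finset.range (N + 1), φ * (T n / (p * q n * (n + r))) :=
        Finset.sum_le_sum fun n _ => hterm n
    _ = φ * ∑ n ∈ Finset.range (N + 1), T n / (p * q n * (n + r)) := by rw [Finset.mul_sum]
    _ ≤ _ := mul_le_mul_of_nonneg_left (by linarith) hφp.le

/-- Abel summation of pⁿ f(n) against conj f(n), with the partial sums of pʲ f(j) as primitive; the
boundary term is kept because the segment is finite. -/
theorem sum_by_parts (hp : 0 < p) (f : ℕ → ℂ) (N : ℕ) :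
    ∑ n ∈ Finset.range N, p ^ n * ‖f n‖ ^ 2
      ≤ ∑ n ∈ Finset.range N,
          ‖∑ j ∈ Finset.range (n + 1), (p : ℂ) ^ j * f j‖ * ‖f (n + 1) - f n‖
        + ‖∑ j ∈ Finset.range N, (p : ℂ) ^ j * f j‖ * ‖f N‖ := by
  have h : ∑ n ∈ Finset.range N, (p : ℂ) ^ n * f n * starRingEnd ℂ (f n)
      = -∑ n ∈ Finset.range N, (∑ j ∈ Finset.range (n + 1), (p : ℂ) ^ j * f j)
          * starRingEnd ℂ (f (n + 1) - f n)
        + (∑ j ∈ Finset.range N, (p : ℂ) ^ j * f j) * starRingEnd ℂ (f N) := by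
    induction N with
    | zero => simp
    | succ N ih =>
      rw [Finset.sum_range_succ, ih, Finset.sum_range_succ (fun n =>
        (∑ j ∈ Finset.range (n + 1), (p : ℂ) ^ j * f j) * starRingEnd ℂ (f (n + 1) - f n)),
        Finset.sum_range_succ _ N, map_sub]
      ring
  have h2 : ((∑ n ∈ Finset.range N, p ^ n * ‖f n‖ ^ 2 : ℝ) : ℂ)
      = ∑ n ∈ Finset.range N, (p : ℂ) ^ n * f n * starRingEnd ℂ (f n) := by
    push_cast
    exact Finset.sum_congr rfl fun n _ => by rw [mul_assoc, Complex.mul_conj']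
  have h3 : 0 ≤ ∑ n ∈ Finset.range N, p ^ n * ‖f n‖ ^ 2 :=
    Finset.sum_nonneg fun n _ => by positivity
  rw [← Real.norm_of_nonneg h3, ← Complex.norm_real, h2, h]
  refine (norm_add_le _ _).trans ?_
  rw [norm_neg, norm_mul, RCLike.norm_conj]
  gcongr
  refine norm_sum_le_of_le _ fun n _ => ?_
  rw [norm_mul, RCLike.norm_conj]

/-- Tails of a centred bounded function decay geometrically. -/
theorem norm_partial_sum_le (hp : 0 < p) (hp1 : p < 1) {f : ℕ → ℂ} {C : ℝ} (hf : ∀ n, ‖f n‖ ≤ C)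
    (h0 : ∑' n, (p : ℂ) ^ n * f n = 0) (N : ℕ) :
    ‖∑ j ∈ Finset.range N, (p : ℂ) ^ j * f j‖ ≤ C / (1 - p) * p ^ N := by
  have hb : ∀ n, ‖(p : ℂ) ^ n * f n‖ ≤ C * p ^ n := by
    intro n
    rw [norm_mul, norm_pow, Complex.norm_real, Real.norm_of_nonneg hp.le, mul_comm]
    gcongr
    exact hf n
  have hg := (summable_geometric_of_lt_one hp.le hp1).mul_left C
  have hs : Summable fun n => (p : ℂ) ^ n * f n := Summable.of_norm_bounded hg hb
  have h1 := hs.sum_add_tsum_nat_add N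
  rw [h0, add_eq_zero_iff_eq_neg] at h1
  rw [h1, norm_neg]
  have h2 : ∀ i, ‖(p : ℂ) ^ (i + N) * f (i + N)‖ ≤ C * p ^ N * p ^ i := by
    intro i
    refine (hb (i + N)).trans (le_of_eq ?_)
    rw [pow_add]; ring
  refine (tsum_of_norm_bounded ((hasSum_geometric_of_lt_one hp.le hp1).mul_left (C * p ^ N)) h2).trans
    (le_of_eq ?_)
  ring

/-- The Poincaré inequality of the birth and death chain. -/
theorem poincare (hp : 0 < p) (hp1 : p < 1) (hr : 0 < r) {f : ℕ → ℂ} {C : ℝ}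
    (hf : ∀ n, ‖f n‖ ≤ C) (h0 : ∑' n, (p : ℂ) ^ n * f n = 0)
    (hs : Summable fun n : ℕ => p ^ (n + 1) * ((n + 1) * (n + r)) * ‖f (n + 1) - f n‖ ^ 2) :
    ∑' n, p ^ n * ‖f n‖ ^ 2
      ≤ lerchPhi p 1 r
        * ∑' n : ℕ, p ^ (n + 1) * ((n + 1) * (n + r)) * ‖f (n + 1) - f n‖ ^ 2 := by
  set φ := lerchPhi p 1 r with hφ
  have hφp : 0 < φ := by rw [hφ, ← lerchShift_zero]; exact lerchShift_pos hp hp1 hr 0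
  have hC : 0 ≤ C := (norm_nonneg _).trans (hf 0)
  have hV : Summable fun n => p ^ n * ‖f n‖ ^ 2 := by
    refine Summable.of_nonneg_of_le (fun n => by positivity) (fun n => ?_)
      ((summable_geometric_of_lt_one hp.le hp1).mul_right (C ^ 2))
    have := hf n
    gcongr
  set S : ℕ → ℂ := fun n => ∑ j ∈ Finset.range (n + 1), (p : ℂ) ^ j * f j with hS
  have hSb : ∀ n, ‖S n‖ ≤ C / (1 - p) * p ^ (n + 1) := fun n =>
    norm_partial_sum_le hp hp1 hf h0 (n + 1)
  have hfin : ∀ N, ∑ n ∈ Finset.range (N + 1), p ^ n * ‖f n‖ ^ 2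
      ≤ φ * ∑ n ∈ Finset.range (N + 1), p ^ (n + 1) * ((n + 1) * (n + r)) * ‖f (n + 1) - f n‖ ^ 2
        + ((C / (1 - p)) ^ 2 * p ^ (N + 1) + 2 * (C / (1 - p) * p ^ (N + 1)) * C) := by
    intro N
    have h1 := dual_hardy hp hp1 hr f N
    have h2 := sum_by_parts hp f (N + 1)
    -- Weighted arithmetic-geometric inequality. The coefficient 1/(2φ) is chosen so that
    -- `dual_hardy` turns the first half into half of the left-hand side, which is then absorbed.
    have h3 : ∀ n : ℕ, ‖S n‖ * ‖f (n + 1) - f n‖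
        ≤ (1 / (2 * φ)) * (‖S n‖ ^ 2 / (p ^ (n + 1) * ((n + 1) * (n + r))))
          + φ / 2 * (p ^ (n + 1) * ((n + 1) * (n + r)) * ‖f (n + 1) - f n‖ ^ 2) := by
      intro n
      set x := ‖S n‖
      set y := ‖f (n + 1) - f n‖
      have hc : 0 < p ^ (n + 1) * (((n : ℝ) + 1) * (n + r)) := by positivity
      set c := p ^ (n + 1) * (((n : ℝ) + 1) * (n + r))
      have : (1 / (2 * φ)) * (x ^ 2 / c) + φ / 2 * (c * y ^ 2) - x * y
          = (x - φ * c * y) ^ 2 / (2 * φ * c) := by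
        field_simp
        ring
      have h4 : 0 ≤ (x - φ * c * y) ^ 2 / (2 * φ * c) := by positivity
      linarith
    have h4 := Finset.sum_le_sum fun n (_ : n ∈ Finset.range (N + 1)) => h3 n
    rw [Finset.sum_add_distrib, ← Finset.mul_sum, ← Finset.mul_sum] at h4
    have h5 : ‖S N‖ ^ 2 / p ^ (N + 1) ≤ (C / (1 - p)) ^ 2 * p ^ (N + 1) := by
      rw [div_le_iff₀ (by positivity)]
      calc ‖S N‖ ^ 2 ≤ (C / (1 - p) * p ^ (N + 1)) ^ 2 := by gcongr; exact hSb N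
        _ = _ := by ring
    have h6 : ‖S N‖ * ‖f (N + 1)‖ ≤ C / (1 - p) * p ^ (N + 1) * C :=
      mul_le_mul (hSb N) (hf _) (norm_nonneg _) ((norm_nonneg _).trans (hSb N))
    have h7 := mul_le_mul_of_nonneg_left h1 (by positivity : 0 ≤ 1 / (2 * φ))
    have h8 : ∀ z, 1 / (2 * φ) * (φ * z) = z / 2 := by intro z; field_simp
    rw [h8] at h7
    linarith
  have ht1 := (tendsto_add_atTop_iff_nat 1).2 hV.hasSum.tendsto_sum_nat
  have ht2 := (tendsto_add_atTop_iff_nat 1).2 hs.hasSum.tendsto_sum_nat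
  have ht3 := (tendsto_add_atTop_iff_nat 1).2 (tendsto_pow_atTop_nhds_zero_of_lt_one hp.le hp1)
  have ht4 := (ht2.const_mul φ).add (((ht3.const_mul ((C / (1 - p)) ^ 2))).add
    (((ht3.const_mul (C / (1 - p))).const_mul 2).mul_const C))
  have := le_of_tendsto_of_tendsto' ht1 ht4 hfin
  simpa using this

end Poincare

namespace QuadraticOscillator

variable (Q : QuadraticOscillator)

/-! ## Energy estimates -/

/-- The weight `ρₘ^{1/2} ρₙ^{1/2}` of the matrix unit `(m, n)`. -/
def weight (m n : ℕ) : ℝ := (1 - Q.nu ^ 2) * Q.nu ^ (m + n)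

theorem one_sub_nu_sq_pos : 0 < 1 - Q.nu ^ 2 := by nlinarith [Q.nu_pos, Q.nu_lt_one]

theorem weight_pos (m n : ℕ) : 0 < Q.weight m n :=
  mul_pos Q.one_sub_nu_sq_pos (pow_pos Q.nu_pos _)

theorem lam_eq : Q.lam = Q.nu * Q.mu := by
  rw [nu, div_mul_cancel₀ _ Q.mu_pos.ne']

/-- Detailed balance between (m,n) and (m+1,n+1), from λ = νμ. -/
theorem mu_sq_mul_weight_succ (m n : ℕ) :
    Q.mu ^ 2 * Q.weight (m + 1) (n + 1) = Q.lam ^ 2 * Q.weight m n := by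
  rw [lam_eq, weight, weight]
  ring

theorem omega_succ (n : ℕ) : Q.omega (n + 1) = (n + 1) * (n + Q.r) := by
  unfold omega
  push_cast
  ring

theorem omega_le (n : ℕ) : Q.omega n ≤ (1 + Q.r) * ((n : ℝ) + 1) ^ 2 := by
  have h : (0 : ℝ) ≤ n := n.cast_nonneg
  have hr := Q.r_pos
  unfold omega
  nlinarith [mul_nonneg h h, mul_nonneg hr.le h, mul_nonneg (mul_nonneg hr.le h) h]

theorem omega_succ_le (n : ℕ) : Q.omega (n + 1) ≤ (1 + Q.r) * ((n : ℝ) + 1) ^ 2 := by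
  have h : (0 : ℝ) ≤ n := n.cast_nonneg
  have hr := Q.r_pos
  rw [omega_succ]
  nlinarith [mul_nonneg h h, mul_nonneg hr.le h, mul_nonneg (mul_nonneg hr.le h) h]

theorem sqrt_omega_le {n k : ℕ} (h : Q.omega n ≤ (1 + Q.r) * ((k : ℝ) + 1) ^ 2) :
    √(Q.omega n) ≤ √(1 + Q.r) * ((k : ℝ) + 1) := by
  refine (Real.sqrt_le_sqrt h).trans (le_of_eq ?_)
  rw [Real.sqrt_mul (by linarith [Q.r_pos]), Real.sqrt_sq (by positivity)]

theorem sqrt_omega_mul_le {m n k l : ℕ} (h : Q.omega m ≤ (1 + Q.r) * ((k : ℝ) + 1) ^ 2)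
    (h' : Q.omega n ≤ (1 + Q.r) * ((l : ℝ) + 1) ^ 2) :
    √(Q.omega m) * √(Q.omega n) ≤ (1 + Q.r) * (((k : ℝ) + 1) * (l + 1)) ^ 2 := by
  have h1 := mul_le_mul (Q.sqrt_omega_le h) (Q.sqrt_omega_le h') (Real.sqrt_nonneg _)
    (by positivity)
  have h2 : √(1 + Q.r) * √(1 + Q.r) = 1 + Q.r := Real.mul_self_sqrt (by linarith [Q.r_pos])
  have hk : (0 : ℝ) ≤ k := k.cast_nonneg
  have hl : (0 : ℝ) ≤ l := l.cast_nonneg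
  have h3 : (1 : ℝ) ≤ ((k : ℝ) + 1) * (l + 1) := by nlinarith [mul_nonneg hk hl]
  have hr := Q.r_pos
  calc _ ≤ _ := h1
    _ = √(1 + Q.r) * √(1 + Q.r) * (((k : ℝ) + 1) * (l + 1)) := by ring
    _ = (1 + Q.r) * (((k : ℝ) + 1) * (l + 1)) := by rw [h2]
    _ ≤ _ := by
      refine mul_le_mul_of_nonneg_left ?_ (by linarith)
      nlinarith

theorem norm_gEig_le (n : ℕ) :
    ‖Q.gEig n‖ ≤ (Q.lam ^ 2 / 2 + |Q.zp| + Q.mu ^ 2 / 2 + |Q.zm|) * (1 + Q.r) * ((n : ℝ) + 1) ^ 2 := by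
  have h1 := Q.omega_succ_le n
  have h2 := Q.omega_le n
  have h3 := Q.omega_nonneg n
  have h4 := Q.omega_nonneg (n + 1)
  have e1 : ‖-(((Q.lam ^ 2 / 2 : ℝ) : ℂ) + Complex.I * Q.zp)‖ ≤ Q.lam ^ 2 / 2 + |Q.zp| := by
    rw [norm_neg]
    refine (norm_add_le _ _).trans (le_of_eq ?_)
    rw [norm_mul, Complex.norm_I, one_mul, Complex.norm_real, Complex.norm_real,
      Real.norm_of_nonneg (by positivity), Real.norm_eq_abs]
  have e2 : ‖(((Q.mu ^ 2 / 2 : ℝ) : ℂ) + Complex.I * Q.zm)‖ ≤ Q.mu ^ 2 / 2 + |Q.zm| := by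
    refine (norm_add_le _ _).trans (le_of_eq ?_)
    rw [norm_mul, Complex.norm_I, one_mul, Complex.norm_real, Complex.norm_real,
      Real.norm_of_nonneg (by positivity), Real.norm_eq_abs]
  unfold gEig
  refine (norm_sub_le _ _).trans ?_
  rw [norm_mul, norm_mul, Complex.norm_real, Complex.norm_real, Real.norm_of_nonneg h3,
    Real.norm_of_nonneg h4]
  calc _ ≤ (Q.lam ^ 2 / 2 + |Q.zp|) * ((1 + Q.r) * ((n : ℝ) + 1) ^ 2)
        + (Q.mu ^ 2 / 2 + |Q.zm|) * ((1 + Q.r) * ((n : ℝ) + 1) ^ 2) := by gcongr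
    _ = _ := by ring

/-- The Lindblad generator has polynomially growing coefficients. -/
theorem exists_norm_lindblad_le : ∃ K : ℝ, 0 ≤ K ∧ ∀ (b : ℕ → ℕ → ℂ) (C : ℝ),
    (∀ m n, ‖b m n‖ ≤ C) → ∀ m n : ℕ,
      ‖Q.lindblad b m n‖ ≤ K * C * (((m : ℝ) + 1) * (n + 1)) ^ 2 := by
  have hr := Q.r_pos
  set K₁ := (Q.lam ^ 2 / 2 + |Q.zp| + Q.mu ^ 2 / 2 + |Q.zm|) * (1 + Q.r) with hK₁
  have hK₁0 : 0 ≤ K₁ := by positivity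
  refine ⟨2 * K₁ + (Q.mu ^ 2 + Q.lam ^ 2) * (1 + Q.r), by positivity, fun b C hb m n => ?_⟩
  have hC : 0 ≤ C := (norm_nonneg _).trans (hb 0 0)
  set X := (((m : ℝ) + 1) * (n + 1)) ^ 2 with hX
  have hm : (0 : ℝ) ≤ m := m.cast_nonneg
  have hn : (0 : ℝ) ≤ n := n.cast_nonneg
  have h1 : ((m : ℝ) + 1) ^ 2 ≤ X := by
    rw [hX, mul_pow]
    exact le_mul_of_one_le_right (by positivity) (by nlinarith)
  have h2 : ((n : ℝ) + 1) ^ 2 ≤ X := by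
    rw [hX, mul_pow]
    exact le_mul_of_one_le_left (by positivity) (by nlinarith)
  have h3 : ‖Q.drift m n‖ ≤ 2 * K₁ * X := by
    refine (norm_add_le _ _).trans ?_
    rw [RCLike.norm_conj]
    have e1 := (Q.norm_gEig_le m).trans (mul_le_mul_of_nonneg_left h1 hK₁0)
    have e2 := (Q.norm_gEig_le n).trans (mul_le_mul_of_nonneg_left h2 hK₁0)
    rw [← hK₁] at e1 e2
    linarith
  have h4 := Q.norm_jump_le hb m n
  have h5 := Q.sqrt_omega_mul_le (Q.omega_le m) (Q.omega_le n)
  have h6 := Q.sqrt_omega_mul_le (Q.omega_succ_le m) (Q.omega_succ_le n)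
  have h7 : (Q.mu ^ 2 * (√(Q.omega m) * √(Q.omega n))
      + Q.lam ^ 2 * (√(Q.omega (m + 1)) * √(Q.omega (n + 1)))) * C
      ≤ (Q.mu ^ 2 * ((1 + Q.r) * X) + Q.lam ^ 2 * ((1 + Q.r) * X)) * C := by gcongr
  have h8 : ‖Q.drift m n * b m n‖ ≤ 2 * K₁ * X * C := by
    rw [norm_mul]
    exact mul_le_mul h3 (hb m n) (norm_nonneg _) (by positivity)
  refine (norm_add_le _ _).trans ?_
  linarith

/-- A summable function on `ℕ × ℕ` that dominates all the energy densities. -/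
def dominator (m n : ℕ) : ℝ := Q.nu ^ (m + n) * (((m : ℝ) + 1) * (n + 1)) ^ 4

theorem summable_dominator : Summable fun p : ℕ × ℕ => Q.dominator p.1 p.2 := by
  have h : Summable fun n : ℕ => Q.nu ^ n * ((n : ℝ) + 1) ^ 4 := by
    have h1 := summable_pow_mul_geometric_of_norm_lt_one 4 (r := Q.nu)
      (by rw [Real.norm_of_nonneg Q.nu_pos.le]; exact Q.nu_lt_one)
    have h2 := ((summable_nat_add_iff 1).2 h1).mul_left Q.nu⁻¹
    refine h2.congr fun n => ?_
    have := Q.nu_pos.ne'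
    push_cast
    field_simp
    ring
  have hnn : 0 ≤ fun n : ℕ => Q.nu ^ n * ((n : ℝ) + 1) ^ 4 := fun n => by
    have := Q.nu_pos
    positivity
  refine (h.mul_of_nonneg h hnn hnn).congr fun p => ?_
  rw [dominator]
  ring

theorem summable_of_le_dominator {E : Type*} [NormedAddCommGroup E] [CompleteSpace E]
    {h : ℕ → ℕ → E} {K : ℝ} (hK : ∀ m n, ‖h m n‖ ≤ K * Q.dominator m n) :
    Summable fun p : ℕ × ℕ => h p.1 p.2 :=
  Summable.of_norm_bounded (Q.summable_dominator.mul_left K) fun p => hK p.1 p.2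

theorem summable_diag_of_le_dominator {E : Type*} [NormedAddCommGroup E] [CompleteSpace E]
    {h : ℕ → E} {K : ℝ} (hK : ∀ n, ‖h n‖ ≤ K * Q.dominator n n) : Summable h :=
  Summable.of_norm_bounded ((Q.summable_dominator.mul_left K).comp_injective
    (i := fun n : ℕ => (n, n)) fun _ _ h => (Prod.mk.inj h).1) hK

theorem weight_le (m n : ℕ) : Q.weight m n ≤ Q.nu ^ (m + n) := by
  have := pow_pos Q.nu_pos (m + n)
  exact mul_le_of_le_one_left this.le (by nlinarith [Q.nu_pos])

/-- Domination of a product of a weight, a quartic coefficient and a bounded factor. -/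
theorem weight_mul_le_dominator {m n : ℕ} {a A : ℝ} (hA : 0 ≤ A)
    (ha : a ≤ A * (((m : ℝ) + 1) * (n + 1)) ^ 2) :
    Q.weight m n * a ≤ A * Q.dominator m n := by
  have hm : (0 : ℝ) ≤ m := m.cast_nonneg
  have hn : (0 : ℝ) ≤ n := n.cast_nonneg
  have h1 : (1 : ℝ) ≤ (((m : ℝ) + 1) * (n + 1)) ^ 2 :=
    one_le_pow₀ (by nlinarith [mul_nonneg hm hn])
  have h2 : (((m : ℝ) + 1) * (n + 1)) ^ 2 ≤ (((m : ℝ) + 1) * (n + 1)) ^ 4 := by nlinarith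
  have h3 := Q.weight_le m n
  have h4 := (Q.weight_pos m n).le
  have h5 : 0 ≤ Q.nu ^ (m + n) := h4.trans h3
  calc _ ≤ Q.weight m n * (A * (((m : ℝ) + 1) * (n + 1)) ^ 4) := by gcongr; exact ha.trans (by gcongr)
    _ ≤ Q.nu ^ (m + n) * (A * (((m : ℝ) + 1) * (n + 1)) ^ 4) := by gcongr
    _ = _ := by unfold dominator; ring

theorem shift_injective : Function.Injective fun p : ℕ × ℕ => (p.1 + 1, p.2 + 1) := by
  rintro ⟨a, b⟩ ⟨c, d⟩ h
  simp only [Prod.mk.injEq, add_left_inj] at h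
  exact Prod.ext h.1 h.2

/-- The diagonal shift misses only the row and the column of index 0, where h vanishes. It expresses
the cancellation of transported energy. -/
theorem tsum_shift {h : ℕ → ℕ → ℝ} (hl : ∀ n, h 0 n = 0) (hr : ∀ m, h m 0 = 0) :
    ∑' p : ℕ × ℕ, h (p.1 + 1) (p.2 + 1) = ∑' p : ℕ × ℕ, h p.1 p.2 := by
  refine shift_injective.tsum_eq (f := fun p : ℕ × ℕ => h p.1 p.2) ?_
  rintro ⟨m, n⟩ hmn
  rcases m with _ | m
  · exact absurd (hl n) hmn
  rcases n with _ | n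
  · exact absurd (hr (m + 1)) hmn
  exact ⟨(m, n), rfl⟩

theorem tsum_diag {E : Type*} [NormedAddCommGroup E] {d : ℕ → E} :
    ∑' p : ℕ × ℕ, (if p.1 = p.2 then d p.1 else 0) = ∑' n, d n := by
  have hinj : Function.Injective fun n : ℕ => (n, n) := fun _ _ h => (Prod.mk.inj h).1
  have h := hinj.tsum_eq (f := fun p : ℕ × ℕ => if p.1 = p.2 then d p.1 else 0) (by
    rintro ⟨m, n⟩ hmn
    have : m = n := by
      by_contra h
      exact hmn (if_neg h)
    exact ⟨m, by simp [this]⟩)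
  simpa using h.symm

/-! ### Pointwise energy estimates on the diagonals -/

/-- The rate of decay of the first off-diagonal. -/
def gapRate : ℝ := Q.mu ^ 2 / 2 * (2 * Q.nu ^ 2 + Q.r * (1 - Q.nu ^ 2))

theorem gapRate_eq : Q.gapRate = Q.lam ^ 2 + Q.r * (Q.mu ^ 2 - Q.lam ^ 2) / 2 := by
  rw [gapRate, lam_eq]
  ring

theorem gapRate_pos : 0 < Q.gapRate := by
  have h1 := Q.one_sub_nu_sq_pos
  have h2 := Q.nu_pos
  have h3 := Q.mu_pos
  have h4 := Q.r_pos
  unfold gapRate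
  positivity

/-- The coefficient that is transported along an off-diagonal. -/
def transport (m n : ℕ) : ℝ := (min m n : ℕ) * ((max m n : ℕ) + Q.r - 1)

theorem transport_succ (m n : ℕ) :
    Q.transport (m + 1) (n + 1) = ((min m n : ℕ) + 1) * ((max m n : ℕ) + Q.r) := by
  unfold transport
  rw [Nat.add_min_add_right, Nat.add_max_add_right]
  push_cast
  ring

theorem transport_nonneg (m n : ℕ) : 0 ≤ Q.transport m n := by
  rcases m with _ | m
  · simp [transport]
  rcases n with _ | n
  · simp [transport]
  rw [transport_succ]
  have := Q.r_pos
  positivity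

theorem transport_le (m n : ℕ) : Q.transport m n ≤ (1 + Q.r) * (((m : ℝ) + 1) * (n + 1)) ^ 2 := by
  have hr := Q.r_pos
  have hm : (0 : ℝ) ≤ m := m.cast_nonneg
  have hn : (0 : ℝ) ≤ n := n.cast_nonneg
  have key : ∀ a c : ℝ, 0 ≤ a → 0 ≤ c → a * (c + Q.r - 1) ≤ (1 + Q.r) * ((a + 1) * (c + 1)) ^ 2 := by
    intro a c ha hc
    have h1 : a * (c + Q.r - 1) ≤ (1 + Q.r) * ((a + 1) * (c + 1)) := by
      nlinarith [mul_nonneg ha hc, mul_nonneg hr.le ha, mul_nonneg hr.le hc,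
        mul_nonneg hr.le (mul_nonneg ha hc)]
    have h2 : 1 ≤ (a + 1) * (c + 1) := by nlinarith [mul_nonneg ha hc]
    refine h1.trans (mul_le_mul_of_nonneg_left ?_ (by linarith))
    nlinarith
  unfold transport
  rcases le_total m n with h | h
  · rw [min_eq_left h, max_eq_right h]
    exact key _ _ hm hn
  · rw [min_eq_right h, max_eq_left h, mul_comm ((m : ℝ) + 1)]
    exact key _ _ hn hm

/-- The right-hand side depends only on the distance |m - n|: all terms in the position along the
diagonal cancel. This is the reason for the choice of `transport` and of the coefficient
(min+r)(max+1). -/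
theorem gapRate_le {m n : ℕ} (h : m ≠ n) :
    Q.gapRate ≤ Q.killRate m + Q.killRate n
      - Q.lam ^ 2 * (((min m n : ℕ) + Q.r) * ((max m n : ℕ) + 1)) - Q.mu ^ 2 * Q.transport m n := by
  wlog hmn : m < n generalizing m n
  · have := this h.symm (by omega)
    unfold transport at this ⊢
    rw [min_comm n m, max_comm n m] at this
    linarith
  obtain ⟨d, rfl⟩ := Nat.exists_eq_add_of_lt hmn
  have h1 : min m (m + d + 1) = m := by omega
  have h2 : max m (m + d + 1) = m + d + 1 := by omega
  rw [transport, h1, h2, gapRate_eq, killRate, killRate]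
  simp only [omega]
  push_cast
  -- Here the distance is d + 1. The value increases with d and equals `gapRate` at d = 0.
  have e : ((Q.lam ^ 2 * ((m + 1) * (m + 1 + Q.r - 1)) + Q.mu ^ 2 * (m * (m + Q.r - 1))) / 2 +
          (Q.lam ^ 2 * (((m : ℝ) + d + 1 + 1) * (m + d + 1 + 1 + Q.r - 1))
            + Q.mu ^ 2 * ((m + d + 1) * (m + d + 1 + Q.r - 1))) / 2 -
        Q.lam ^ 2 * ((m + Q.r) * (m + d + 1 + 1)) -
      Q.mu ^ 2 * (m * (m + d + 1 + Q.r - 1)))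
      = ((d : ℝ) + 1) / 2 * (d * (Q.lam ^ 2 + Q.mu ^ 2) + 2 * Q.lam ^ 2
          + Q.r * (Q.mu ^ 2 - Q.lam ^ 2)) := by ring
  rw [e]
  have hd : (0 : ℝ) ≤ d := d.cast_nonneg
  have hr := Q.r_pos
  have hlm : 0 ≤ Q.mu ^ 2 - Q.lam ^ 2 := by nlinarith [Q.lam_pos, Q.lam_lt_mu]
  have e1 : 0 ≤ (d : ℝ) * (Q.lam ^ 2 + Q.mu ^ 2) := by positivity
  have e2 : 0 ≤ 2 * Q.lam ^ 2 + Q.r * (Q.mu ^ 2 - Q.lam ^ 2) := by positivity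
  nlinarith [mul_nonneg hd e1, mul_nonneg hd e2]

/-- The energy density of a matrix, after a shift of the `μ²`-part along the diagonals. -/
def density (b : ℕ → ℕ → ℂ) (m n : ℕ) : ℝ :=
  -(Q.weight m n * (Q.killRate m + Q.killRate n) * ‖b m n‖ ^ 2)
    + 2 * (Q.lam ^ 2 * Q.weight m n * (√(Q.omega (m + 1)) * √(Q.omega (n + 1)))
      * (starRingEnd ℂ (b m n) * b (m + 1) (n + 1)).re)

/-- The cross term is split by 2√(αβ)xy ≤ αx² + βy². The α-part is absorbed into the decay rates; by
detailed balance the β-part is the energy transported from the next site, so the last two terms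
telescope along the diagonal. -/
theorem density_le_of_ne (b : ℕ → ℕ → ℂ) {m n : ℕ} (h : m ≠ n) :
    Q.density b m n ≤ -(Q.gapRate * (Q.weight m n * ‖b m n‖ ^ 2))
      - Q.mu ^ 2 * Q.weight m n * Q.transport m n * ‖b m n‖ ^ 2
      + Q.mu ^ 2 * Q.weight (m + 1) (n + 1) * Q.transport (m + 1) (n + 1)
        * ‖b (m + 1) (n + 1)‖ ^ 2 := by
  have hw := (Q.weight_pos m n).le
  have hr := Q.r_pos
  set x := ‖b m n‖ with hx
  set y := ‖b (m + 1) (n + 1)‖ with hy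
  set α := ((min m n : ℕ) + Q.r) * ((max m n : ℕ) + 1) with hα
  have hα0 : 0 ≤ α := by positivity
  set β := Q.transport (m + 1) (n + 1) with hβ
  have hβ0 : 0 ≤ β := Q.transport_nonneg _ _
  set c := √(Q.omega (m + 1)) * √(Q.omega (n + 1)) with hc
  have hc0 : 0 ≤ c := by positivity
  -- Both sides are the product of the four factors m+1, m+r, n+1, n+r, paired differently.
  have hcc : c ^ 2 = α * β := by
    rw [hc, mul_pow, Real.sq_sqrt (Q.omega_nonneg _), Real.sq_sqrt (Q.omega_nonneg _), omega_succ,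
      omega_succ, hβ, transport_succ, hα]
    rcases le_total m n with h | h
    · rw [min_eq_left h, max_eq_right h]; ring
    · rw [min_eq_right h, max_eq_left h]; ring
  have h1 : (starRingEnd ℂ (b m n) * b (m + 1) (n + 1)).re ≤ x * y := by
    refine (Complex.re_le_norm _).trans (le_of_eq ?_)
    rw [norm_mul, RCLike.norm_conj]
  have h2 : 2 * (c * (x * y)) ≤ α * x ^ 2 + β * y ^ 2 := by
    have e1 : c = √α * √β := by
      rw [← Real.sqrt_mul hα0, ← hcc, Real.sqrt_sq hc0]
    have e2 := sq_nonneg (√α * x - √β * y)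
    have e3 := Real.sq_sqrt hα0
    have e4 := Real.sq_sqrt hβ0
    calc 2 * (c * (x * y)) ≤ (√α) ^ 2 * x ^ 2 + (√β) ^ 2 * y ^ 2 := by rw [e1]; nlinarith
      _ = _ := by rw [e3, e4]
  have h3 := Q.gapRate_le h
  rw [← hα] at h3
  have h4 := Q.mu_sq_mul_weight_succ m n
  rw [h4]
  have h5 : 2 * (Q.lam ^ 2 * Q.weight m n * c * (starRingEnd ℂ (b m n) * b (m + 1) (n + 1)).re)
      ≤ Q.lam ^ 2 * Q.weight m n * (α * x ^ 2 + β * y ^ 2) := by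
    have : Q.lam ^ 2 * Q.weight m n * (c * (starRingEnd ℂ (b m n) * b (m + 1) (n + 1)).re)
      ≤ Q.lam ^ 2 * Q.weight m n * (c * (x * y)) := by gcongr
    have h6 := mul_le_mul_of_nonneg_left h2 (by positivity : 0 ≤ Q.lam ^ 2 * Q.weight m n)
    linarith
  have h6 := mul_le_mul_of_nonneg_left h3 (by positivity : 0 ≤ Q.weight m n * x ^ 2)
  unfold density
  linarith

/-- Completing the square in b(n+1,n+1) - b(n,n): what remains, by detailed balance, is a
telescoping difference. -/
theorem density_diag (b : ℕ → ℕ → ℂ) (n : ℕ) :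
    Q.density b n n = -(Q.lam ^ 2 * Q.weight n n * Q.omega (n + 1)
        * ‖b (n + 1) (n + 1) - b n n‖ ^ 2)
      + (Q.mu ^ 2 * Q.weight (n + 1) (n + 1) * Q.omega (n + 1) * ‖b (n + 1) (n + 1)‖ ^ 2
        - Q.mu ^ 2 * Q.weight n n * Q.omega n * ‖b n n‖ ^ 2) := by
  rw [mu_sq_mul_weight_succ, density, Real.mul_self_sqrt (Q.omega_nonneg _), killRate]
  have h : ‖b (n + 1) (n + 1) - b n n‖ ^ 2 = ‖b (n + 1) (n + 1)‖ ^ 2 + ‖b n n‖ ^ 2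
      - 2 * (starRingEnd ℂ (b n n) * b (n + 1) (n + 1)).re := by
    simp only [← Complex.normSq_eq_norm_sq]
    rw [Complex.normSq_sub, mul_comm (b (n + 1) (n + 1))]
  rw [h]
  ring

/-! ### Summability -/

section Summability

variable {b : ℕ → ℕ → ℂ} {C : ℝ}

theorem norm_sq_le (hb : ∀ m n, ‖b m n‖ ≤ C) (m n : ℕ) : ‖b m n‖ ^ 2 ≤ C ^ 2 := by
  have := hb m n
  gcongr

theorem summable_weight_norm_sq (hb : ∀ m n, ‖b m n‖ ≤ C) :
    Summable fun p : ℕ × ℕ => Q.weight p.1 p.2 * ‖b p.1 p.2‖ ^ 2 := by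
  refine Q.summable_of_le_dominator (h := fun m n => Q.weight m n * ‖b m n‖ ^ 2) (K := C ^ 2)
    fun m n => ?_
  rw [Real.norm_of_nonneg (mul_nonneg (Q.weight_pos m n).le (sq_nonneg _))]
  refine Q.weight_mul_le_dominator (sq_nonneg _) ((norm_sq_le hb m n).trans ?_)
  refine le_mul_of_one_le_right (sq_nonneg _) (one_le_pow₀ ?_)
  have hm : (0 : ℝ) ≤ m := m.cast_nonneg
  have hn : (0 : ℝ) ≤ n := n.cast_nonneg
  nlinarith [mul_nonneg hm hn]

theorem summable_transport (hb : ∀ m n, ‖b m n‖ ≤ C) :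
    Summable fun p : ℕ × ℕ => if p.1 = p.2 then 0 else
      Q.mu ^ 2 * Q.weight p.1 p.2 * Q.transport p.1 p.2 * ‖b p.1 p.2‖ ^ 2 := by
  have hr := Q.r_pos
  refine Q.summable_of_le_dominator (h := fun m n => if m = n then 0 else
      Q.mu ^ 2 * Q.weight m n * Q.transport m n * ‖b m n‖ ^ 2)
    (K := Q.mu ^ 2 * (1 + Q.r) * C ^ 2) fun m n => ?_
  have hw := (Q.weight_pos m n).le
  have ht := Q.transport_nonneg m n
  have h1 : Q.mu ^ 2 * Q.weight m n * Q.transport m n * ‖b m n‖ ^ 2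
      ≤ Q.mu ^ 2 * (1 + Q.r) * C ^ 2 * Q.dominator m n := by
    rw [show Q.mu ^ 2 * Q.weight m n * Q.transport m n * ‖b m n‖ ^ 2
      = Q.weight m n * (Q.mu ^ 2 * Q.transport m n * ‖b m n‖ ^ 2) by ring]
    refine Q.weight_mul_le_dominator (by positivity) ?_
    calc _ ≤ Q.mu ^ 2 * ((1 + Q.r) * (((m : ℝ) + 1) * (n + 1)) ^ 2) * C ^ 2 := by
          gcongr
          · exact Q.transport_le m n
          · exact hb m n
      _ = _ := by ring
  have h0 : 0 ≤ Q.mu ^ 2 * Q.weight m n * Q.transport m n * ‖b m n‖ ^ 2 := by positivity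
  split_ifs
  · rw [norm_zero]; exact h0.trans h1
  · rw [Real.norm_of_nonneg h0]; exact h1

theorem summable_mu_weight_omega (hb : ∀ m n, ‖b m n‖ ≤ C) :
    Summable fun n : ℕ => Q.mu ^ 2 * Q.weight n n * Q.omega n * ‖b n n‖ ^ 2 := by
  have hr := Q.r_pos
  refine Q.summable_diag_of_le_dominator (K := Q.mu ^ 2 * (1 + Q.r) * C ^ 2) fun n => ?_
  have hw := (Q.weight_pos n n).le
  have hω := Q.omega_nonneg n
  rw [Real.norm_of_nonneg (by positivity), show Q.mu ^ 2 * Q.weight n n * Q.omega n * ‖b n n‖ ^ 2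
      = Q.weight n n * (Q.mu ^ 2 * (√(Q.omega n) * √(Q.omega n)) * ‖b n n‖ ^ 2) by
        rw [Real.mul_self_sqrt hω]; ring]
  refine Q.weight_mul_le_dominator (by positivity) ?_
  calc _ ≤ Q.mu ^ 2 * ((1 + Q.r) * (((n : ℝ) + 1) * (n + 1)) ^ 2) * C ^ 2 := by
        exact mul_le_mul (mul_le_mul_of_nonneg_left
          (Q.sqrt_omega_mul_le (Q.omega_le n) (Q.omega_le n)) (sq_nonneg _))
          (norm_sq_le hb n n) (sq_nonneg _) (by positivity)
    _ = _ := by ring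

theorem summable_lam_weight_omega (hb : ∀ m n, ‖b m n‖ ≤ C) :
    Summable fun n : ℕ => Q.lam ^ 2 * Q.weight n n * Q.omega (n + 1)
      * ‖b (n + 1) (n + 1) - b n n‖ ^ 2 := by
  have hr := Q.r_pos
  have hC : 0 ≤ C := (norm_nonneg _).trans (hb 0 0)
  refine Q.summable_diag_of_le_dominator (K := Q.lam ^ 2 * (1 + Q.r) * (C + C) ^ 2) fun n => ?_
  have hw := (Q.weight_pos n n).le
  have hω := Q.omega_nonneg (n + 1)
  rw [Real.norm_of_nonneg (by positivity), show Q.lam ^ 2 * Q.weight n n * Q.omega (n + 1)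
      * ‖b (n + 1) (n + 1) - b n n‖ ^ 2
      = Q.weight n n * (Q.lam ^ 2 * (√(Q.omega (n + 1)) * √(Q.omega (n + 1)))
        * ‖b (n + 1) (n + 1) - b n n‖ ^ 2) by rw [Real.mul_self_sqrt hω]; ring]
  refine Q.weight_mul_le_dominator (by positivity) ?_
  calc _ ≤ Q.lam ^ 2 * ((1 + Q.r) * (((n : ℝ) + 1) * (n + 1)) ^ 2) * (C + C) ^ 2 := by
        exact mul_le_mul (mul_le_mul_of_nonneg_left
          (Q.sqrt_omega_mul_le (Q.omega_succ_le n) (Q.omega_succ_le n)) (sq_nonneg _))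
          (pow_le_pow_left₀ (norm_nonneg _)
            ((norm_sub_le _ _).trans (add_le_add (hb _ _) (hb _ _))) 2)
          (sq_nonneg _) (by positivity)
    _ = _ := by ring

end Summability

end QuadraticOscillator

namespace QuadraticOscillator

variable (Q : QuadraticOscillator)

/-! ### The energy inequality for a fixed matrix -/

section Static

variable {b : ℕ → ℕ → ℂ} {C : ℝ}

theorem summable_energy (hb : ∀ m n, ‖b m n‖ ≤ C) :
    Summable fun p : ℕ × ℕ =>
      Q.weight p.1 p.2 * (starRingEnd ℂ (b p.1 p.2) * Q.lindblad b p.1 p.2).re := by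
  obtain ⟨K, hK0, hK⟩ := Q.exists_norm_lindblad_le
  have hC : 0 ≤ C := (norm_nonneg _).trans (hb 0 0)
  refine Q.summable_of_le_dominator (h := fun m n =>
    Q.weight m n * (starRingEnd ℂ (b m n) * Q.lindblad b m n).re) (K := C * (K * C)) fun m n => ?_
  have hw := (Q.weight_pos m n).le
  rw [norm_mul, Real.norm_of_nonneg hw]
  refine Q.weight_mul_le_dominator (by positivity) ?_
  refine (Complex.abs_re_le_norm _).trans ?_
  rw [norm_mul, RCLike.norm_conj, mul_assoc C]
  exact mul_le_mul (hb m n) (hK b C hb m n) (norm_nonneg _) hC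

/-- The energy density that comes from the `μ²`-part of the jumps. -/
def jumpDensity (b : ℕ → ℕ → ℂ) (m n : ℕ) : ℝ :=
  Q.mu ^ 2 * Q.weight m n * (√(Q.omega m) * √(Q.omega n))
    * (starRingEnd ℂ (b (m - 1) (n - 1)) * b m n).re

theorem summable_jumpDensity (hb : ∀ m n, ‖b m n‖ ≤ C) :
    Summable fun p : ℕ × ℕ => Q.jumpDensity b p.1 p.2 := by
  have hC : 0 ≤ C := (norm_nonneg _).trans (hb 0 0)
  have hr := Q.r_pos
  refine Q.summable_of_le_dominator (h := fun m n => Q.jumpDensity b m n)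
    (K := Q.mu ^ 2 * (1 + Q.r) * (C * C)) fun m n => ?_
  have hw := (Q.weight_pos m n).le
  rw [jumpDensity, norm_mul, Real.norm_of_nonneg (by positivity),
    show ∀ a c x y : ℝ, a * c * x * y = c * (a * x * y) by intros; ring]
  refine Q.weight_mul_le_dominator (by positivity) ?_
  have h1 : ‖(starRingEnd ℂ (b (m - 1) (n - 1)) * b m n).re‖ ≤ C * C := by
    refine (Complex.abs_re_le_norm _).trans ?_
    rw [norm_mul, RCLike.norm_conj]
    exact mul_le_mul (hb _ _) (hb _ _) (norm_nonneg _) hC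
  calc _ ≤ Q.mu ^ 2 * ((1 + Q.r) * (((m : ℝ) + 1) * (n + 1)) ^ 2) * (C * C) :=
        mul_le_mul (mul_le_mul_of_nonneg_left
          (Q.sqrt_omega_mul_le (Q.omega_le m) (Q.omega_le n)) (sq_nonneg _)) h1 (norm_nonneg _)
          (by positivity)
    _ = _ := by ring

/-- By detailed balance, shifting the μ²-jump term from (m,n) to (m+1,n+1) makes it a second copy of
the λ²-jump term at (m,n). The correction is a discrete divergence, whose sum vanishes. -/
theorem density_eq (b : ℕ → ℕ → ℂ) (m n : ℕ) :
    Q.density b m n = Q.weight m n * (starRingEnd ℂ (b m n) * Q.lindblad b m n).re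
      - Q.jumpDensity b m n + Q.jumpDensity b (m + 1) (n + 1) := by
  have h1 : (starRingEnd ℂ (b m n) * Q.lindblad b m n).re
      = -(Q.killRate m + Q.killRate n) * ‖b m n‖ ^ 2
        + Q.mu ^ 2 * (√(Q.omega m) * √(Q.omega n))
          * (starRingEnd ℂ (b (m - 1) (n - 1)) * b m n).re
        + Q.lam ^ 2 * (√(Q.omega (m + 1)) * √(Q.omega (n + 1)))
          * (starRingEnd ℂ (b m n) * b (m + 1) (n + 1)).re := by
    have e1 : starRingEnd ℂ (b m n) * Q.lindblad b m n
        = Q.drift m n * (‖b m n‖ ^ 2 : ℝ)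
          + ((Q.mu ^ 2 * (√(Q.omega m) * √(Q.omega n)) : ℝ) : ℂ)
            * (starRingEnd ℂ (b m n) * b (m - 1) (n - 1))
          + ((Q.lam ^ 2 * (√(Q.omega (m + 1)) * √(Q.omega (n + 1))) : ℝ) : ℂ)
            * (starRingEnd ℂ (b m n) * b (m + 1) (n + 1)) := by
      rw [lindblad, jump, Complex.ofReal_pow, ← Complex.conj_mul']
      ring
    rw [e1]
    simp only [Complex.add_re, Complex.re_ofReal_mul, Complex.re_mul_ofReal]
    simp only [drift, Complex.add_re, Complex.conj_re, gEig_re]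
    have e2 : (starRingEnd ℂ (b m n) * b (m - 1) (n - 1)).re
        = (starRingEnd ℂ (b (m - 1) (n - 1)) * b m n).re := by
      simp [Complex.mul_re]; ring
    rw [e2]
    ring
  have h2 := Q.mu_sq_mul_weight_succ m n
  rw [h1, density, jumpDensity, jumpDensity, h2, Nat.add_sub_cancel, Nat.add_sub_cancel]
  ring

theorem summable_shift {h : ℕ → ℕ → ℝ} (hs : Summable fun p : ℕ × ℕ => h p.1 p.2) :
    Summable fun p : ℕ × ℕ => h (p.1 + 1) (p.2 + 1) := by
  have := hs.comp_injective shift_injective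
  exact this

theorem hasSum_density (hb : ∀ m n, ‖b m n‖ ≤ C) :
    HasSum (fun p : ℕ × ℕ => Q.density b p.1 p.2) (∑' p : ℕ × ℕ,
      Q.weight p.1 p.2 * (starRingEnd ℂ (b p.1 p.2) * Q.lindblad b p.1 p.2).re) := by
  have h1 := Q.summable_energy hb
  have h2 := Q.summable_jumpDensity hb
  have h3 : Summable fun p : ℕ × ℕ => Q.jumpDensity b (p.1 + 1) (p.2 + 1) :=
    summable_shift h2
  have h4 := tsum_shift (h := Q.jumpDensity b) (fun n => by simp [jumpDensity, omega_zero])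
    (fun m => by simp [jumpDensity, omega_zero])
  have h3' := h3.hasSum
  rw [h4] at h3'
  have h5 := (h1.hasSum.sub h2.hasSum).add h3'
  rw [sub_add_cancel] at h5
  simp only [density_eq]
  exact h5

/-- The energy on the main diagonal is controlled by the Poincaré inequality. -/
theorem tsum_density_diag_le (hb : ∀ m n, ‖b m n‖ ≤ C)
    (hmean : ∑' n, (Q.weight n n : ℂ) * b n n = 0) {g : ℝ} (hg0 : 0 ≤ g)
    (hg : g * lerchPhi (Q.nu ^ 2) 1 Q.r ≤ Q.mu ^ 2) :
    ∑' n, (Q.density b n n + g * (Q.weight n n * ‖b n n‖ ^ 2)) ≤ 0 := by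
  set p := Q.nu ^ 2 with hp
  have hp0 : 0 < p := by have := Q.nu_pos; positivity
  have hp1 : p < 1 := by linarith [Q.one_sub_nu_sq_pos]
  have hq : 0 < 1 - p := Q.one_sub_nu_sq_pos
  have hw : ∀ n, Q.weight n n = (1 - p) * p ^ n := fun n => by
    rw [weight, ← two_mul, pow_mul]
  have hK := Q.summable_lam_weight_omega hb
  have he := Q.summable_mu_weight_omega hb
  have hKeq : ∀ n : ℕ, Q.lam ^ 2 * Q.weight n n * Q.omega (n + 1) * ‖b (n + 1) (n + 1) - b n n‖ ^ 2
      = ((1 - p) * Q.mu ^ 2) * (p ^ (n + 1) * ((n + 1) * (n + Q.r))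
        * ‖b (n + 1) (n + 1) - b n n‖ ^ 2) := by
    intro n
    rw [hw, omega_succ, lam_eq, mul_pow, ← hp]
    ring
  have hc : (1 - p) * Q.mu ^ 2 ≠ 0 := by have := Q.mu_pos; positivity
  have hZ : Summable fun n : ℕ => p ^ (n + 1) * ((n + 1) * (n + Q.r))
      * ‖b (n + 1) (n + 1) - b n n‖ ^ 2 := by
    simp only [hKeq] at hK
    exact (summable_mul_left_iff hc).1 hK
  have hV : Summable fun n : ℕ => Q.weight n n * ‖b n n‖ ^ 2 :=
    (Q.summable_weight_norm_sq hb).comp_injective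
      (i := fun n : ℕ => (n, n)) fun _ _ h => (Prod.mk.inj h).1
  have h0 : ∑' n, (p : ℂ) ^ n * b n n = 0 := by
    have : ∀ n, (Q.weight n n : ℂ) * b n n = ((1 - p : ℝ) : ℂ) * ((p : ℂ) ^ n * b n n) := by
      intro n
      rw [hw]
      push_cast
      ring
    simp only [this] at hmean
    rw [tsum_mul_left, mul_eq_zero] at hmean
    exact hmean.resolve_left (by exact_mod_cast hq.ne')
  have hP := poincare hp0 hp1 Q.r_pos (fun n => hb n n) h0 hZ
  set V := ∑' n, p ^ n * ‖b n n‖ ^ 2 with hVdef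
  set Z := ∑' n : ℕ, p ^ (n + 1) * ((n + 1) * (n + Q.r)) * ‖b (n + 1) (n + 1) - b n n‖ ^ 2 with hZdef
  have hZ0 : 0 ≤ Z := tsum_nonneg fun n => by have := Q.r_pos; positivity
  have hVs : ∑' n, Q.weight n n * ‖b n n‖ ^ 2 = (1 - p) * V := by
    simp only [hw, mul_assoc]
    rw [tsum_mul_left]
  have hKs : ∑' n, Q.lam ^ 2 * Q.weight n n * Q.omega (n + 1) * ‖b (n + 1) (n + 1) - b n n‖ ^ 2
      = (1 - p) * Q.mu ^ 2 * Z := by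
    simp only [hKeq]
    rw [tsum_mul_left]
  have hes : Summable fun n : ℕ => Q.mu ^ 2 * Q.weight (n + 1) (n + 1) * Q.omega (n + 1)
      * ‖b (n + 1) (n + 1)‖ ^ 2 := (summable_nat_add_iff 1).2 he
  have he0 := he.tsum_eq_zero_add
  simp only [omega_zero, mul_zero, zero_mul, zero_add] at he0
  -- The telescoping part contributes nothing, as ω₀ = 0; only the Dirichlet form and the variance
  -- term remain.
  have hsum := ((hK.hasSum.neg.add (hes.hasSum.sub he.hasSum))).add (hV.hasSum.mul_left g)
  simp only [density_diag]
  rw [hsum.tsum_eq, hVs, hKs, he0, sub_self, add_zero]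
  have h1 : g * V ≤ Q.mu ^ 2 * Z := by
    calc g * V ≤ g * (lerchPhi p 1 Q.r * Z) := mul_le_mul_of_nonneg_left hP hg0
      _ = (g * lerchPhi p 1 Q.r) * Z := by ring
      _ ≤ _ := mul_le_mul_of_nonneg_right hg hZ0
  nlinarith

/-- The spectral gap inequality on matrices with bounded entries. -/
theorem energy_le (hb : ∀ m n, ‖b m n‖ ≤ C)
    (hmean : ∑' n, (Q.weight n n : ℂ) * b n n = 0) {g : ℝ} (hg0 : 0 ≤ g) (hg1 : g ≤ Q.gapRate)
    (hg : g * lerchPhi (Q.nu ^ 2) 1 Q.r ≤ Q.mu ^ 2) :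
    ∑' p : ℕ × ℕ, Q.weight p.1 p.2 * (starRingEnd ℂ (b p.1 p.2) * Q.lindblad b p.1 p.2).re
      ≤ -(g * ∑' p : ℕ × ℕ, Q.weight p.1 p.2 * ‖b p.1 p.2‖ ^ 2) := by
  have h1 := Q.hasSum_density hb
  have h2 := Q.summable_weight_norm_sq hb
  -- The energy transported along the off-diagonals. Adding h - (h shifted), whose sum is 0, makes
  -- the off-diagonal bound pointwise.
  set h : ℕ → ℕ → ℝ := fun m n => if m = n then 0 else
      Q.mu ^ 2 * Q.weight m n * Q.transport m n * ‖b m n‖ ^ 2 with hh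
  have h3 : Summable fun p : ℕ × ℕ => h p.1 p.2 := Q.summable_transport hb
  have h4 : Summable fun p : ℕ × ℕ => h (p.1 + 1) (p.2 + 1) := summable_shift h3
  have h5 := tsum_shift (h := h) (fun n => by simp [hh, transport]) (fun m => by simp [hh, transport])
  have h4' := h4.hasSum
  rw [h5] at h4'
  have h6 := (h1.add (h2.hasSum.mul_left g)).add (h3.hasSum.sub h4')
  rw [sub_self, add_zero] at h6
  -- Off the diagonal the comparison is termwise with 0. On the diagonal it only holds after
  -- summation, so these terms are retained and summed separately.
  set d : ℕ → ℝ := fun n => Q.density b n n + g * (Q.weight n n * ‖b n n‖ ^ 2) with hd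
  have h7 : Summable fun p : ℕ × ℕ => if p.1 = p.2 then d p.1 else 0 := by
    refine Summable.of_norm_bounded ((h1.add (h2.hasSum.mul_left g)).summable.norm) ?_
    rintro ⟨m, n⟩
    by_cases hmn : m = n
    · subst hmn
      simp [hd]
    · simp only [hmn, if_false, norm_zero]
      exact norm_nonneg _
  have h8 := hasSum_le ?_ h6 h7.hasSum
  · rw [tsum_diag] at h8
    have := Q.tsum_density_diag_le hb hmean hg0 hg
    linarith
  · rintro ⟨m, n⟩
    by_cases hmn : m = n
    · subst hmn
      simp [hd, hh]
    · have e1 := Q.density_le_of_ne b hmn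
      have e2 : 0 ≤ Q.weight m n * ‖b m n‖ ^ 2 := mul_nonneg (Q.weight_pos m n).le (sq_nonneg _)
      have e3 := mul_le_mul_of_nonneg_right hg1 e2
      simp only [hh, hmn, if_false, add_left_inj]
      linarith

theorem summable_mean (hb : ∀ m n, ‖b m n‖ ≤ C) : Summable fun n => (Q.weight n n : ℂ) * b n n := by
  refine Q.summable_diag_of_le_dominator (K := C) fun n => ?_
  have hC : 0 ≤ C := (norm_nonneg _).trans (hb 0 0)
  rw [norm_mul, Complex.norm_real, Real.norm_of_nonneg (Q.weight_pos n n).le]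
  refine Q.weight_mul_le_dominator hC ((hb n n).trans (le_mul_of_one_le_right hC (one_le_pow₀ ?_)))
  have hn : (0 : ℝ) ≤ n := n.cast_nonneg
  nlinarith [mul_nonneg hn hn]

/-- The invariant state annihilates the range of the generator. -/
theorem mean_lindblad (hb : ∀ m n, ‖b m n‖ ≤ C) :
    ∑' n, (Q.weight n n : ℂ) * Q.lindblad b n n = 0 := by
  have hC : 0 ≤ C := (norm_nonneg _).trans (hb 0 0)
  have hr := Q.r_pos
  -- The current of the chain through the edge from n - 1 to n; it vanishes at n = 0, where the
  -- truncated index is harmless. The mean of the generator is the sum of its increments.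
  set j : ℕ → ℂ := fun n => ((Q.mu ^ 2 * Q.weight n n * Q.omega n : ℝ) : ℂ)
    * (b n n - b (n - 1) (n - 1)) with hj
  have hjs : Summable j := by
    refine Q.summable_diag_of_le_dominator (K := Q.mu ^ 2 * (1 + Q.r) * (C + C)) fun n => ?_
    have hw := (Q.weight_pos n n).le
    have hω := Q.omega_nonneg n
    rw [hj, norm_mul, Complex.norm_real, Real.norm_of_nonneg (by positivity),
      show ∀ a c x y : ℝ, a * c * x * y = c * (a * x * y) by intros; ring]
    refine Q.weight_mul_le_dominator (by positivity) ?_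
    have h1 := Q.sqrt_omega_mul_le (Q.omega_le n) (Q.omega_le n)
    rw [Real.mul_self_sqrt hω] at h1
    calc _ ≤ Q.mu ^ 2 * ((1 + Q.r) * (((n : ℝ) + 1) * (n + 1)) ^ 2) * (C + C) :=
          mul_le_mul (mul_le_mul_of_nonneg_left h1 (sq_nonneg _))
            ((norm_sub_le _ _).trans (add_le_add (hb _ _) (hb _ _))) (norm_nonneg _) (by positivity)
      _ = _ := by ring
  have h1 : ∀ n, (Q.weight n n : ℂ) * Q.lindblad b n n = j (n + 1) - j n := by
    intro n
    have h2 : Q.drift n n = ((-(Q.lam ^ 2 * Q.omega (n + 1) + Q.mu ^ 2 * Q.omega n) : ℝ) : ℂ) := by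
      rw [drift, add_comm, Complex.add_conj, gEig_re, killRate]
      push_cast
      ring
    have h3 := Q.mu_sq_mul_weight_succ n n
    rw [hj, lindblad, jump, h2, Real.mul_self_sqrt (Q.omega_nonneg _),
      Real.mul_self_sqrt (Q.omega_nonneg _)]
    simp only [h3, Nat.add_sub_cancel]
    push_cast
    ring
  simp only [h1]
  rw [((summable_nat_add_iff 1).2 hjs).tsum_sub hjs, hjs.tsum_eq_zero_add]
  simp [hj, omega_zero]

end Static

/-! ### Invariance of the mean and decay of solutions -/

section Dynamic

variable {Q}
variable {F : ℝ → ℕ → ℕ → ℂ} {C : ℝ}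

/-- The invariant state is invariant. -/
theorem IsSolution.mean_eq (hF : Q.IsSolution F C) {t : ℝ} (ht : 0 ≤ t) :
    ∑' n, (Q.weight n n : ℂ) * F t n n = ∑' n, (Q.weight n n : ℂ) * F 0 n n := by
  have hC : 0 ≤ C := (norm_nonneg _).trans (hF.norm_le 0 le_rfl 0 0)
  obtain ⟨K, hK0, hK⟩ := Q.exists_norm_lindblad_le
  have hdom : Summable fun n : ℕ => Q.dominator n n :=
    Q.summable_dominator.comp_injective
      (i := fun n : ℕ => (n, n)) fun _ _ h => (Prod.mk.inj h).1
  have hbd : ∀ (b : ℕ → ℕ → ℂ) (D : ℝ), 0 ≤ D → (∀ n : ℕ, ‖b n n‖ ≤ D * (((n : ℝ) + 1) * (n + 1)) ^ 2) →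
      ∀ n, ‖(Q.weight n n : ℂ) * b n n‖ ≤ D * Q.dominator n n := by
    intro b D hD h n
    rw [norm_mul, Complex.norm_real, Real.norm_of_nonneg (Q.weight_pos n n).le]
    exact Q.weight_mul_le_dominator hD (h n)
  have hone : ∀ n : ℕ, C ≤ C * (((n : ℝ) + 1) * (n + 1)) ^ 2 := fun n => by
    have hn : (0 : ℝ) ≤ n := n.cast_nonneg
    exact le_mul_of_one_le_right hC (one_le_pow₀ (by nlinarith [mul_nonneg hn hn]))
  have hcont : ContinuousOn (fun t => ∑' n, (Q.weight n n : ℂ) * F t n n) (Set.Ici 0) :=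
    continuousOn_tsum (fun n => continuousOn_const.mul (hF.continuousOn n n)) (hdom.mul_left C)
      fun n t ht => hbd (F t) C hC (fun n => (hF.norm_le t ht n n).trans (hone n)) n
  have hder : ∀ t ∈ Set.Ioi (0 : ℝ), HasDerivAt (fun t => ∑' n, (Q.weight n n : ℂ) * F t n n) 0 t := by
    intro t ht
    have h := hasDerivAt_tsum_of_isPreconnected (𝕜 := ℝ) (t := Set.Ioi (0 : ℝ)) (y₀ := t)
      (g := fun n t => (Q.weight n n : ℂ) * F t n n)
      (g' := fun n t => (Q.weight n n : ℂ) * Q.lindblad (F t) n n)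
      (hdom.mul_left (K * C)) isOpen_Ioi isPreconnected_Ioi
      (fun n s hs => (hF.hasDerivAt s hs n n).const_mul _)
      (fun n s hs => hbd (Q.lindblad (F s)) (K * C) (by positivity)
        (fun n => hK _ C (hF.norm_le s (le_of_lt hs)) n n) n) ht
      (Q.summable_mean (hF.norm_le t (le_of_lt ht))) ht
    rwa [Q.mean_lindblad (hF.norm_le t (le_of_lt ht))] at h
  rcases ht.eq_or_lt with rfl | ht
  · rfl
  -- The equation is available only at positive times: the mean is constant on the open half-line,
  -- and continuity from the right reaches time 0.
  have hconst : ∀ s ∈ Set.Ioi (0 : ℝ), ∑' n, (Q.weight n n : ℂ) * F s n n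
      = ∑' n, (Q.weight n n : ℂ) * F t n n := fun s hs =>
    isOpen_Ioi.is_const_of_deriv_eq_zero isPreconnected_Ioi
      (fun s hs => (hder s hs).differentiableAt.differentiableWithinAt)
      (fun s hs => (hder s hs).deriv) hs ht
  have hlim := ((hcont 0 Set.self_mem_Ici).mono Set.Ioi_subset_Ici_self).tendsto
  refine tendsto_nhds_unique (tendsto_const_nhds.congr' ?_) hlim
  filter_upwards [self_mem_nhdsWithin] with s hs
  exact (hconst s hs).symm

theorem hasDerivAt_tsum_prod {φ φ' : ℕ → ℕ → ℝ → ℝ} {u : ℕ × ℕ → ℝ} (hu : Summable u)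
    (hφ : ∀ m n, ∀ s, 0 < s → HasDerivAt (φ m n) (φ' m n s) s)
    (hb : ∀ m n, ∀ s, 0 < s → ‖φ' m n s‖ ≤ u (m, n)) {t : ℝ} (ht : 0 < t)
    (hs : Summable fun p : ℕ × ℕ => φ p.1 p.2 t) :
    HasDerivAt (fun t => ∑' p : ℕ × ℕ, φ p.1 p.2 t) (∑' p : ℕ × ℕ, φ' p.1 p.2 t) t :=
  hasDerivAt_tsum_of_isPreconnected (𝕜 := ℝ) (t := Set.Ioi (0 : ℝ)) (y₀ := t)
    (g := fun p : ℕ × ℕ => φ p.1 p.2) (g' := fun p => φ' p.1 p.2) hu isOpen_Ioi isPreconnected_Ioi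
    (fun p => hφ p.1 p.2) (fun p => hb p.1 p.2) ht hs ht

/-- Exponential decay of centred solutions. -/
theorem IsSolution.decay (hF : Q.IsSolution F C)
    (hmean : ∑' n, (Q.weight n n : ℂ) * F 0 n n = 0) {g : ℝ} (hg0 : 0 ≤ g) (hg1 : g ≤ Q.gapRate)
    (hg : g * lerchPhi (Q.nu ^ 2) 1 Q.r ≤ Q.mu ^ 2) {t : ℝ} (ht : 0 ≤ t) :
    ∑' p : ℕ × ℕ, Q.weight p.1 p.2 * ‖F t p.1 p.2‖ ^ 2
      ≤ Real.exp (-(2 * g) * t) * ∑' p : ℕ × ℕ, Q.weight p.1 p.2 * ‖F 0 p.1 p.2‖ ^ 2 := by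
  have hC : 0 ≤ C := (norm_nonneg _).trans (hF.norm_le 0 le_rfl 0 0)
  obtain ⟨K, hK0, hK⟩ := Q.exists_norm_lindblad_le
  set Y : ℝ → ℝ := fun t => ∑' p : ℕ × ℕ, Q.weight p.1 p.2 * ‖F t p.1 p.2‖ ^ 2 with hY
  have hbd : ∀ (D a : ℝ), 0 ≤ D → ∀ m n : ℕ, |a| ≤ D * (((m : ℝ) + 1) * (n + 1)) ^ 2 →
      ‖Q.weight m n * a‖ ≤ D * Q.dominator m n := by
    intro D a hD m n h
    rw [norm_mul, Real.norm_of_nonneg (Q.weight_pos m n).le]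
    exact Q.weight_mul_le_dominator hD h
  have hcont : ContinuousOn Y (Set.Ici 0) := by
    refine continuousOn_tsum (fun p => continuousOn_const.mul ((hF.continuousOn p.1 p.2).norm.pow 2))
      (Q.summable_dominator.mul_left (C ^ 2)) fun p t ht => hbd _ _ (sq_nonneg C) _ _ ?_
    rw [abs_of_nonneg (sq_nonneg _)]
    refine (norm_sq_le (hF.norm_le t ht) _ _).trans
      (le_mul_of_one_le_right (sq_nonneg C) (one_le_pow₀ ?_))
    have hm : (0 : ℝ) ≤ p.1 := p.1.cast_nonneg
    have hn : (0 : ℝ) ≤ p.2 := p.2.cast_nonneg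
    nlinarith [mul_nonneg hm hn]
  have hder : ∀ t ∈ Set.Ioi (0 : ℝ), HasDerivAt Y (∑' p : ℕ × ℕ, Q.weight p.1 p.2
      * (2 * (starRingEnd ℂ (F t p.1 p.2) * Q.lindblad (F t) p.1 p.2).re)) t := by
    intro t ht
    have hnl := hF.norm_le
    refine hasDerivAt_tsum_prod (φ := fun m n t => Q.weight m n * ‖F t m n‖ ^ 2)
      (φ' := fun m n t => Q.weight m n * (2 * (starRingEnd ℂ (F t m n) * Q.lindblad (F t) m n).re))
      (Q.summable_dominator.mul_left (2 * (C * (K * C)))) (fun m n s hs => ?_) (fun m n s hs => ?_)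
      ht (Q.summable_weight_norm_sq (hnl t (le_of_lt ht)))
    · have h := (hF.hasDerivAt s hs m n).norm_sq
      rw [Complex.inner, mul_comm (Q.lindblad _ _ _)] at h
      exact h.const_mul _
    · refine hbd (2 * (C * (K * C))) _ (by positivity) m n ?_
      rw [abs_mul, abs_two, mul_assoc, mul_assoc]
      refine mul_le_mul_of_nonneg_left ((Complex.abs_re_le_norm _).trans ?_) zero_le_two
      rw [norm_mul, RCLike.norm_conj]
      exact mul_le_mul (hnl s (le_of_lt hs) _ _) (hK _ C (hnl s (le_of_lt hs)) _ _)
        (norm_nonneg _) hC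
  have hexp : ∀ t, HasDerivAt (fun t => Real.exp (2 * g * t)) (Real.exp (2 * g * t) * (2 * g)) t := by
    intro t
    simpa using ((hasDerivAt_id t).const_mul (2 * g)).exp
  -- Grönwall: the derivative of Y is twice the energy, which is at most -2gY because the solution
  -- stays centred.
  have hanti : AntitoneOn (fun t => Real.exp (2 * g * t) * Y t) (Set.Ici 0) := by
    refine antitoneOn_of_deriv_nonpos (convex_Ici 0)
      (ContinuousOn.mul (Continuous.continuousOn (by fun_prop)) hcont) ?_ ?_
    · rw [interior_Ici]
      exact fun t ht => ((hexp t).mul (hder t ht)).differentiableAt.differentiableWithinAt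
    · rw [interior_Ici]
      intro t ht
      refine le_of_eq_of_le ((hexp t).mul (hder t ht)).deriv ?_
      have h1 := Q.energy_le (hF.norm_le t (le_of_lt ht))
        ((hF.mean_eq (le_of_lt ht)).trans hmean) hg0 hg1 hg
      simp only [mul_left_comm _ (2 : ℝ)]
      rw [tsum_mul_left]
      have h2 := Real.exp_pos (2 * g * t)
      have h3 : g * Y t + ∑' p : ℕ × ℕ, Q.weight p.1 p.2
          * (starRingEnd ℂ (F t p.1 p.2) * Q.lindblad (F t) p.1 p.2).re ≤ 0 := by linarith
      nlinarith
  have h := hanti Set.self_mem_Ici ht ht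
  simp only [mul_zero, Real.exp_zero, one_mul] at h
  have h1 : Real.exp (-(2 * g) * t) * Real.exp (2 * g * t) = 1 := by
    rw [← Real.exp_add]; simp
  calc Y t = Real.exp (-(2 * g) * t) * (Real.exp (2 * g * t) * Y t) := by
        rw [← mul_assoc, h1, one_mul]
    _ ≤ _ := mul_le_mul_of_nonneg_left h (Real.exp_pos _).le

end Dynamic

end QuadraticOscillator

namespace HilbertSchmidt

open QuadraticOscillator

/-! ## Hilbert-Schmidt operators as square summable matrices -/

theorem coeff_apply (x : FockSpace →L[ℂ] FockSpace) (m n : ℕ) : coeff x m n = x (ket n) m := by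
  rw [coeff, ket, lp.inner_single_left]
  simp

theorem hasSum_norm_sq (v : FockSpace) : HasSum (fun m => ‖v m‖ ^ 2) (‖v‖ ^ 2) := by
  have := lp.hasSum_norm (p := 2) (by norm_num) v
  simpa using this

theorem memlp_coeff (ξ : HilbertSchmidt) :
    Memℓp (fun p : ℕ × ℕ => coeff (toOp ξ) p.1 p.2) 2 := by
  have h2 : (2 : ENNReal).toReal = ((2 : ℕ) : ℝ) := by norm_num
  refine memℓp_gen ?_
  simp only [h2, Real.rpow_natCast]
  have h : Summable fun p : ℕ × ℕ => ‖coeff (toOp ξ) p.2 p.1‖ ^ 2 := by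
    rw [summable_prod_of_nonneg (fun p => by positivity)]
    simp only [coeff_apply]
    refine ⟨fun n => (hasSum_norm_sq _).summable, ?_⟩
    simp only [(hasSum_norm_sq _).tsum_eq]
    have : Summable fun n => ‖toOp ξ (ket n)‖ ^ (2 : ENNReal).toReal :=
      (memℓp_gen_iff (by norm_num)).1 ξ.2
    simpa [h2, Real.rpow_natCast] using this
  exact h.prod_symm

/-- The matrix of a Hilbert-Schmidt operator, as a square summable family. -/
def matrix : HilbertSchmidt →ₗ[ℂ] lp (fun _ : ℕ × ℕ => ℂ) 2 where
  toFun ξ := ⟨fun p => coeff (toOp ξ) p.1 p.2, memlp_coeff ξ⟩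
  map_add' ξ η := by
    apply Subtype.ext
    refine funext fun p => ?_
    show coeff (toOp (ξ + η)) p.1 p.2 = coeff (toOp ξ) p.1 p.2 + coeff (toOp η) p.1 p.2
    rw [map_add, coeff_add]
  map_smul' c ξ := by
    apply Subtype.ext
    refine funext fun p => ?_
    show coeff (toOp (c • ξ)) p.1 p.2 = c * coeff (toOp ξ) p.1 p.2
    rw [map_smul, coeff_smul]

theorem matrix_apply (ξ : HilbertSchmidt) (p : ℕ × ℕ) :
    matrix ξ p = coeff (toOp ξ) p.1 p.2 := rfl

/-- The double series is swapped because the trace is summed column by column, whereas the index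
pair is (row, column). -/
theorem inner_matrix (ξ η : HilbertSchmidt) :
    inner ℂ (matrix ξ) (matrix η) = inner ℂ ξ η := by
  have hs := lp.summable_inner (𝕜 := ℂ) (matrix ξ) (matrix η)
  rw [lp.inner_eq_tsum, inner_eq, ← (Equiv.prodComm ℕ ℕ).tsum_eq]
  have hs' := (Equiv.prodComm ℕ ℕ).summable_iff.2 hs
  rw [Summable.tsum_prod (f := fun c => inner ℂ (matrix ξ ((Equiv.prodComm ℕ ℕ) c))
    (matrix η ((Equiv.prodComm ℕ ℕ) c))) hs']
  refine tsum_congr fun n => ?_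
  rw [lp.inner_eq_tsum]
  refine tsum_congr fun m => ?_
  simp only [matrix_apply, Equiv.prodComm_apply, Prod.swap_prod_mk, coeff_apply]

/-- Cauchy-Schwarz on the finite product of the supports: the Hilbert-Schmidt norm dominates the
operator norm. -/
theorem norm_sform_le (c : lp (fun _ : ℕ × ℕ => ℂ) 2) (v u : Core) :
    ‖sform (fun m n => c (m, n)) v u‖ ≤ ‖c‖ * ‖incl v‖ * ‖incl u‖ := by
  have h1 : ‖sform (fun m n => c (m, n)) v u‖
      ≤ ∑ p ∈ v.support ×ˢ u.support, ‖c p‖ * (‖v p.1‖ * ‖u p.2‖) := by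
    rw [Finset.sum_product]
    refine norm_sum_le_of_le _ fun m _ => norm_sum_le_of_le _ fun n _ => le_of_eq ?_
    rw [norm_mul, norm_mul, RCLike.norm_conj]
    ring
  have h2 := Finset.sum_mul_sq_le_sq_mul_sq (v.support ×ˢ u.support) (fun p => ‖c p‖)
    (fun p => ‖v p.1‖ * ‖u p.2‖)
  have h3 : ∑ p ∈ v.support ×ˢ u.support, (‖v p.1‖ * ‖u p.2‖) ^ 2 = ‖incl v‖ ^ 2 * ‖incl u‖ ^ 2 := by
    rw [norm_incl_sq, norm_incl_sq, qform, qform, Finsupp.sum, Finsupp.sum, Finset.sum_mul_sum,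
      Finset.sum_product]
    simp only [mul_one, mul_pow]
  have h4 : ∑ p ∈ v.support ×ˢ u.support, ‖c p‖ ^ 2 ≤ ‖c‖ ^ 2 := by
    have := lp.sum_rpow_le_norm_rpow (p := 2) (by norm_num) c (v.support ×ˢ u.support)
    simpa using this
  rw [h3] at h2
  refine h1.trans (abs_le_of_sq_le_sq' ?_ (by positivity)).2
  calc _ ≤ _ := h2
    _ ≤ ‖c‖ ^ 2 * (‖incl v‖ ^ 2 * ‖incl u‖ ^ 2) := by gcongr
    _ = _ := by ring

/-- A square summable matrix has a bounded form, hence is the matrix of a bounded operator, whose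
columns are square summable by Tonelli. -/
theorem matrix_surjective : Function.Surjective matrix := by
  intro c
  obtain ⟨y, hy⟩ := exists_operator (norm_nonneg c) (norm_sform_le c)
  have h2 : (2 : ENNReal).toReal = ((2 : ℕ) : ℝ) := by norm_num
  have hmem : y ∈ hsSubmodule := by
    show Memℓp (fun n => y (ket n)) 2
    refine memℓp_gen ?_
    simp only [h2, Real.rpow_natCast]
    have h3 : Summable fun p : ℕ × ℕ => ‖c p‖ ^ 2 := by
      have := (lp.hasSum_norm (p := 2) (by norm_num) c).summable
      simpa using this
    have h4 := (summable_prod_of_nonneg (fun p => by positivity)).1 h3.prod_symm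
    refine h4.2.congr fun n => ?_
    rw [← (hasSum_norm_sq (y (ket n))).tsum_eq]
    refine tsum_congr fun m => ?_
    rw [← coeff_apply, hy]
    rfl
  refine ⟨⟨y, hmem⟩, ?_⟩
  apply Subtype.ext
  exact funext fun p => hy p.1 p.2

/-- The isometry between Hilbert-Schmidt operators and square summable matrices. -/
def matrixEquiv : HilbertSchmidt ≃ₗᵢ[ℂ] lp (fun _ : ℕ × ℕ => ℂ) 2 :=
  LinearIsometryEquiv.ofSurjective (matrix.isometryOfInner inner_matrix) matrix_surjective

theorem matrixEquiv_apply (ξ : HilbertSchmidt) (p : ℕ × ℕ) :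
    matrixEquiv ξ p = coeff (toOp ξ) p.1 p.2 := rfl

instance : CompleteSpace HilbertSchmidt :=
  (completeSpace_congr (e := matrixEquiv.toEquiv) matrixEquiv.isometry.isUniformEmbedding).2
    inferInstance

theorem hasSum_inner (ξ η : HilbertSchmidt) :
    HasSum (fun p : ℕ × ℕ =>
      starRingEnd ℂ (coeff (toOp ξ) p.1 p.2) * coeff (toOp η) p.1 p.2) (inner ℂ ξ η) := by
  have h := lp.hasSum_inner (𝕜 := ℂ) (matrixEquiv ξ) (matrixEquiv η)
  rw [LinearIsometryEquiv.inner_map_map] at h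
  simpa [matrixEquiv_apply, RCLike.inner_apply, mul_comm] using h

theorem hasSum_norm (ξ : HilbertSchmidt) :
    HasSum (fun p : ℕ × ℕ => ‖coeff (toOp ξ) p.1 p.2‖ ^ 2) (‖ξ‖ ^ 2) := by
  have h := lp.hasSum_norm (p := 2) (by norm_num) (matrixEquiv ξ)
  rw [LinearIsometryEquiv.norm_map] at h
  simpa [matrixEquiv_apply] using h

theorem ext_matrix {ξ η : HilbertSchmidt}
    (h : ∀ m n, coeff (toOp ξ) m n = coeff (toOp η) m n) : ξ = η :=
  matrixEquiv.injective (Subtype.ext (funext fun p => h p.1 p.2))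

/-- A square summable matrix is the matrix of a Hilbert-Schmidt operator. -/
theorem exists_of_summable {c : ℕ → ℕ → ℂ} (hc : Summable fun p : ℕ × ℕ => ‖c p.1 p.2‖ ^ 2) :
    ∃ ξ : HilbertSchmidt, ∀ m n, coeff (toOp ξ) m n = c m n := by
  have h2 : (2 : ENNReal).toReal = ((2 : ℕ) : ℝ) := by norm_num
  have hmem : Memℓp (fun p : ℕ × ℕ => c p.1 p.2) 2 := memℓp_gen (by simpa [h2] using hc)
  obtain ⟨ξ, hξ⟩ := matrix_surjective ⟨_, hmem⟩
  exact ⟨ξ, fun m n => congrFun (congrArg Subtype.val hξ) (m, n)⟩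

end HilbertSchmidt

namespace QuadraticOscillator

open HilbertSchmidt

variable (Q : QuadraticOscillator)

/-! ### The embedding of the bounded operators -/

theorem inner_ket_rhoPow {a : ℝ} (ha : 0 < a) (m : ℕ) (w : FockSpace) :
    inner ℂ (ket m) (Q.rhoPow a w) = ((Q.rhoEig m ^ a : ℝ) : ℂ) * inner ℂ (ket m) w := by
  have h1 := (Q.summable_rhoPow ha).hasSum.mapL (ContinuousLinearMap.apply ℂ FockSpace w)
  have h2 := h1.mapL (innerSL ℂ (ket m))
  refine h2.unique ?_
  convert hasSum_single m ?_ using 1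
  · simp [norm_ket]
  · intro n hn
    simp [inner_ket, hn.symm]

theorem rhoEig_rpow_mul (m n : ℕ) :
    Q.rhoEig m ^ (1 / 4 : ℝ) * Q.rhoEig n ^ (1 / 4 : ℝ) = √(Q.weight m n) := by
  have h : Q.rhoEig m * Q.rhoEig n = Q.weight m n ^ 2 := by
    unfold rhoEig weight
    ring
  rw [← Real.mul_rpow (Q.rhoEig_pos m).le (Q.rhoEig_pos n).le, h, ← Real.rpow_natCast,
    ← Real.rpow_mul (Q.weight_pos m n).le, Real.sqrt_eq_rpow]
  norm_num

theorem coeff_embedding (x : FockSpace →L[ℂ] FockSpace) (m n : ℕ) :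
    coeff (toOp (Q.embedding x)) m n = (√(Q.weight m n) : ℂ) * coeff x m n := by
  have h4 : (0 : ℝ) < 1 / 4 := by norm_num
  have h : toOp (Q.embedding x) = Q.rhoPow (1 / 4) ∘L x ∘L Q.rhoPow (1 / 4) := rfl
  rw [h, coeff, ContinuousLinearMap.comp_apply, ContinuousLinearMap.comp_apply,
    inner_ket_rhoPow _ h4, rhoPow_ket _ h4, map_smul, inner_smul_right, ← rhoEig_rpow_mul, coeff]
  push_cast
  ring

theorem norm_sq_embedding (x : FockSpace →L[ℂ] FockSpace) :
    ‖Q.embedding x‖ ^ 2 = ∑' p : ℕ × ℕ, Q.weight p.1 p.2 * ‖coeff x p.1 p.2‖ ^ 2 := by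
  rw [← (hasSum_norm _).tsum_eq]
  refine tsum_congr fun p => ?_
  rw [coeff_embedding, norm_mul, mul_pow, Complex.norm_real, Real.norm_eq_abs, sq_abs,
    Real.sq_sqrt (Q.weight_pos _ _).le]

/-- Since ι(1) = ρ^{1/2}, this pairing is the expectation tr(ρx). Orthogonality to ι(1) is thus the
centring condition of the Poincaré inequality. -/
theorem inner_embedding_one (x : FockSpace →L[ℂ] FockSpace) :
    inner ℂ (Q.embedding 1) (Q.embedding x) = ∑' n, (Q.weight n n : ℂ) * coeff x n n := by
  rw [← (hasSum_inner _ _).tsum_eq, ← tsum_diag]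
  refine tsum_congr fun p => ?_
  rw [coeff_embedding, coeff_embedding, coeff_one]
  split_ifs with h
  · rw [mul_one, Complex.conj_ofReal, ← mul_assoc, ← Complex.ofReal_mul,
      Real.mul_self_sqrt (Q.weight_pos _ _).le, h]
  · simp

theorem embedding_add (x y : FockSpace →L[ℂ] FockSpace) :
    Q.embedding (x + y) = Q.embedding x + Q.embedding y :=
  ext_matrix fun m n => by
    rw [map_add, coeff_add]
    simp only [coeff_embedding, coeff_add, mul_add]

theorem embedding_smul (c : ℂ) (x : FockSpace →L[ℂ] FockSpace) :
    Q.embedding (c • x) = c • Q.embedding x :=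
  ext_matrix fun m n => by
    rw [map_smul, coeff_smul]
    simp only [coeff_embedding, coeff_smul]
    ring

/-- The embedding of the bounded operators, as a linear map. -/
def embeddingₗ : (FockSpace →L[ℂ] FockSpace) →ₗ[ℂ] HilbertSchmidt where
  toFun := Q.embedding
  map_add' := Q.embedding_add
  map_smul' := Q.embedding_smul

theorem coeff_rankOne (i j m n : ℕ) :
    coeff (rankOne ℂ (ket i) (ket j)) m n = if m = i ∧ n = j then 1 else 0 := by
  rw [coeff, rankOne_apply, inner_smul_right, inner_ket, inner_ket]
  by_cases h1 : m = i <;> by_cases h2 : j = n <;> simp [h1, h2, eq_comm]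

/-- The images of the matrix units are positive multiples of matrix units, so a vector orthogonal to
all of them has zero matrix. -/
theorem denseRange_embedding : DenseRange Q.embeddingₗ := by
  have h : (LinearMap.range Q.embeddingₗ).topologicalClosure = ⊤ := by
    rw [Submodule.topologicalClosure_eq_top_iff, Submodule.eq_bot_iff]
    intro ξ hξ
    refine ext_matrix fun i j => ?_
    have h1 := hξ (Q.embeddingₗ (rankOne ℂ (ket i) (ket j))) (LinearMap.mem_range_self _ _)
    have h2 := (hasSum_inner (Q.embeddingₗ (rankOne ℂ (ket i) (ket j))) ξ).unique
      (hasSum_single (i, j) fun p hp => ?_)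
    · rw [h1] at h2
      have h3 : coeff (toOp (Q.embeddingₗ (rankOne ℂ (ket i) (ket j)))) i j
          = (√(Q.weight i j) : ℂ) * 1 := by
        rw [← show coeff (rankOne ℂ (ket i) (ket j)) i j = 1 by simp [coeff_rankOne]]
        exact Q.coeff_embedding _ _ _
      simp only [h3, mul_one, Complex.conj_ofReal] at h2
      have h4 : ((√(Q.weight i j) : ℝ) : ℂ) ≠ 0 := by
        exact_mod_cast (Real.sqrt_pos.2 (Q.weight_pos i j)).ne'
      rw [(mul_eq_zero.1 h2.symm).resolve_left h4, map_zero]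
      simp [coeff]
    · have h3 : coeff (toOp (Q.embeddingₗ (rankOne ℂ (ket i) (ket j)))) p.1 p.2 = 0 := by
        refine (Q.coeff_embedding _ _ _).trans ?_
        rw [coeff_rankOne, if_neg, mul_zero]
        rintro ⟨h5, h6⟩
        exact hp (Prod.ext h5 h6)
      rw [h3, map_zero, zero_mul]
  have h2 := congrArg (fun K : Submodule ℂ HilbertSchmidt => (K : Set HilbertSchmidt)) h
  rw [DenseRange, dense_iff_closure_eq]
  exact (by simpa using h2 : closure (LinearMap.range Q.embeddingₗ : Set HilbertSchmidt) = Set.univ)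

end QuadraticOscillator

namespace QuadraticOscillator

open HilbertSchmidt

variable (Q : QuadraticOscillator)

/-! ## The semigroup on Hilbert-Schmidt operators -/

theorem coeff_sub (x y : FockSpace →L[ℂ] FockSpace) (m n : ℕ) :
    coeff (x - y) m n = coeff x m n - coeff y m n := by
  simp [coeff]

theorem lindblad_sub (b b' : ℕ → ℕ → ℂ) (m n : ℕ) :
    Q.lindblad (fun m n => b m n - b' m n) m n = Q.lindblad b m n - Q.lindblad b' m n := by
  simp only [lindblad, jump]
  ring

theorem lindblad_one (m n : ℕ) : Q.lindblad (coeff 1) m n = 0 := by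
  simp only [lindblad, jump, coeff_one]
  by_cases h : m = n
  · subst h
    have h2 : Q.drift m m = ((-(Q.lam ^ 2 * Q.omega (m + 1) + Q.mu ^ 2 * Q.omega m) : ℝ) : ℂ) := by
      rw [drift, add_comm, Complex.add_conj, gEig_re, killRate]
      push_cast
      ring
    rw [h2, Real.mul_self_sqrt (Q.omega_nonneg _), Real.mul_self_sqrt (Q.omega_nonneg _)]
    simp
    ring
  · have h1 : ((Q.mu ^ 2 * (√(Q.omega m) * √(Q.omega n)) : ℝ) : ℂ)
        * (if m - 1 = n - 1 then 1 else 0) = 0 := by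
      split_ifs with h3
      · have h4 : m = 0 ∨ n = 0 := by omega
        rcases h4 with h4 | h4 <;> simp [h4, omega_zero]
      · simp
    rw [h1]
    simp [h]

/-- The minimal quantum dynamical semigroup is conservative. -/
theorem qms_one {t : ℝ} (ht : 0 ≤ t) : Q.qms t 1 = 1 := by
  have h1 := Q.isSolution_coeff_qms 1
  have hF : Q.IsSolution (fun t m n => coeff (Q.qms t 1) m n - coeff 1 m n)
      (‖(1 : FockSpace →L[ℂ] FockSpace)‖ + ‖(1 : FockSpace →L[ℂ] FockSpace)‖) := by
    refine ⟨fun t ht m n => (norm_sub_le _ _).trans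
      (add_le_add (h1.norm_le t ht m n) (norm_coeff_le _ _ _)),
      fun m n => (h1.continuousOn m n).sub continuousOn_const, fun t ht m n => ?_⟩
    rw [lindblad_sub, lindblad_one, sub_zero]
    exact (h1.hasDerivAt t ht m n).sub_const _
  have h0 : ∀ m n, coeff (Q.qms 0 1) m n - coeff 1 m n = 0 := fun m n => by
    rw [coeff_qms_zero, sub_self]
  -- Decay at rate 0 serves as a uniqueness theorem: the difference of the two bounded solutions
  -- starts at 0 and stays there. The condition on the Lerch function is void for g = 0.
  have h2 := hF.decay (g := 0) (by simp [h0]) le_rfl Q.gapRate_pos.le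
    (by rw [zero_mul]; positivity) ht
  simp only [h0, norm_zero, ne_eq, OfNat.ofNat_ne_zero, not_false_eq_true, zero_pow, mul_zero,
    tsum_zero] at h2
  have hs := Q.summable_weight_norm_sq (hF.norm_le t ht)
  have hnn : ∀ p : ℕ × ℕ, 0 ≤ Q.weight p.1 p.2
      * ‖coeff (Q.qms t 1) p.1 p.2 - coeff 1 p.1 p.2‖ ^ 2 := fun p =>
    mul_nonneg (Q.weight_pos _ _).le (sq_nonneg _)
  refine ext_coeff fun m n => ?_
  have h3 := (hs.le_tsum (m, n) fun p _ => hnn p).trans h2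
  have h4 := le_antisymm h3 (hnn (m, n))
  simpa [(Q.weight_pos m n).ne', sub_eq_zero] using h4

theorem inner_embedding_one_one : inner ℂ (Q.embedding 1) (Q.embedding 1) = (1 : ℂ) := by
  rw [inner_embedding_one]
  have hp0 : 0 ≤ Q.nu ^ 2 := sq_nonneg _
  have hp1 : Q.nu ^ 2 < 1 := by linarith [Q.one_sub_nu_sq_pos]
  have h : ∀ n, (Q.weight n n : ℂ) * coeff 1 n n = (((1 - Q.nu ^ 2) * (Q.nu ^ 2) ^ n : ℝ) : ℂ) := by
    intro n
    rw [coeff_one, if_pos rfl, mul_one, weight, ← two_mul, pow_mul]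
  simp only [h]
  rw [← Complex.ofReal_tsum, tsum_mul_left, tsum_geometric_of_lt_one hp0 hp1,
    mul_inv_cancel₀ Q.one_sub_nu_sq_pos.ne', Complex.ofReal_one]

theorem norm_embedding_one : ‖Q.embedding 1‖ = 1 := by
  have h := Q.inner_embedding_one_one
  rw [inner_self_eq_norm_sq_to_K] at h
  have h2 : ‖Q.embedding 1‖ ^ 2 = 1 :=
    Complex.ofReal_injective (by rw [Complex.ofReal_one, ← h]; push_cast; rfl)
  exact (pow_eq_one_iff_of_nonneg (norm_nonneg _) two_ne_zero).1 h2

theorem norm_embedding_qms_le {x : FockSpace →L[ℂ] FockSpace}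
    (hx : inner ℂ (Q.embedding 1) (Q.embedding x) = 0) {g : ℝ} (hg0 : 0 ≤ g) (hg1 : g ≤ Q.gapRate)
    (hg : g * lerchPhi (Q.nu ^ 2) 1 Q.r ≤ Q.mu ^ 2) {t : ℝ} (ht : 0 ≤ t) :
    ‖Q.embedding (Q.qms t x)‖ ≤ Real.exp (-g * t) * ‖Q.embedding x‖ := by
  rw [inner_embedding_one, ← coeff_qms_zero Q x] at hx
  have h := (Q.isSolution_coeff_qms x).decay hx hg0 hg1 hg ht
  rw [coeff_qms_zero, ← norm_sq_embedding, ← norm_sq_embedding] at h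
  refine (abs_le_of_sq_le_sq' ?_ (by positivity)).2
  rw [mul_pow, ← Real.exp_nat_mul]
  refine h.trans (le_of_eq ?_)
  congr 2
  push_cast
  ring

/-- The component of a bounded operator that is centred in the invariant state. -/
theorem embedding_centre (x : FockSpace →L[ℂ] FockSpace) :
    Q.embedding (x - (inner ℂ (Q.embedding 1) (Q.embedding x) : ℂ) • 1)
      = Q.embedding x - (inner ℂ (Q.embedding 1) (Q.embedding x) : ℂ) • Q.embedding 1 := by
  rw [sub_eq_add_neg, ← neg_smul, embedding_add, embedding_smul, neg_smul, ← sub_eq_add_neg]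

theorem inner_centre (ξ : HilbertSchmidt) :
    inner ℂ (Q.embedding 1) (ξ - (inner ℂ (Q.embedding 1) ξ : ℂ) • Q.embedding 1) = 0 := by
  rw [inner_sub_right, inner_smul_right, inner_embedding_one_one, mul_one, sub_self]

/-- The map `x ↦ ι (𝒯ₜ x)`. -/
def evolEmbedding {t : ℝ} (ht : 0 ≤ t) : (FockSpace →L[ℂ] FockSpace) →ₗ[ℂ] HilbertSchmidt where
  toFun x := Q.embedding (Q.qms t x)
  map_add' x y := by rw [Q.qms_add ht, embedding_add]
  map_smul' c x := by rw [Q.qms_smul ht, embedding_smul]; rfl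

/-- Split x into its mean and its centred part. The mean is fixed, the centred part does not grow,
and the triangle inequality gives (1 + 1) + 1 = 3. The value is irrelevant; only boundedness is
needed, so that the semigroup extends from the dense range of ι. -/
theorem norm_evolEmbedding_le {t : ℝ} (ht : 0 ≤ t) (x : FockSpace →L[ℂ] FockSpace) :
    ‖Q.evolEmbedding ht x‖ ≤ 3 * ‖Q.embeddingₗ x‖ := by
  set m : ℂ := inner ℂ (Q.embedding 1) (Q.embedding x) with hm
  have hmn : ‖m‖ ≤ ‖Q.embedding x‖ := by
    have := norm_inner_le_norm (𝕜 := ℂ) (Q.embedding 1) (Q.embedding x)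
    rwa [norm_embedding_one, one_mul] at this
  have hx0 := Q.embedding_centre x
  rw [← hm] at hx0
  have h1 := Q.norm_embedding_qms_le (x := x - m • 1) (g := 0)
    (by rw [hx0]; exact Q.inner_centre _) le_rfl Q.gapRate_pos.le (by rw [zero_mul]; positivity) ht
  rw [neg_zero, zero_mul, Real.exp_zero, one_mul, hx0] at h1
  have h2 : Q.evolEmbedding ht x = Q.embedding (Q.qms t (x - m • 1)) + m • Q.embedding 1 := by
    have e1 : Q.evolEmbedding ht x = Q.evolEmbedding ht (x - m • 1) + m • Q.evolEmbedding ht 1 := by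
      rw [← map_smul, ← map_add, sub_add_cancel]
    have e2 : Q.evolEmbedding ht 1 = Q.embedding 1 := by
      show Q.embedding (Q.qms t 1) = _
      rw [Q.qms_one ht]
    rw [e1, e2]
    rfl
  have h3 : ‖Q.embedding x - m • Q.embedding 1‖ ≤ ‖Q.embedding x‖ + ‖m‖ := by
    refine (norm_sub_le _ _).trans ?_
    rw [norm_smul, norm_embedding_one, mul_one]
  rw [h2]
  refine (norm_add_le _ _).trans ?_
  rw [norm_smul, norm_embedding_one, mul_one]
  have h4 : Q.embeddingₗ x = Q.embedding x := rfl
  rw [h4]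
  linarith

theorem hsSemigroup_embedding {t : ℝ} (ht : 0 ≤ t) (x : FockSpace →L[ℂ] FockSpace) :
    Q.hsSemigroup t (Q.embedding x) = Q.embedding (Q.qms t x) := by
  have h : ∃ S : HilbertSchmidt →L[ℂ] HilbertSchmidt,
      ∀ x, S (Q.embedding x) = Q.embedding (Q.qms t x) :=
    ⟨(Q.evolEmbedding ht).extendOfNorm Q.embeddingₗ, fun x =>
      (Q.evolEmbedding ht).extendOfNorm_eq Q.denseRange_embedding
        ⟨3, Q.norm_evolEmbedding_le ht⟩ x⟩
  exact Classical.epsilon_spec h x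

/-- Exponential decay of the semigroup on the orthogonal complement of `ι(1)`. -/
theorem norm_hsSemigroup_le {ξ : HilbertSchmidt} (hξ : inner ℂ (Q.embedding 1) ξ = 0) {g : ℝ}
    (hg0 : 0 ≤ g) (hg1 : g ≤ Q.gapRate) (hg : g * lerchPhi (Q.nu ^ 2) 1 Q.r ≤ Q.mu ^ 2)
    {t : ℝ} (ht : 0 ≤ t) : ‖Q.hsSemigroup t ξ‖ ≤ Real.exp (-g * t) * ‖ξ‖ := by
  -- The bound is stated for the centred part of an arbitrary vector, so that density of the range
  -- of ι can be used without leaving the complement of ι(1).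
  have key : ∀ ξ : HilbertSchmidt,
      ‖Q.hsSemigroup t (ξ - (inner ℂ (Q.embedding 1) ξ : ℂ) • Q.embedding 1)‖
        ≤ Real.exp (-g * t) * ‖ξ - (inner ℂ (Q.embedding 1) ξ : ℂ) • Q.embedding 1‖ := by
    intro ξ
    refine Q.denseRange_embedding.induction_on (p := fun ξ =>
      ‖Q.hsSemigroup t (ξ - (inner ℂ (Q.embedding 1) ξ : ℂ) • Q.embedding 1)‖
        ≤ Real.exp (-g * t) * ‖ξ - (inner ℂ (Q.embedding 1) ξ : ℂ) • Q.embedding 1‖) ξ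
      (isClosed_le (by fun_prop) (by fun_prop)) fun x => ?_
    have e : Q.embeddingₗ x = Q.embedding x := rfl
    have h0 := Q.embedding_centre x
    rw [e, ← h0, Q.hsSemigroup_embedding ht]
    refine Q.norm_embedding_qms_le ?_ hg0 hg1 hg ht
    rw [h0]
    exact Q.inner_centre _
  have := key ξ
  rwa [hξ, zero_smul, sub_zero] at this

/-! ## The generator -/

section RightDerivative

variable {Q}
variable {F : ℝ → ℕ → ℕ → ℂ} {C : ℝ}

/-- The equation expresses the derivative by finitely many entries, which are continuous at 0; a
function whose derivative has a limit at an endpoint is differentiable there. -/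
theorem IsSolution.hasDerivWithinAt_zero (hF : Q.IsSolution F C) (m n : ℕ) :
    HasDerivWithinAt (fun t => F t m n) (Q.lindblad (F 0) m n) (Set.Ici 0) 0 := by
  have hc : ∀ m n, Tendsto (fun t => F t m n) (𝓝[>] 0) (𝓝 (F 0 m n)) := fun m n =>
    ((hF.continuousOn m n 0 Set.self_mem_Ici).mono Set.Ioi_subset_Ici_self).tendsto
  refine hasDerivWithinAt_Ici_of_tendsto_deriv (s := Set.Ioi 0)
    (fun t ht => (hF.hasDerivAt t ht m n).differentiableAt.differentiableWithinAt)
    ((hF.continuousOn m n 0 Set.self_mem_Ici).mono Set.Ioi_subset_Ici_self)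
    self_mem_nhdsWithin ?_
  have h : Tendsto (fun t => Q.lindblad (F t) m n) (𝓝[>] 0) (𝓝 (Q.lindblad (F 0) m n)) :=
    ((hc m n).const_mul _).add (Q.tendsto_jump hc m n)
  refine h.congr' ?_
  filter_upwards [self_mem_nhdsWithin] with t ht
  exact (hF.hasDerivAt t ht m n).deriv.symm

theorem IsSolution.tendsto_slope (hF : Q.IsSolution F C) (m n : ℕ) :
    Tendsto (fun t : ℝ => (t : ℂ)⁻¹ * (F t m n - F 0 m n)) (𝓝[>] 0)
      (𝓝 (Q.lindblad (F 0) m n)) := by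
  have h := (hF.hasDerivWithinAt_zero m n).Ioi_of_Ici
  rw [hasDerivWithinAt_iff_tendsto_slope' (by simp)] at h
  refine h.congr fun t => ?_
  rw [slope_def_module, sub_zero, Complex.real_smul, Complex.ofReal_inv]

/-- Mean value inequality. It makes the difference quotients dominated uniformly in t. -/
theorem IsSolution.norm_slope_le (hF : Q.IsSolution F C) {m n : ℕ} {D : ℝ}
    (hD : ∀ t, 0 ≤ t → ‖Q.lindblad (F t) m n‖ ≤ D) {t : ℝ} (ht : 0 < t) :
    ‖(t : ℂ)⁻¹ * (F t m n - F 0 m n)‖ ≤ D := by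
  have h := norm_image_sub_le_of_norm_deriv_right_le_segment (f := fun t => F t m n)
    (f' := fun t => Q.lindblad (F t) m n) (a := 0) (b := t)
    ((hF.continuousOn m n).mono Set.Icc_subset_Ici_self) (fun s hs => ?_)
    (fun s hs => hD s hs.1) t ⟨ht.le, le_rfl⟩
  · rw [norm_mul, norm_inv, Complex.norm_real, Real.norm_of_nonneg ht.le, inv_mul_le_iff₀ ht]
    rw [sub_zero] at h
    linarith
  · rcases hs.1.eq_or_lt with h0 | h0
    · subst h0
      exact hF.hasDerivWithinAt_zero m n
    · exact (hF.hasDerivAt s h0 m n).hasDerivWithinAt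

end RightDerivative

/-- The square of a quadratic coefficient is what calls for the fourth power in `dominator`. -/
theorem weight_mul_sq_le_dominator {m n : ℕ} {a A : ℝ} (ha0 : 0 ≤ a)
    (ha : a ≤ A * (((m : ℝ) + 1) * (n + 1)) ^ 2) :
    Q.weight m n * a ^ 2 ≤ A ^ 2 * Q.dominator m n := by
  have h1 := Q.weight_le m n
  have h2 := (Q.weight_pos m n).le
  have h3 := h2.trans h1
  calc _ ≤ Q.nu ^ (m + n) * (A * (((m : ℝ) + 1) * (n + 1)) ^ 2) ^ 2 := by gcongr
    _ = _ := by unfold dominator; ring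

theorem norm_sqrt_weight_mul_sq (m n : ℕ) (z : ℂ) :
    ‖(√(Q.weight m n) : ℂ) * z‖ ^ 2 = Q.weight m n * ‖z‖ ^ 2 := by
  rw [norm_mul, mul_pow, Complex.norm_real, Real.norm_eq_abs, sq_abs,
    Real.sq_sqrt (Q.weight_pos _ _).le]

/-- All the operators `ι(x)` are in the domain of the generator, which acts on them as the Lindblad
generator acts on matrices. -/
theorem exists_tendsto_embedding (x : FockSpace →L[ℂ] FockSpace) : ∃ η : HilbertSchmidt,
    (∀ m n, coeff (toOp η) m n = (√(Q.weight m n) : ℂ) * Q.lindblad (coeff x) m n) ∧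
    Tendsto (fun t : ℝ => (t : ℂ)⁻¹ • (Q.hsSemigroup t (Q.embedding x) - Q.embedding x)) (𝓝[>] 0)
      (𝓝 η) := by
  obtain ⟨K, hK0, hK⟩ := Q.exists_norm_lindblad_le
  have hF := Q.isSolution_coeff_qms x
  have hx0 := Q.coeff_qms_zero x
  have hl : ∀ t, 0 ≤ t → ∀ m n : ℕ, ‖Q.lindblad (coeff (Q.qms t x)) m n‖
      ≤ K * ‖x‖ * (((m : ℝ) + 1) * (n + 1)) ^ 2 := fun t ht => hK _ _ (hF.norm_le t ht)
  have hl0 : ∀ m n : ℕ, ‖Q.lindblad (coeff x) m n‖ ≤ K * ‖x‖ * (((m : ℝ) + 1) * (n + 1)) ^ 2 := by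
    rw [← hx0]
    exact hl 0 le_rfl
  obtain ⟨η, hη⟩ := exists_of_summable
    (c := fun m n => (√(Q.weight m n) : ℂ) * Q.lindblad (coeff x) m n) (by
      refine Q.summable_of_le_dominator (h := fun m n =>
        ‖(√(Q.weight m n) : ℂ) * Q.lindblad (coeff x) m n‖ ^ 2) (K := (K * ‖x‖) ^ 2) fun m n => ?_
      rw [Real.norm_of_nonneg (by positivity), norm_sqrt_weight_mul_sq]
      exact Q.weight_mul_sq_le_dominator (norm_nonneg _) (hl0 m n))
  refine ⟨η, hη, ?_⟩
  rw [tendsto_iff_norm_sub_tendsto_zero]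
  have hsq : Tendsto (fun t : ℝ =>
      ‖(t : ℂ)⁻¹ • (Q.hsSemigroup t (Q.embedding x) - Q.embedding x) - η‖ ^ 2) (𝓝[>] 0) (𝓝 0) := by
    -- Dominated convergence for the squared Hilbert-Schmidt norm, entry by entry: the slope and its
    -- limit obey the same bound, hence the factor 2.
    have h1 : Tendsto (fun t : ℝ => ∑' p : ℕ × ℕ, Q.weight p.1 p.2
        * ‖(t : ℂ)⁻¹ * (coeff (Q.qms t x) p.1 p.2 - coeff x p.1 p.2)
          - Q.lindblad (coeff x) p.1 p.2‖ ^ 2) (𝓝[>] 0) (𝓝 (∑' _ : ℕ × ℕ, 0)) := by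
      refine tendsto_tsum_of_dominated_convergence
        (Q.summable_dominator.mul_left ((2 * (K * ‖x‖)) ^ 2)) (fun p => ?_) ?_
      · have h2 := hF.tendsto_slope p.1 p.2
        rw [hx0] at h2
        have h3 := ((h2.sub_const (Q.lindblad (coeff x) p.1 p.2)).norm.pow 2).const_mul
          (Q.weight p.1 p.2)
        simpa using h3
      · filter_upwards [self_mem_nhdsWithin] with t ht p
        rw [Real.norm_of_nonneg (mul_nonneg (Q.weight_pos _ _).le (sq_nonneg _))]
        refine Q.weight_mul_sq_le_dominator (norm_nonneg _) ((norm_sub_le _ _).trans ?_)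
        have h2 := hF.norm_slope_le (fun s hs => hl s hs p.1 p.2) ht
        rw [hx0] at h2
        have h3 := hl0 p.1 p.2
        linarith
    rw [tsum_zero] at h1
    refine h1.congr' ?_
    filter_upwards [self_mem_nhdsWithin] with t ht
    rw [Q.hsSemigroup_embedding (le_of_lt ht), ← (hasSum_norm _).tsum_eq]
    refine tsum_congr fun p => ?_
    rw [← norm_sqrt_weight_mul_sq]
    congr 2
    rw [map_sub, map_smul, map_sub, coeff_sub, coeff_smul, coeff_sub, hη, coeff_embedding,
      coeff_embedding]
    ring
  have h := hsq.sqrt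
  simpa using h

theorem mem_domain_of_tendsto {ξ η : HilbertSchmidt}
    (h : Tendsto (fun t : ℝ => (t : ℂ)⁻¹ • (Q.hsSemigroup t ξ - ξ)) (𝓝[>] 0) (𝓝 η)) :
    ∃ d : Q.L.domain, (d : HilbertSchmidt) = ξ ∧ Q.L d = η :=
  ⟨⟨ξ, η, h⟩, rfl, tendsto_nhds_unique (generator_spec Q.hsSemigroup ⟨ξ, η, h⟩) h⟩

theorem exists_domain_embedding_one :
    ∃ d : Q.L.domain, (d : HilbertSchmidt) = Q.embedding 1 ∧ Q.L d = 0 := by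
  refine Q.mem_domain_of_tendsto (tendsto_const_nhds.congr' ?_)
  filter_upwards [self_mem_nhdsWithin] with t ht
  rw [Q.hsSemigroup_embedding (le_of_lt ht), Q.qms_one (le_of_lt ht), sub_self, smul_zero]

/-- The spectral gap inequality for the generator. -/
theorem le_dirichletForm {g : ℝ} (hg0 : 0 ≤ g) (hg1 : g ≤ Q.gapRate)
    (hg : g * lerchPhi (Q.nu ^ 2) 1 Q.r ≤ Q.mu ^ 2) (ξ : Q.L.domain)
    (hξ : inner ℂ (Q.embedding 1) (ξ : HilbertSchmidt) = 0) :
    g * ‖(ξ : HilbertSchmidt)‖ ^ 2 ≤ dirichletForm Q.L ξ := by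
  set v := (ξ : HilbertSchmidt) with hv
  have h1 : Tendsto (fun t : ℝ => (inner ℂ v ((t : ℂ)⁻¹ • (Q.hsSemigroup t v - v))).re) (𝓝[>] 0)
      (𝓝 (inner ℂ v (Q.L ξ)).re) :=
    (Complex.continuous_re.tendsto _).comp
      (Tendsto.inner tendsto_const_nhds (generator_spec Q.hsSemigroup ξ))
  have h2 : Tendsto (fun t : ℝ => t⁻¹ * (Real.exp (-g * t) - 1) * ‖v‖ ^ 2) (𝓝[>] 0)
      (𝓝 (-g * ‖v‖ ^ 2)) := by
    have hd : HasDerivAt (fun t : ℝ => Real.exp (-g * t)) (-g) 0 := by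
      simpa using ((hasDerivAt_id (0 : ℝ)).const_mul (-g)).exp
    have := hd.tendsto_slope_zero_right
    simp only [zero_add, mul_zero, Real.exp_zero, smul_eq_mul] at this
    exact this.mul_const _
  -- Re ⟨v, T_t v⟩ lies below exp(-gt) ‖v‖² with equality at t = 0, so the same order holds for the
  -- right derivatives at 0.
  have h3 := le_of_tendsto_of_tendsto h1 h2 ?_
  · unfold dirichletForm
    rw [← hv]
    linarith
  · filter_upwards [self_mem_nhdsWithin] with t ht
    have ht0 : (0 : ℝ) < t := ht
    rw [inner_smul_right, ← Complex.ofReal_inv, Complex.re_ofReal_mul, inner_sub_right,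
      Complex.sub_re, mul_assoc]
    refine mul_le_mul_of_nonneg_left ?_ (by positivity)
    have h4 : (inner ℂ v (Q.hsSemigroup t v)).re ≤ Real.exp (-g * t) * ‖v‖ ^ 2 := by
      refine (Complex.re_le_norm _).trans ((norm_inner_le_norm _ _).trans ?_)
      have := mul_le_mul_of_nonneg_left (Q.norm_hsSemigroup_le hξ hg0 hg1 hg ht0.le) (norm_nonneg v)
      calc _ ≤ _ := this
        _ = _ := by ring
    have h5 : (inner ℂ v v).re = ‖v‖ ^ 2 := by
      rw [inner_self_eq_norm_sq_to_K]
      norm_cast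
    rw [h5]
    linarith

/-- The kernel of the generator is spanned by `ι(1)`. -/
theorem eq_smul_of_mem_kernel (hΦ : Q.gapRate * lerchPhi (Q.nu ^ 2) 1 Q.r ≤ Q.mu ^ 2)
    {ξ : HilbertSchmidt} (hξ : ξ ∈ kernel Q.L) :
    ξ = (inner ℂ (Q.embedding 1) ξ : ℂ) • Q.embedding 1 := by
  obtain ⟨d, hd, rfl⟩ := Submodule.mem_map.1 hξ
  obtain ⟨e, he1, he2⟩ := Q.exists_domain_embedding_one
  set c : ℂ := inner ℂ (Q.embedding 1) (d : HilbertSchmidt) with hc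
  have hd0 : Q.L d = 0 := hd
  -- The centred part is still in the kernel, so its Dirichlet form is 0, and the strictly positive
  -- gap forces it to vanish.
  have h1 : Q.L (d - c • e) = 0 := by
    rw [LinearPMap.map_sub, LinearPMap.map_smul, hd0, he2, smul_zero, sub_zero]
  have h2 : ((d - c • e : Q.L.domain) : HilbertSchmidt)
      = (d : HilbertSchmidt) - c • Q.embedding 1 := by
    rw [Submodule.coe_sub, Submodule.coe_smul, he1]
  have h3 := Q.le_dirichletForm Q.gapRate_pos.le le_rfl hΦ (d - c • e)
    (by rw [h2]; exact Q.inner_centre _)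
  rw [dirichletForm, h1, inner_zero_right, Complex.zero_re, neg_zero, h2] at h3
  have h4 : ‖(d : HilbertSchmidt) - c • Q.embedding 1‖ ^ 2 = 0 :=
    le_antisymm (nonpos_of_mul_nonpos_right h3 Q.gapRate_pos) (sq_nonneg _)
  rw [sq_eq_zero_iff, norm_eq_zero, sub_eq_zero] at h4
  exact h4

/-! ## An operator that attains the gap -/

/-- The weights of the shift that attains the gap. -/
def shiftCoeff (n : ℕ) : ℝ := √(n / (n + Q.r - 1))

theorem shiftCoeff_zero : Q.shiftCoeff 0 = 0 := by simp [shiftCoeff]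

theorem shiftCoeff_succ_sq (n : ℕ) : Q.shiftCoeff (n + 1) ^ 2 = (n + 1) / (n + Q.r) := by
  have hr := Q.r_pos
  have h : ((n + 1 : ℕ) : ℝ) / ((n + 1 : ℕ) + Q.r - 1) = (n + 1) / (n + Q.r) := by
    push_cast
    congr 1
    ring
  rw [shiftCoeff, h, Real.sq_sqrt (by positivity)]

/-- The weights are the equality case of the arithmetic-geometric split on the first off-diagonal.
With them every square root in the energy combines to an integer. -/
theorem sqrt_omega_mul_shiftCoeff (n : ℕ) : √(Q.omega n) * Q.shiftCoeff n = n := by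
  rcases n with _ | n
  · simp [shiftCoeff_zero]
  · have hr := Q.r_pos
    have h0 : (0 : ℝ) ≤ ((n + 1 : ℕ) : ℝ) := by positivity
    have hpos : (0 : ℝ) < (n + 1 : ℕ) + Q.r - 1 := by
      have : (0 : ℝ) ≤ n := n.cast_nonneg
      push_cast
      linarith
    rw [shiftCoeff, ← Real.sqrt_mul (Q.omega_nonneg _), ← Real.sqrt_sq h0, omega]
    congr 1
    rw [Real.sqrt_sq h0]
    field_simp

/-- The squared weights (n+1)/(n+r) are at most 1 + 1/r, so the extremal matrix belongs to a bounded
operator and needs no truncation. -/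
theorem exists_weighted_shift : ∃ x : FockSpace →L[ℂ] FockSpace, ∀ m n,
    coeff x m n = if n = m + 1 then (Q.shiftCoeff n : ℂ) else 0 := by
  have hr := Q.r_pos
  set A : Core →ₗ[ℂ] Core := Finsupp.linearCombination ℂ fun n =>
    Finsupp.single (n - 1) (Q.shiftCoeff n : ℂ) with hA
  have hAs : ∀ n, A (Finsupp.single n 1) = (Q.shiftCoeff n : ℂ) • Finsupp.single (n - 1) 1 := by
    intro n
    simp [hA]
  have hbd : ∀ u, ‖(incl ∘ₗ A) u‖ ≤ √(1 + 1 / Q.r) * ‖incl u‖ := by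
    intro u
    refine (abs_le_of_sq_le_sq' ?_ (by positivity)).2
    rw [mul_pow, Real.sq_sqrt (by positivity), LinearMap.comp_apply, norm_incl_sq, norm_incl_sq,
      qform_comp hAs (fun m n h h' => by
        have h3 : m = 0 ∨ n = 0 := by omega
        rcases h3 with h3 | h3 <;> simp [h3, shiftCoeff_zero])]
    have h1 : qform (fun _ => 1 + 1 / Q.r) u = (1 + 1 / Q.r) * qform (fun _ => 1) u := by
      unfold qform
      rw [Finsupp.mul_sum]
      exact Finsupp.sum_congr fun n _ => by ring
    rw [← h1]
    refine qform_mono (fun n => ?_) u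
    rw [mul_one, Complex.norm_real, Real.norm_eq_abs, sq_abs]
    rcases n with _ | n
    · rw [shiftCoeff_zero, zero_pow two_ne_zero]
      positivity
    · rw [shiftCoeff_succ_sq, div_le_iff₀ (by positivity)]
      have : (1 + 1 / Q.r) * (n + Q.r) = n + 1 + Q.r + n / Q.r := by
        field_simp
        ring
      rw [this]
      have : (0 : ℝ) ≤ n / Q.r := by positivity
      linarith
  refine ⟨(incl ∘ₗ A).extendOfNorm incl, fun m n => ?_⟩
  have h3 := (incl ∘ₗ A).extendOfNorm_eq denseRange_incl ⟨_, hbd⟩ (Finsupp.single n 1)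
  rw [incl_single, one_smul] at h3
  rw [coeff, h3, LinearMap.comp_apply, hAs, map_smul, incl_single, one_smul, inner_smul_right,
    inner_ket]
  rcases n with _ | n
  · simp [shiftCoeff_zero]
  · by_cases h : n = m
    · simp [h]
    · simp [h, Ne.symm h]

/-- Equality holds entry by entry, not only after summation. Only the real part is claimed: the
Hamiltonian adds imaginary terms that may vary along the off-diagonal, so this need not be an
eigenvector. -/
theorem energy_weighted_shift {x : FockSpace →L[ℂ] FockSpace}
    (hx : ∀ m n, coeff x m n = if n = m + 1 then (Q.shiftCoeff n : ℂ) else 0) (m n : ℕ) :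
    (starRingEnd ℂ (coeff x m n) * Q.lindblad (coeff x) m n).re
      = -(Q.gapRate * ‖coeff x m n‖ ^ 2) := by
  by_cases h : n = m + 1
  · subst h
    have hr := Q.r_pos
    set s := Q.shiftCoeff with hs
    have h1 : coeff x m (m + 1) = (s (m + 1) : ℂ) := by rw [hx, if_pos rfl]
    have h2 : coeff x (m + 1) (m + 1 + 1) = (s (m + 2) : ℂ) := by rw [hx, if_pos rfl]
    have h3 : ((Q.mu ^ 2 * (√(Q.omega m) * √(Q.omega (m + 1))) : ℝ) : ℂ) * coeff x (m - 1) (m + 1 - 1)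
        = ((Q.mu ^ 2 * (√(Q.omega m) * √(Q.omega (m + 1))) * s m : ℝ) : ℂ) := by
      rcases m with _ | m
      · simp [omega_zero]
      · rw [Nat.add_sub_cancel, Nat.add_sub_cancel, hx, if_pos rfl]
        push_cast
        rfl
    rw [lindblad, jump, h1, h2, h3, Complex.conj_ofReal, Complex.re_ofReal_mul, Complex.add_re,
      Complex.add_re, Complex.re_mul_ofReal, Complex.ofReal_re, Complex.re_ofReal_mul,
      Complex.ofReal_re, Complex.norm_real, Real.norm_eq_abs, sq_abs, drift, Complex.add_re,
      Complex.conj_re, gEig_re, gEig_re]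
    have e0 := Q.sqrt_omega_mul_shiftCoeff m
    have e1 := Q.sqrt_omega_mul_shiftCoeff (m + 1)
    have e2 := Q.sqrt_omega_mul_shiftCoeff (m + 2)
    rw [← hs] at e0 e1 e2
    have e3 : s (m + 1) * ((-Q.killRate m + -Q.killRate (m + 1)) * s (m + 1)
        + (Q.mu ^ 2 * (√(Q.omega m) * √(Q.omega (m + 1))) * s m
          + Q.lam ^ 2 * (√(Q.omega (m + 1)) * √(Q.omega (m + 1 + 1))) * s (m + 2)))
        = -(Q.killRate m + Q.killRate (m + 1)) * s (m + 1) ^ 2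
          + (√(Q.omega (m + 1)) * s (m + 1)) * (Q.mu ^ 2 * (√(Q.omega m) * s m)
            + Q.lam ^ 2 * (√(Q.omega (m + 2)) * s (m + 2))) := by ring
    rw [e3, e0, e1, e2, hs, shiftCoeff_succ_sq, gapRate_eq, killRate, killRate]
    simp only [omega]
    push_cast
    have hpos : (0 : ℝ) < m + Q.r := by positivity
    field_simp
    ring
  · rw [hx, if_neg h]
    simp

theorem exists_attaining (hΦ : Q.gapRate * lerchPhi (Q.nu ^ 2) 1 Q.r ≤ Q.mu ^ 2) :
    ∃ ξ : Q.L.domain, ‖(ξ : HilbertSchmidt)‖ = 1 ∧ (ξ : HilbertSchmidt) ∈ (kernel Q.L)ᗮ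
      ∧ dirichletForm Q.L ξ = Q.gapRate := by
  obtain ⟨x, hx⟩ := Q.exists_weighted_shift
  obtain ⟨η, hη, hlim⟩ := Q.exists_tendsto_embedding x
  obtain ⟨d, hd1, hd2⟩ := Q.mem_domain_of_tendsto hlim
  have hr := Q.r_pos
  have hne : Q.embedding x ≠ 0 := by
    intro h
    have h1 := Q.coeff_embedding x 0 1
    rw [h, map_zero, hx, if_pos rfl] at h1
    have h2 : (√(Q.weight 0 1) : ℂ) * (Q.shiftCoeff 1 : ℂ) = 0 := by
      rw [← h1]
      simp [coeff]
    have h3 : Q.shiftCoeff 1 ≠ 0 := by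
      have := Q.shiftCoeff_succ_sq 0
      intro h0
      rw [zero_add, h0] at this
      have h4 : (0 : ℝ) < ((0 : ℕ) + 1) / ((0 : ℕ) + Q.r) := by positivity
      rw [← this] at h4
      simp at h4
    have h4 := (Real.sqrt_pos.2 (Q.weight_pos 0 1)).ne'
    rcases mul_eq_zero.1 h2 with h5 | h5
    · exact h4 (by exact_mod_cast h5)
    · exact h3 (by exact_mod_cast h5)
  have hinner : (inner ℂ (Q.embedding x) η).re = -(Q.gapRate * ‖Q.embedding x‖ ^ 2) := by
    have h1 := (hasSum_inner (Q.embedding x) η).mapL Complex.reCLM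
    have h2 : ∀ p : ℕ × ℕ, Complex.reCLM (starRingEnd ℂ (coeff (toOp (Q.embedding x)) p.1 p.2)
        * coeff (toOp η) p.1 p.2) = -Q.gapRate * ‖coeff (toOp (Q.embedding x)) p.1 p.2‖ ^ 2 := by
      intro p
      have h3 := Q.energy_weighted_shift hx p.1 p.2
      have h4 := Real.mul_self_sqrt (Q.weight_pos p.1 p.2).le
      rw [hη, coeff_embedding, norm_sqrt_weight_mul_sq, Complex.reCLM_apply, map_mul,
        Complex.conj_ofReal, mul_mul_mul_comm, ← Complex.ofReal_mul, h4, Complex.re_ofReal_mul, h3]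
      ring
    simp only [h2] at h1
    have h5 := h1.unique ((hasSum_norm (Q.embedding x)).mul_left (-Q.gapRate))
    rw [Complex.reCLM_apply] at h5
    rw [h5]
    ring
  -- The shift has zero diagonal, hence zero mean.
  have hort : inner ℂ (Q.embedding 1) (Q.embedding x) = 0 := by
    rw [inner_embedding_one]
    simp [hx]
  set c : ℂ := ((‖Q.embedding x‖⁻¹ : ℝ) : ℂ) with hc
  have hn : ‖Q.embedding x‖ ≠ 0 := norm_ne_zero_iff.2 hne
  refine ⟨c • d, ?_, ?_, ?_⟩
  · rw [Submodule.coe_smul, hd1, norm_smul, hc, Complex.norm_real, norm_inv, norm_norm,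
      inv_mul_cancel₀ hn]
  · rw [Submodule.mem_orthogonal]
    intro ζ hζ
    rw [Q.eq_smul_of_mem_kernel hΦ hζ, Submodule.coe_smul, hd1, inner_smul_left, inner_smul_right,
      hort, mul_zero, mul_zero]
  · rw [dirichletForm, LinearPMap.map_smul, Submodule.coe_smul, hd1, hd2, inner_smul_left,
      inner_smul_right, ← mul_assoc, hc, Complex.conj_ofReal, ← Complex.ofReal_mul,
      Complex.re_ofReal_mul, hinner]
    field_simp

theorem spectralGap_eq (hΦ : Q.gapRate * lerchPhi (Q.nu ^ 2) 1 Q.r ≤ Q.mu ^ 2) :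
    spectralGap Q.L = Q.gapRate := by
  refine IsLeast.csInf_eq ⟨Q.exists_attaining hΦ, ?_⟩
  rintro a ⟨ξ, hξ1, hξ2, rfl⟩
  obtain ⟨e, he1, he2⟩ := Q.exists_domain_embedding_one
  have hk : Q.embedding 1 ∈ kernel Q.L := Submodule.mem_map.2 ⟨e, he2, he1⟩
  have h := Q.le_dirichletForm Q.gapRate_pos.le le_rfl hΦ ξ (hξ2 _ hk)
  rwa [hξ1, one_pow, mul_one] at h

end QuadraticOscillator

end

/-! ### The gap under the Lerch condition and for large r -/

theorem theorem5 (Q : QuadraticOscillator) :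
    ((2 * Q.nu ^ 2 + Q.r * (1 - Q.nu ^ 2)) * lerchPhi (Q.nu ^ 2) 1 Q.r ≤ 2 →
      spectralGap Q.L = Q.mu ^ 2 / 2 * (2 * Q.nu ^ 2 + Q.r * (1 - Q.nu ^ 2))) ∧
    (2 * Q.nu ^ 2 / (1 - Q.nu ^ 2) ≤ Q.r →
      spectralGap Q.L = Q.mu ^ 2 / 2 * (2 * Q.nu ^ 2 + Q.r * (1 - Q.nu ^ 2))) := by
  have main : (2 * Q.nu ^ 2 + Q.r * (1 - Q.nu ^ 2)) * lerchPhi (Q.nu ^ 2) 1 Q.r ≤ 2 →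
      spectralGap Q.L = Q.mu ^ 2 / 2 * (2 * Q.nu ^ 2 + Q.r * (1 - Q.nu ^ 2)) := by
    intro h
    refine Q.spectralGap_eq ?_
    have h1 := mul_le_mul_of_nonneg_left h (by positivity : 0 ≤ Q.mu ^ 2 / 2)
    unfold QuadraticOscillator.gapRate
    linarith
  refine ⟨main, fun h => main ?_⟩
  have hp0 : 0 < Q.nu ^ 2 := pow_pos Q.nu_pos 2
  have hq := Q.one_sub_nu_sq_pos
  have hr := Q.r_pos
  rw [div_le_iff₀ hq] at h
  have h1 := lerchPhi_le hp0 (by linarith) hr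
  -- The assumption on r says 2ν² ≤ r(1-ν²), and Φ ≤ 1/(r(1-ν²)) by comparison with a geometric
  -- series; the product is then at most 2.
  have h2 : 2 * Q.nu ^ 2 + Q.r * (1 - Q.nu ^ 2) ≤ 2 * (Q.r * (1 - Q.nu ^ 2)) := by linarith
  calc _ ≤ (2 * Q.nu ^ 2 + Q.r * (1 - Q.nu ^ 2)) * (1 / (Q.r * (1 - Q.nu ^ 2))) := by gcongr
    _ ≤ 2 * (Q.r * (1 - Q.nu ^ 2)) * (1 / (Q.r * (1 - Q.nu ^ 2))) := by gcongr
    _ = 2 := by field_simp
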